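/- Let $\alpha\in(\tfrac43,2]$ and let $X=(X_t)_{t\ge 0}$ be a real-valued symmetric $\alpha$-stable process on a probability space $(\Omega,\mathcal F,\mathbb P)$. That is, $X$ is a Lévy process ($X_0=0$ a.s., independent and stationary increments, a.s. càdlàg paths) such that $X_1$ is symmetric, not a.s. $0$, and strictly stable of index $\alpha$: for all $A,B>0$ and independent copies $X_1^{(1)},X_1^{(2)}$ of $X_1$, one has $AX_1^{(1)}+BX_1^{(2)}\overset{d}{=}(A^\alpha+B^\alpha)^{1/\alpha}X_1$. For $\varepsilon>0$ put $$\hat\theta_\varepsilon=\frac{i}{2\pi}\int_0^1\int_0^t\int_{\mathbb R}p\,e^{ip(X_t-X_s)}e^{-\varepsilon p^2/2}\,dp\,ds\,dt .$$ A real random variable $\hat\theta$ is called the derivative of self-intersection local time (DSLT) of $X$ on $[0,1]$ if $\hat\theta_\varepsilon\to\hat\theta$ in $L^q(\mathbb P)$ as $\varepsilon\downarrow0$ for every $q\in(0,\infty)$. (i) If $\alpha>\tfrac32$, the DSLT of $X$ on $[0,1]$ exists. (ii) If $\alpha\in(\tfrac43,2]$ and $\hat\theta$ is the DSLT of $X$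 on $[0,1]$, then for every $\gamma\in\left[0,\tfrac{2\alpha}{6+\alpha}\right)$ there is a constant $M>0$ such that $\mathbb E\left[\exp\left(M|\hat\theta|^\gamma\right)\right]<\infty$. -/

import Mathlib

open MeasureTheory ProbabilityTheory Filter Topology
open scoped NNReal ENNReal

/-- A real valued Lévy process `X = (X_t)_{t ≥ 0}` on the probability space `(Ω, P)`: it starts at
`0`, its increments are independent and stationary, and almost all its paths are càdlàg. -/
structure IsLevyProcess {Ω : Type*} [MeasurableSpace Ω] (X : ℝ≥0 → Ω → ℝ) (P : Measure Ω) :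
    Prop where
  measurable : ∀ t, Measurable (X t)
  zero : ∀ᵐ ω ∂P, X 0 ω = 0
  indep : HasIndepIncrements X P
  stationary : ∀ s t, IdentDistrib (fun ω => X (s + t) ω - X s ω) (X t) P P
  cadlag : ∀ᵐ ω ∂P,
    (∀ t, ContinuousWithinAt (fun s => X s ω) (Set.Ici t) t) ∧
      ∀ t, 0 < t → ∃ l, Tendsto (fun s => X s ω) (𝓝[<] t) (𝓝 l)

/-- `μ` is the law of a strictly stable real random variable `Z` with index of stability `α`: if
`Z₁, Z₂` are independent copies of `Z` and `A, B > 0`, then `A Z₁ + B Z₂` has the law of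
`(A ^ α + B ^ α) ^ (1 / α) Z`. -/
def IsStrictlyStable (α : ℝ) (μ : Measure ℝ) : Prop :=
  ∀ A B : ℝ, 0 < A → 0 < B →
    (μ.map (fun x => A * x)).conv (μ.map (fun x => B * x)) =
      μ.map (fun x => (A ^ α + B ^ α) ^ (1 / α) * x)

/-- A symmetric `α`-stable process: a Lévy process `X` for which `X_1` is strictly stable with index
of stability `α`, symmetric, and not almost surely equal to `0`. -/
structure IsSymmetricStableProcess {Ω : Type*} [MeasurableSpace Ω] (α : ℝ) (X : ℝ≥0 → Ω → ℝ)
    (P : Measure Ω) : Prop where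
  levy : IsLevyProcess X P
  stable : IsStrictlyStable α (P.map (X 1))
  symmetric : IdentDistrib (fun ω => -X 1 ω) (X 1) P P
  nondegenerate : ¬ ∀ᵐ ω ∂P, X 1 ω = 0

/-- The approximation `(i / 2π) ∫₀¹ ∫₀ᵗ ∫_ℝ p e^{i p (X_t - X_s)} e^{-ε p² / 2} dp ds dt` of the
derivative of self-intersection local time on `[0, 1]`, which is `∫₀¹ ∫₀ᵗ ρ_ε'(X_t - X_s) ds dt`
for the Gaussian density `ρ_ε` with mean `0` and variance `ε`. -/
noncomputable def dsltApprox {Ω : Type*} (X : ℝ≥0 → Ω → ℝ) (ε : ℝ) (ω : Ω) : ℂ :=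
  Complex.I / (2 * Real.pi) *
    ∫ t in (0 : ℝ)..1, ∫ s in (0 : ℝ)..t, ∫ p : ℝ,
      (p : ℂ) * Complex.exp (Complex.I * p * (X t.toNNReal ω - X s.toNNReal ω : ℝ)) *
        Complex.exp (-(ε * p ^ 2 / 2 : ℝ))

/-- `θ` is the derivative of self-intersection local time of `X` on `[0, 1]`: the limit of the
approximations, as `ε ↓ 0`, in `L^q` for all `0 < q < ∞`. -/
structure IsDSLT {Ω : Type*} [MeasurableSpace Ω] (X : ℝ≥0 → Ω → ℝ) (P : Measure Ω)
    (θ : Ω → ℝ) : Prop where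
  aemeasurable : AEMeasurable θ P
  tendsto : ∀ q : ℝ≥0, 0 < q →
    Tendsto (fun ε : ℝ => eLpNorm (fun ω => dsltApprox X ε ω - (θ ω : ℂ)) q P) (𝓝[>] 0) (𝓝 0)

/-! The threshold is `α = 3/2`. Above it the DSLT exists and `exp (M |θ| ^ γ)` is integrable for
every `γ ≤ 1/2`, which covers the claimed range because `2α / (6 + α) ≤ 1/2` for `α ≤ 2`. At or
below it there is no DSLT, so that (ii) is vacuous there.

Case `α > 3/2`. The increment over a time `u` has characteristic function `exp (-κ |p| ^ α u)`. Let
`g` be the Fourier transform of `c` with `|c p| ≤ A |p| ^ r`. Over a square `(a, a + h] × (a - h,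
a]` the increment `Y_t - Y_s` splits at time `a` into two independent pieces. The `n`-th moment of
the integral of `g (Y_t - Y_s)` is then an integral over `n` frequencies of a product of two
expectations. Sorting the times and summing by parts bounds each expectation by a sum over `n!`
orderings of products in the tail sums of the frequencies. Cauchy-Schwarz and scaling give `n!² (C A
h ^ β) ^ n` with `β = 2 - (r + 1) / α`, finite when `r < α - 1/2`
(`IsStableMotion.abs_integral_square_pow_le`).

The triangle of times is two half-size triangles and a square. The triangles give independent
centred variables when `c` is odd, so their sum costs a factor `√2` and not `2` in the moment scale
(`HasFactorialMoments.add_of_indepFun`). As `√2 · 2 ^ (-β) < 1`, the recursion over dyadic scales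
closes (`IsStableMotion.exists_hasFactorialMoments_timeTriangle`). With `r = 1` this bounds the
`2m`-th moments of the approximations by `k ^ (2m) (2m)!²`, which is integrability of `exp (M
√|θ|)`. With `r` slightly above `1` it bounds differences of approximations by a power of `ε`, which
gives convergence in every `L^q`.

Case `α ≤ 3/2`. The second moment of an approximation is an integral over two frequencies and two
pairs of times whose integrand turns out to be nonnegative. Frequencies `p ≤ q ≤ p + 1` and nested
time intervals whose endpoints differ by at most `p ^ (-α)` already contribute at least a constant
times `∫ p ^ (2 - 2α) dp ≥ ∫ dp / p`, up to a cutoff of order `ε ^ (-1/2)`. Hence the second moments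
diverge logarithmically (`IsStableMotion.log_le_integral_realApprox_sq`), which excludes an `L²`
limit. -/

section TriangularChange

/-! ### Unimodular changes of variables: times to increments, frequencies to tail sums -/

theorem lintegral_pi_prod_eq_prod_lintegral {n : ℕ} (G : Fin n → ℝ → ℝ≥0∞)
    (hG : ∀ j, Measurable (G j)) :
    ∫⁻ v : Fin n → ℝ, ∏ j, G j (v j) = ∏ j, ∫⁻ x, G j x := by
  induction n with
  | zero => simp [volume_pi]
  | succ n ih =>
    rw [← ((volume_preserving_piFinSuccAbove (fun _ : Fin (n + 1) => ℝ) 0).symm).lintegral_comp_emb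
      (MeasurableEquiv.measurableEmbedding _)]
    simp only [Fin.prod_univ_succ, MeasurableEquiv.piFinSuccAbove_symm_apply,
      Fin.insertNthEquiv, Equiv.coe_fn_mk, Fin.insertNth_zero, Fin.cons_zero, Fin.cons_succ,
      Fin.zero_succAbove, cast_eq]
    rw [Measure.volume_eq_prod, lintegral_prod_mul (f := G 0)
      (g := fun v : Fin n → ℝ => ∏ j, G j.succ (v j)) (hG 0).aemeasurable, ih _ fun j => hG _]
    exact (Finset.measurable_prod _ fun j _ => (hG _).comp (measurable_pi_apply j)).aemeasurable

theorem measurePreserving_mulVec_of_det_eq_one {n : ℕ} (M : Matrix (Fin n) (Fin n) ℝ)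
    (hM : M.det = 1) : MeasurePreserving (fun v : Fin n → ℝ => M.mulVec v) := by
  have h := Real.map_matrix_volume_pi_eq_smul_volume_pi (M := M) (by rw [hM]; exact one_ne_zero)
  rw [hM] at h
  simp only [inv_one, abs_one, ENNReal.ofReal_one, one_smul] at h
  exact ⟨(Matrix.toLin' M).continuous_on_pi.measurable, h⟩

/-- Applied to two triangular matrices with unit diagonal: times to increments, and frequencies to
tail sums. In the new variables the integrands factorise. -/
theorem lintegral_prod_mulVec {n : ℕ} (M : Matrix (Fin n) (Fin n) ℝ)
    (hM : M.det = 1) (G : Fin n → ℝ → ℝ≥0∞) (hG : ∀ j, Measurable (G j)) :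
    ∫⁻ v : Fin n → ℝ, ∏ j, G j (M.mulVec v j) = ∏ j, ∫⁻ x, G j x := by
  rw [← lintegral_pi_prod_eq_prod_lintegral G hG]
  exact (measurePreserving_mulVec_of_det_eq_one M hM).lintegral_comp
    (Finset.measurable_prod _ fun j _ => (hG _).comp (measurable_pi_apply j))

/-- The entry of `v` before the `j`-th one, with `0` before the first. -/
def prevEntry {n : ℕ} (v : Fin n → ℝ) (j : Fin n) : ℝ := (Fin.cons 0 v : Fin (n + 1) → ℝ) j.castSucc

/-- The sum of the entries of `p` from the `j`-th one on. -/
def tailSum {n : ℕ} (p : Fin n → ℝ) (j : Fin n) : ℝ := ∑ i ∈ Finset.Ici j, p i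

theorem prevEntry_zero {n : ℕ} (v : Fin (n + 1) → ℝ) : prevEntry v 0 = 0 := rfl

theorem prevEntry_succ {n : ℕ} (v : Fin (n + 1) → ℝ) (j : Fin n) :
    prevEntry v j.succ = v j.castSucc := rfl

theorem lintegral_prod_increments {n : ℕ} (G : Fin n → ℝ → ℝ≥0∞) (hG : ∀ j, Measurable (G j)) :
    ∫⁻ v : Fin n → ℝ, ∏ j, G j (v j - prevEntry v j) = ∏ j, ∫⁻ x, G j x := by
  let M : Matrix (Fin n) (Fin n) ℝ :=
    fun i j => (if i = j then 1 else 0) - (if (j : ℕ) + 1 = i then 1 else 0)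
  have hdet : M.det = 1 := by
    rw [Matrix.det_of_isLowerTriangular M]
    · exact Finset.prod_eq_one fun i _ => by simp [M]
    · intro i j hij
      have hij : i < j := hij
      have h1 : i ≠ j := hij.ne
      have h2 : ¬ (j : ℕ) + 1 = i := by have := Fin.lt_def.1 hij; omega
      simp [M, h1, h2]
  rw [← lintegral_prod_mulVec M hdet G hG]
  congr 1
  funext v
  refine Finset.prod_congr rfl fun j _ => ?_
  congr 1
  simp only [Matrix.mulVec, dotProduct, M, sub_mul, Finset.sum_sub_distrib, ite_mul, one_mul,
    zero_mul, Finset.sum_ite_eq, Finset.mem_univ, if_true]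
  congr 1
  cases n with
  | zero => exact j.elim0
  | succ n =>
    refine Fin.cases ?_ (fun i => ?_) j
    · simp [prevEntry_zero]
    · rw [prevEntry_succ, Finset.sum_eq_single i.castSucc]
      · simp
      · intro b _ hb
        rw [if_neg]
        intro h
        apply hb
        ext
        simpa using h
      · simp

theorem lintegral_prod_tailSum {n : ℕ} (G : Fin n → ℝ → ℝ≥0∞) (hG : ∀ j, Measurable (G j)) :
    ∫⁻ p : Fin n → ℝ, ∏ j, G j (tailSum p j) = ∏ j, ∫⁻ x, G j x := by
  let M : Matrix (Fin n) (Fin n) ℝ := fun i j => if i ≤ j then 1 else 0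
  have hdet : M.det = 1 := by
    rw [Matrix.det_of_isUpperTriangular (M := M)]
    · exact Finset.prod_eq_one fun i _ => by simp [M]
    · intro i j hij
      have hij : j < i := hij
      simp [M, hij]
  rw [← lintegral_prod_mulVec M hdet G hG]
  congr 1
  funext v
  refine Finset.prod_congr rfl fun j _ => ?_
  congr 1
  simp only [Matrix.mulVec, dotProduct, M, ite_mul, one_mul, zero_mul, tailSum]
  rw [← Finset.sum_filter]
  congr 1
  ext i
  simp

/-- Abel summation. It turns a linear combination of path values at sorted times into one of
successive increments, which are independent. -/
theorem sum_mul_eq_sum_tailSum_mul_increment {n : ℕ} (p v : Fin n → ℝ) (z : ℝ → ℝ) :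
    ∑ j, p j * (z (v j) - z 0) = ∑ j, tailSum p j * (z (v j) - z (prevEntry v j)) := by
  have key : ∀ j : Fin n, z (v j) - z 0 = ∑ i ∈ Finset.Iic j, (z (v i) - z (prevEntry v i)) := by
    intro j
    cases n with
    | zero => exact j.elim0
    | succ n =>
      refine Fin.induction ?_ (fun i ih => ?_) j
      · have : Finset.Iic (0 : Fin (n + 1)) = {0} := by ext x; simp
        simp [this, prevEntry_zero]
      · have : Finset.Iic i.succ = insert i.succ (Finset.Iic i.castSucc) := by
          ext x
          simp only [Finset.mem_Iic, Finset.mem_insert, Fin.le_def, Fin.ext_iff]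
          simp only [Fin.val_succ, Fin.val_castSucc]
          omega
        rw [this, Finset.sum_insert (by simp), ← ih, prevEntry_succ]
        ring
  simp_rw [key, tailSum, Finset.mul_sum, Finset.sum_mul]
  exact Finset.sum_comm' (fun x y => by simp)

/-- Each `p j` is a difference of consecutive tail sums, and `|x - y| ≤ L (1 + |x| / L) (1 + |y| /
L)`. Every tail sum enters at most two of these differences, whence the exponent `2 * r`. The scale
`L` is free and is later matched to the side of the square. -/
theorem prod_rpow_abs_le_prod_tailSum {n : ℕ} (p : Fin n → ℝ) {r L : ℝ} (hr : 0 ≤ r) (hL : 0 < L) :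
    ∏ j, |p j| ^ r ≤ ∏ j, (L ^ r * (1 + |tailSum p j| / L) ^ (2 * r)) := by
  have hone : ∀ x : ℝ, 1 ≤ 1 + |x| / L := fun x => le_add_of_nonneg_right (by positivity)
  have base : ∀ x y : ℝ, |x - y| ^ r ≤ L ^ r * ((1 + |x| / L) ^ r * (1 + |y| / L) ^ r) := by
    intro x y
    rw [← Real.mul_rpow (by positivity) (by positivity), ← Real.mul_rpow hL.le (by positivity)]
    refine Real.rpow_le_rpow (abs_nonneg _) ?_ hr
    have h1 : |x - y| ≤ |x| + |y| := abs_sub x y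
    have h2 : L * ((1 + |x| / L) * (1 + |y| / L)) = L + |x| + |y| + |x| * |y| / L := by
      field_simp
      ring
    have h3 : 0 ≤ |x| * |y| / L := by positivity
    linarith
  have hsplit : ∀ x : ℝ, (1 + |x| / L) ^ (2 * r) = (1 + |x| / L) ^ r * (1 + |x| / L) ^ r :=
    fun x => by rw [← Real.rpow_add (by positivity), two_mul]
  cases n with
  | zero => simp
  | succ n =>
    have hcast : ∀ i : Fin n, p i.castSucc = tailSum p i.castSucc - tailSum p i.succ := by
      intro i
      have : Finset.Ici i.castSucc = insert i.castSucc (Finset.Ici i.succ) := by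
        ext x
        simp only [Finset.mem_Ici, Finset.mem_insert, Fin.le_def, Fin.ext_iff]
        simp only [Fin.val_succ, Fin.val_castSucc]
        omega
      rw [tailSum, tailSum, this, Finset.sum_insert (by simp)]
      ring
    have hlast : p (Fin.last n) = tailSum p (Fin.last n) - 0 := by
      have : Finset.Ici (Fin.last n) = {Fin.last n} := by
        ext x
        simp [Fin.last_le_iff]
      simp [tailSum, this]
    simp only [hsplit]
    have hpos : ∀ j, 0 ≤ (1 + |tailSum p j| / L) ^ r := fun j => by positivity
    have hge : ∀ j, 1 ≤ (1 + |tailSum p j| / L) ^ r := fun j => Real.one_le_rpow (hone _) hr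
    calc ∏ j, |p j| ^ r
        = (∏ i : Fin n, |p i.castSucc| ^ r) * |p (Fin.last n)| ^ r := Fin.prod_univ_castSucc _
      _ ≤ (∏ i : Fin n, (L ^ r * ((1 + |tailSum p i.castSucc| / L) ^ r *
            (1 + |tailSum p i.succ| / L) ^ r))) * (L ^ r * (1 + |tailSum p (Fin.last n)| / L) ^ r)
            := by
          gcongr with i _
          · rw [hcast i]
            exact base _ _
          · rw [hlast]
            have := base (tailSum p (Fin.last n)) 0
            simpa using this
      _ = L ^ r * (∏ i : Fin n, L ^ r) * (∏ j, (1 + |tailSum p j| / L) ^ r) *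
            ∏ i : Fin n, (1 + |tailSum p i.succ| / L) ^ r := by
          rw [Fin.prod_univ_castSucc (fun j => (1 + |tailSum p j| / L) ^ r),
            Finset.prod_mul_distrib, Finset.prod_mul_distrib]
          ring
      _ ≤ L ^ r * (∏ i : Fin n, L ^ r) * (∏ j, (1 + |tailSum p j| / L) ^ r) *
            ∏ j, (1 + |tailSum p j| / L) ^ r := by
          refine mul_le_mul_of_nonneg_left ?_ (mul_nonneg (by positivity)
            (Finset.prod_nonneg fun j _ => hpos j))
          rw [Fin.prod_univ_succ]
          exact le_mul_of_one_le_left (Finset.prod_nonneg fun j _ => hpos _) (hge 0)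
      _ = ∏ j, (L ^ r * ((1 + |tailSum p j| / L) ^ r * (1 + |tailSum p j| / L) ^ r)) := by
          rw [Finset.prod_mul_distrib, Finset.prod_mul_distrib, Finset.prod_const]
          simp only [Finset.prod_const, Finset.card_univ, Fintype.card_fin]
          ring

end TriangularChange

/-! ### Characteristic functions of a symmetric stable process -/

section StableCharFun

/-- Cauchy's functional equation. Values are squares, hence nonnegative; a zero at `y` would
propagate to every `y / (n + 1)` and contradict right continuity at `0`. Positive rationals follow
by taking roots, and reals by approximation from the right. -/
theorem eq_rpow_of_mul_of_rightContinuous {f : ℝ → ℝ} (h0 : f 0 = 1)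
    (hmul : ∀ x y, 0 ≤ x → 0 ≤ y → f (x + y) = f x * f y)
    (hcont : ∀ x, 0 ≤ x → ContinuousWithinAt f (Set.Ici x) x) {x : ℝ} (hx : 0 ≤ x) :
    0 < f 1 ∧ f x = f 1 ^ x := by
  have hnat : ∀ (n : ℕ) (y : ℝ), 0 ≤ y → f (n * y) = f y ^ n := by
    intro n y hy
    induction n with
    | zero => simp [h0]
    | succ n ih =>
      rw [Nat.cast_succ, add_mul, one_mul, hmul _ _ (by positivity) hy, ih, pow_succ]
  have hnn : ∀ y, 0 ≤ y → 0 ≤ f y := by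
    intro y hy
    have := hmul (y / 2) (y / 2) (by positivity) (by positivity)
    rw [add_halves] at this
    rw [this]
    exact mul_self_nonneg _
  have hpos : ∀ y, 0 ≤ y → 0 < f y := by
    intro y hy
    refine lt_of_le_of_ne (hnn y hy) fun hzero => ?_
    have hz : ∀ n : ℕ, f (y / ((n : ℝ) + 1)) = 0 := by
      intro n
      have := hnat (n + 1) (y / ((n : ℝ) + 1)) (by positivity)
      rw [Nat.cast_succ, mul_div_cancel₀ _ (by positivity), ← hzero] at this
      exact pow_eq_zero_iff (Nat.succ_ne_zero n) |>.1 this.symm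
    have ht : Tendsto (fun n : ℕ => y / ((n : ℝ) + 1)) atTop (𝓝[Set.Ici 0] 0) := by
      refine tendsto_nhdsWithin_iff.2 ⟨?_, Eventually.of_forall fun n => ?_⟩
      · exact tendsto_const_nhds.div_atTop
          (tendsto_atTop_add_const_right _ _ tendsto_natCast_atTop_atTop)
      · exact Set.mem_Ici.2 (by positivity)
    have := (hcont 0 le_rfl).tendsto.comp ht
    simp only [Function.comp_def, hz, h0] at this
    exact zero_ne_one (tendsto_nhds_unique tendsto_const_nhds this)
  refine ⟨hpos 1 zero_le_one, ?_⟩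
  have hrat : ∀ m n : ℕ, 0 < n → f ((m : ℝ) / n) = f 1 ^ ((m : ℝ) / n) := by
    intro m n hn
    have h1 := hnat n ((m : ℝ) / n) (by positivity)
    rw [mul_div_cancel₀ _ (by positivity)] at h1
    have h2 := hnat m 1 zero_le_one
    rw [mul_one] at h2
    have h3 : (f 1 ^ ((m : ℝ) / n)) ^ n = f 1 ^ m := by
      rw [← Real.rpow_natCast (f 1 ^ ((m : ℝ) / n)), ← Real.rpow_mul (hpos 1 zero_le_one).le,
        div_mul_cancel₀ _ (by positivity), Real.rpow_natCast]
    refine (pow_left_inj₀ (hnn _ (by positivity)) (Real.rpow_nonneg (hnn 1 zero_le_one) _)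
      hn.ne').1 ?_
    rw [← h1, h2, h3]
  have hlim : Tendsto (fun n : ℕ => (⌈x * n⌉₊ : ℝ) / n) atTop (𝓝 x) :=
    (tendsto_nat_ceil_mul_div_atTop hx).comp tendsto_natCast_atTop_atTop
  have hlim' : Tendsto (fun n : ℕ => (⌈x * n⌉₊ : ℝ) / n) atTop (𝓝[Set.Ici x] x) := by
    refine tendsto_nhdsWithin_iff.2 ⟨hlim, ?_⟩
    filter_upwards [eventually_gt_atTop 0] with n hn
    rw [Set.mem_Ici, le_div_iff₀ (by positivity)]
    exact Nat.le_ceil _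
  have e1 := (hcont x hx).tendsto.comp hlim'
  have e2 : Tendsto (fun n : ℕ => f 1 ^ ((⌈x * n⌉₊ : ℝ) / n)) atTop (𝓝 (f 1 ^ x)) :=
    ((Real.continuous_const_rpow (hpos 1 zero_le_one).ne').tendsto x).comp hlim
  refine tendsto_nhds_unique e1 (e2.congr' ?_)
  filter_upwards [eventually_gt_atTop 0] with n hn
  exact (hrat _ n hn).symm

variable {Ω : Type*} [MeasurableSpace Ω] {P : Measure Ω} [IsProbabilityMeasure P] {α : ℝ}
  {X : ℝ≥0 → Ω → ℝ}

/-- The law of `X_1` has characteristic function `exp (-κ |p| ^ α)` for some `κ > 0`. -/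
theorem IsSymmetricStableProcess.exists_charFun_one (hα : 0 < α)
    (hX : IsSymmetricStableProcess α X P) :
    ∃ κ : ℝ, 0 < κ ∧ ∀ p, charFun (P.map (X 1)) p = Complex.exp (-(κ * |p| ^ α : ℝ)) := by
  set μ := P.map (X 1) with hμ
  have hm : Measurable (X 1) := hX.levy.measurable 1
  have : IsProbabilityMeasure μ := Measure.isProbabilityMeasure_map hm.aemeasurable
  have heven : ∀ p, charFun μ (-p) = charFun μ p := by
    intro p
    have h := hX.symmetric.map_eq
    conv_rhs => rw [hμ, ← h]
    have h1 : P.map (fun ω => -X 1 ω) = μ.map (fun x => (-1) * x) := by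
      rw [hμ, Measure.map_map (by fun_prop) hm]
      congr 1
      funext ω
      simp
    rw [h1, charFun_map_mul, neg_one_mul]
  have hreal : ∀ p, ((charFun μ p).re : ℂ) = charFun μ p := by
    intro p
    refine Complex.conj_eq_iff_re.1 ?_
    rw [← charFun_neg, heven]
  have hmul : ∀ A B p : ℝ, 0 < A → 0 < B → charFun μ (A * p) * charFun μ (B * p) =
      charFun μ ((A ^ α + B ^ α) ^ (1 / α) * p) := by
    intro A B p hA hB
    have h := congrArg (fun ν => charFun ν p) (hX.stable A B hA hB)
    have i1 : IsFiniteMeasure (μ.map (fun x => A * x)) := inferInstance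
    simpa only [charFun_conv, charFun_map_mul] using h
  have hcont : Continuous (charFun μ) := continuous_charFun
  -- In the variable `x = |p| ^ α` strict stability becomes multiplicativity.
  let f : ℝ → ℝ := fun x => (charFun μ (x ^ (1 / α))).re
  have hf0 : f 0 = 1 := by
    simp [f, hα.ne']
  have hfmul : ∀ x y, 0 ≤ x → 0 ≤ y → f (x + y) = f x * f y := by
    intro x y hx hy
    rcases hx.eq_or_lt with rfl | hx
    · simp [hf0]
    rcases hy.eq_or_lt with rfl | hy
    · simp [hf0]
    have h := hmul (x ^ (1 / α)) (y ^ (1 / α)) 1 (by positivity) (by positivity)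
    rw [mul_one, mul_one, mul_one, ← Real.rpow_mul hx.le, ← Real.rpow_mul hy.le,
      one_div_mul_cancel hα.ne', Real.rpow_one, Real.rpow_one] at h
    simp only [f]
    rw [← h, ← hreal (x ^ (1 / α)), ← hreal (y ^ (1 / α)), ← Complex.ofReal_mul,
      Complex.ofReal_re, Complex.ofReal_re, Complex.ofReal_re]
  have hfcont : Continuous f :=
    Complex.continuous_re.comp (hcont.comp (Real.continuous_rpow_const (one_div_pos.2 hα).le))
  have key : ∀ x, 0 ≤ x → 0 < f 1 ∧ f x = f 1 ^ x := fun x hx =>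
    eq_rpow_of_mul_of_rightContinuous hf0 hfmul (fun x _ => hfcont.continuousWithinAt) hx
  have hf1 : 0 < f 1 := (key 0 le_rfl).1
  have hform : ∀ p, charFun μ p = Complex.exp (-(-Real.log (f 1) * |p| ^ α : ℝ)) := by
    intro p
    have h1 : charFun μ p = charFun μ |p| := by
      rcases abs_choice p with h | h <;> rw [h]
      exact (heven p).symm
    have h2 : f (|p| ^ α) = (charFun μ |p|).re := by
      simp only [f]
      rw [← Real.rpow_mul (abs_nonneg p), mul_one_div_cancel hα.ne', Real.rpow_one]
    rw [h1, ← hreal, ← h2, (key _ (by positivity)).2, Real.rpow_def_of_pos hf1,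
      Complex.ofReal_exp]
    congr 1
    push_cast
    ring
  refine ⟨-Real.log (f 1), ?_, hform⟩
  have hle : f 1 ≤ 1 := by
    have h1 := norm_charFun_le_one (μ := μ) (t := (1 : ℝ) ^ (1 / α))
    exact ((le_abs_self _).trans (Complex.abs_re_le_norm _)).trans h1
  refine lt_of_le_of_ne (neg_nonneg.2 (Real.log_nonpos hf1.le hle)) fun h => ?_
  rw [← h] at hform
  apply hX.nondegenerate
  -- A vanishing exponent would make `X 1` almost surely `0`.
  have hdirac : μ = Measure.dirac 0 := by
    apply Measure.ext_of_charFun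
    funext p
    rw [hform p, charFun_dirac]
    simp
  have : ∀ᵐ x ∂μ, x = 0 := by
    rw [hdirac, ae_dirac_iff (measurableSet_eq)]
  exact ae_of_ae_map hm.aemeasurable this

theorem IsLevyProcess.charFun_add (hX : IsLevyProcess X P) (s t : ℝ≥0) (p : ℝ) :
    charFun (P.map (X (s + t))) p = charFun (P.map (X s)) p * charFun (P.map (X t)) p := by
  have hind : (X s) ⟂ᵢ[P] (X (s + t) - X s) :=
    hX.indep.indepFun_eval_sub (r := 0) bot_le (le_add_of_nonneg_right bot_le) hX.zero
  have h := hind.charFun_map_add_eq_mul (hX.measurable s).aemeasurable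
    ((hX.measurable (s + t)).sub (hX.measurable s)).aemeasurable
  have h2 : P.map (X (s + t) - X s) = P.map (X t) := (hX.stationary s t).map_eq
  rw [add_sub_cancel, h2] at h
  rw [h, Pi.mul_apply]

theorem IsLevyProcess.charFun_zero (hX : IsLevyProcess X P) (p : ℝ) :
    charFun (P.map (X 0)) p = 1 := by
  have : P.map (X 0) = P.map (fun _ => (0 : ℝ)) := Measure.map_congr hX.zero
  rw [this, Measure.map_const]
  simp

theorem IsLevyProcess.charFun_nsmul (hX : IsLevyProcess X P) (n : ℕ) (t : ℝ≥0) (p : ℝ) :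
    charFun (P.map (X (n * t))) p = charFun (P.map (X t)) p ^ n := by
  induction n with
  | zero => simpa using hX.charFun_zero p
  | succ n ih => rw [Nat.cast_succ, add_mul, one_mul, hX.charFun_add, ih, pow_succ]

theorem IsLevyProcess.tendsto_charFun (hX : IsLevyProcess X P) {t : ℝ≥0} {u : ℕ → ℝ≥0}
    (hu : Tendsto u atTop (𝓝[Set.Ici t] t)) (p : ℝ) :
    Tendsto (fun n => charFun (P.map (X (u n))) p) atTop (𝓝 (charFun (P.map (X t)) p)) := by
  have hform : ∀ s, charFun (P.map (X s)) p = ∫ ω, Complex.exp (p * X s ω * Complex.I) ∂P := by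
    intro s
    rw [charFun_apply_real, integral_map (hX.measurable s).aemeasurable (by fun_prop)]
  simp only [hform]
  refine tendsto_integral_of_dominated_convergence (fun _ => 1) (fun n => ?_)
    (integrable_const 1) (fun n => Eventually.of_forall fun ω => ?_) ?_
  · have := hX.measurable (u n)
    fun_prop
  · rw [← Complex.ofReal_mul, Complex.norm_exp_ofReal_mul_I]
  · filter_upwards [hX.cadlag] with ω hω
    have h1 : Tendsto (fun n => X (u n) ω) atTop (𝓝 (X t ω)) := (hω.1 t).tendsto.comp hu
    have h2 : Continuous fun x : ℝ => Complex.exp (p * x * Complex.I) := by fun_prop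
    exact (h2.tendsto _).comp h1

/-- Stability is assumed at time `1` only. Halving the time takes square roots of the characteristic
function, integer multiples give powers, and càdlàg paths give all times as limits of dyadic ones
from the right. -/
theorem IsSymmetricStableProcess.exists_charFun (hα : 0 < α)
    (hX : IsSymmetricStableProcess α X P) :
    ∃ κ : ℝ, 0 < κ ∧ ∀ (t : ℝ≥0) (p : ℝ),
      charFun (P.map (X t)) p = Complex.exp (-(κ * |p| ^ α * t : ℝ)) := by
  obtain ⟨κ, hκ, h1⟩ := hX.exists_charFun_one hα
  refine ⟨κ, hκ, ?_⟩
  have hpow : ∀ (n : ℕ) (p : ℝ), charFun (P.map (X ((1 / 2) ^ n))) p =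
      Complex.exp (-(κ * |p| ^ α * (1 / 2) ^ n : ℝ)) := by
    intro n
    induction n with
    | zero => intro p; simpa using h1 p
    | succ n ih =>
      have hsq : ∀ p, charFun (P.map (X ((1 / 2) ^ (n + 1)))) p ^ 2 =
          Complex.exp (-(κ * |p| ^ α * (1 / 2) ^ (n + 1) : ℝ)) ^ 2 := by
        intro p
        rw [← hX.levy.charFun_nsmul, ← Complex.exp_nat_mul]
        have : ((2 : ℕ) : ℝ≥0) * (1 / 2) ^ (n + 1) = (1 / 2) ^ n := by
          rw [pow_succ]; push_cast; field_simp
        rw [this, ih p]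
        congr 1
        push_cast
        ring
      have : IsProbabilityMeasure (P.map (X ((1 / 2) ^ (n + 1)))) :=
        Measure.isProbabilityMeasure_map (hX.levy.measurable _).aemeasurable
      have hc2 : Continuous fun p : ℝ =>
          Complex.exp (-(κ * |p| ^ α * (1 / 2) ^ (n + 1) : ℝ)) := by
        have : Continuous fun p : ℝ => |p| ^ α := continuous_abs.rpow_const fun _ => Or.inr hα.le
        fun_prop
      -- Two continuous functions on the line with equal, nonvanishing squares agree up to one
      -- global sign, and both equal `1` at `0`.
      rcases isPreconnected_univ.eq_or_eq_neg_of_sq_eq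
        (f := charFun (P.map (X ((1 / 2) ^ (n + 1)))))
        continuous_charFun.continuousOn hc2.continuousOn (fun p _ => hsq p)
        (fun {p} _ => Complex.exp_ne_zero _) with h | h
      · exact fun p => h (Set.mem_univ p)
      · have h0 := h (Set.mem_univ (0 : ℝ))
        rw [MeasureTheory.charFun_zero, probReal_univ] at h0
        norm_num [Real.zero_rpow hα.ne'] at h0
  have hdy : ∀ (n k : ℕ) (p : ℝ), charFun (P.map (X (k * (1 / 2) ^ n))) p =
      Complex.exp (-(κ * |p| ^ α * (k * (1 / 2) ^ n) : ℝ)) := by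
    intro n k p
    rw [hX.levy.charFun_nsmul, hpow, ← Complex.exp_nat_mul]
    congr 1
    push_cast
    ring
  intro t p
  have h2 : Tendsto (fun n : ℕ => (2 : ℝ) ^ n) atTop atTop :=
    tendsto_pow_atTop_atTop_of_one_lt (by norm_num)
  have hlim : Tendsto (fun n : ℕ => (⌈(t : ℝ) * 2 ^ n⌉₊ : ℝ) * (1 / 2) ^ n) atTop (𝓝 t) := by
    have := (tendsto_nat_ceil_mul_div_atTop (R := ℝ) t.2).comp h2
    refine this.congr fun n => ?_
    simp [div_eq_mul_inv]
  let u : ℕ → ℝ≥0 := fun n => (⌈(t : ℝ) * 2 ^ n⌉₊ : ℝ≥0) * (1 / 2) ^ n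
  have hu : Tendsto u atTop (𝓝[Set.Ici t] t) := by
    refine tendsto_nhdsWithin_iff.2 ⟨?_, Eventually.of_forall fun n => ?_⟩
    · rw [← NNReal.tendsto_coe]
      refine hlim.congr fun n => ?_
      simp [u]
    · rw [Set.mem_Ici, ← NNReal.coe_le_coe]
      have := Nat.le_ceil ((t : ℝ) * 2 ^ n)
      simp only [u, NNReal.coe_mul, NNReal.coe_natCast, NNReal.coe_pow, NNReal.coe_div,
        NNReal.coe_one, NNReal.coe_ofNat]
      calc (t : ℝ) = t * 2 ^ n * (1 / 2) ^ n := by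
            rw [mul_assoc, ← mul_pow]; norm_num
        _ ≤ _ := by gcongr
  refine tendsto_nhds_unique (hX.levy.tendsto_charFun hu p) ?_
  simp only [u, hdy]
  have hc : Continuous fun x : ℝ => Complex.exp (-(κ * |p| ^ α * x : ℝ)) := by fun_prop
  exact (hc.tendsto _).comp hlim

end StableCharFun

/-- A real-time version of a symmetric stable process with everywhere right continuous paths:
independent increments, the one over `[s, t] ⊆ [0, ∞)` having the characteristic function
`exp (-κ |p| ^ α (t - s))`. -/
structure IsStableMotion {Ω : Type*} [MeasurableSpace Ω] (α κ : ℝ) (Y : ℝ → Ω → ℝ)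
    (P : Measure Ω) : Prop where
  measurable : ∀ t, Measurable (Y t)
  rightCont : ∀ ω t, ContinuousWithinAt (fun s => Y s ω) (Set.Ici t) t
  indep : HasIndepIncrements Y P
  charFun_sub : ∀ s t, 0 ≤ s → s ≤ t → ∀ p : ℝ,
    charFun (P.map (fun ω => Y t ω - Y s ω)) p = Complex.exp (-(κ * |p| ^ α * (t - s) : ℝ))

/-- The paths are set to `0` on a measurable null set containing the exceptional paths. Right
continuity for every `ω` is what yields joint measurability in time and `ω` later. Negative times
are sent to `0`. -/
theorem IsSymmetricStableProcess.exists_isStableMotion {Ω : Type*} [MeasurableSpace Ω]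
    {P : Measure Ω} [IsProbabilityMeasure P] {α : ℝ} {X : ℝ≥0 → Ω → ℝ} (hα : 0 < α)
    (hX : IsSymmetricStableProcess α X P) :
    ∃ (κ : ℝ) (Y : ℝ → Ω → ℝ), 0 < κ ∧ IsStableMotion α κ Y P ∧
      ∀ᵐ ω ∂P, ∀ t : ℝ, X t.toNNReal ω = Y t ω := by
  obtain ⟨κ, hκ, hchar⟩ := hX.exists_charFun hα
  obtain ⟨N, hN, hNm, hN0⟩ := exists_measurable_superset_of_null (ae_iff.1 hX.levy.cadlag)
  have hae : ∀ᵐ ω ∂P, ω ∈ Nᶜ := by rwa [ae_iff, show {ω | ¬ ω ∈ Nᶜ} = N by ext; simp]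
  have hY : ∀ t : ℝ, X t.toNNReal =ᵐ[P] Nᶜ.indicator (X t.toNNReal) := fun t => by
    filter_upwards [hae] with ω hω using (Set.indicator_of_mem hω _).symm
  refine ⟨κ, fun t => Nᶜ.indicator (X t.toNNReal), hκ, ⟨fun t => ?_, fun ω t => ?_, ?_, ?_⟩, ?_⟩
  · exact (hX.levy.measurable _).indicator hNm.compl
  · by_cases hω : ω ∈ N
    · simp only [Set.indicator, Set.mem_compl_iff, hω, not_true_eq_false, if_false]
      exact continuousWithinAt_const
    · simp only [Set.indicator, Set.mem_compl_iff, hω, not_false_eq_true, if_true]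
      have h1 := (not_not.1 fun h => hω (hN h)).1 t.toNNReal
      exact ContinuousWithinAt.comp (g := fun s => X s ω) h1
        continuous_real_toNNReal.continuousWithinAt fun s hs => Real.toNNReal_le_toNNReal hs
  · intro n t ht
    refine (hX.levy.indep n (fun i => (t i).toNNReal)
      (fun i j hij => Real.toNNReal_le_toNNReal (ht hij))).congr fun i => ?_
    exact (hY _).sub (hY _)
  · intro s t hs hst p
    have h1 : P.map (fun ω => Nᶜ.indicator (X t.toNNReal) ω - Nᶜ.indicator (X s.toNNReal) ω) =
        P.map (fun ω => X t.toNNReal ω - X s.toNNReal ω) :=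
      Measure.map_congr ((hY t).sub (hY s)).symm
    have h2 := (hX.levy.stationary s.toNNReal (t - s).toNNReal).map_eq
    rw [← Real.toNNReal_add hs (sub_nonneg.2 hst), add_sub_cancel] at h2
    rw [h1, h2, hchar, Real.coe_toNNReal _ (sub_nonneg.2 hst)]
  · filter_upwards [hae] with ω hω t using (Set.indicator_of_mem hω _).symm

/-! ### Joint measurability and independence of path segments -/

section PathSigma

variable {Ω : Type*}

/-- Each `t` is approximated from the right by the next strictly larger point of the grid of step `1
/ (n + 1)`. The approximating maps take countably many times. -/
theorem measurable_uncurry_of_rightContinuous [MeasurableSpace Ω] {Z : ℝ → Ω → ℝ}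
    (hZ : ∀ t, Measurable (Z t))
    (hc : ∀ ω t, ContinuousWithinAt (fun s => Z s ω) (Set.Ici t) t) :
    Measurable (fun x : ℝ × Ω => Z x.1 x.2) := by
  let u : ℕ → ℝ → ℝ := fun n t => ((⌊t * ((n : ℝ) + 1)⌋ : ℝ) + 1) / ((n : ℝ) + 1)
  have hle : ∀ n t, t ≤ u n t := fun n t => by
    rw [le_div_iff₀ (by positivity)]
    exact (Int.lt_floor_add_one _).le
  have hge : ∀ n t, u n t ≤ t + 1 / ((n : ℝ) + 1) := fun n t => by
    have h : t + 1 / ((n : ℝ) + 1) = (t * ((n : ℝ) + 1) + 1) / ((n : ℝ) + 1) := by field_simp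
    rw [h]
    exact div_le_div_of_nonneg_right (add_le_add_left (Int.floor_le _) _) (by positivity)
  have hu : ∀ t, Tendsto (fun n => u n t) atTop (𝓝[Set.Ici t] t) := by
    intro t
    refine tendsto_nhdsWithin_iff.2 ⟨?_, Eventually.of_forall fun n => hle n t⟩
    refine tendsto_of_tendsto_of_tendsto_of_le_of_le tendsto_const_nhds ?_ (fun n => hle n t)
      (fun n => hge n t)
    simpa using tendsto_const_nhds.add (tendsto_one_div_add_atTop_nhds_zero_nat (𝕜 := ℝ))
  refine measurable_of_tendsto_metrizable (f := fun n (x : ℝ × Ω) => Z (u n x.1) x.2)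
    (fun n => ?_) (tendsto_pi_nhds.2 fun x => (hc x.2 x.1).tendsto.comp (hu x.1))
  have h1 : Measurable fun y : ℤ × Ω => Z (((y.1 : ℝ) + 1) / ((n : ℝ) + 1)) y.2 :=
    measurable_from_prod_countable_right fun k => hZ (((k : ℝ) + 1) / ((n : ℝ) + 1))
  have h2 : Measurable fun x : ℝ × Ω => (⌊x.1 * ((n : ℝ) + 1)⌋, x.2) :=
    (Int.measurable_floor.comp (measurable_fst.mul_const _)).prodMk measurable_snd
  exact h1.comp h2

/-- The σ-algebra generated by the increments of `Y` over `[a, b]`. -/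
@[reducible] def incrementSigma (Y : ℝ → Ω → ℝ) (a b : ℝ) : MeasurableSpace Ω :=
  MeasurableSpace.comap (fun ω (t : Set.Icc a b) => Y t ω - Y a ω) inferInstance

theorem measurable_sub_incrementSigma (Y : ℝ → Ω → ℝ) {a b t : ℝ} (ht : t ∈ Set.Icc a b) :
    Measurable[incrementSigma Y a b] fun ω => Y t ω - Y a ω :=
  (measurable_pi_apply (⟨t, ht⟩ : Set.Icc a b)).comp
    (comap_measurable (fun ω (t : Set.Icc a b) => Y t ω - Y a ω))

/-- The process `Y_t - Y_a` with the time `t` clipped to `[a, b]`. -/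
def clippedProcess (Y : ℝ → Ω → ℝ) (a b : ℝ) (t : ℝ) (ω : Ω) : ℝ :=
  Y (max a (min b t)) ω - Y a ω

theorem clippedProcess_of_mem (Y : ℝ → Ω → ℝ) {a b t : ℝ} (ht : t ∈ Set.Icc a b) (ω : Ω) :
    clippedProcess Y a b t ω = Y t ω - Y a ω := by
  rw [clippedProcess, min_eq_right ht.2, max_eq_right ht.1]

theorem measurable_clippedProcess {Y : ℝ → Ω → ℝ} {a b : ℝ} (hab : a ≤ b)
    (hc : ∀ ω t, ContinuousWithinAt (fun s => Y s ω) (Set.Ici t) t) :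
    @Measurable (ℝ × Ω) ℝ (@Prod.instMeasurableSpace _ _ _ (incrementSigma Y a b)) _
      (fun x : ℝ × Ω => clippedProcess Y a b x.1 x.2) := by
  refine @measurable_uncurry_of_rightContinuous Ω (incrementSigma Y a b) (clippedProcess Y a b)
    (fun t => measurable_sub_incrementSigma Y ⟨le_max_left _ _, max_le hab (min_le_left _ _)⟩)
    (fun ω t => ?_)
  refine ContinuousWithinAt.sub ?_ continuousWithinAt_const
  refine ContinuousWithinAt.comp (g := fun s => Y s ω) (hc ω (max a (min b t)))
    (f := fun t => max a (min b t)) (by fun_prop) fun s hs => ?_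
  exact max_le_max le_rfl (min_le_min le_rfl (Set.mem_Ici.1 hs))

/-- Clipping the times to `[a, b]` and subtracting `Y a` changes no increment seen by `T`, and
leaves a process jointly measurable for the σ-algebra of the segment. -/
theorem measurable_setIntegral_increment {Y : ℝ → Ω → ℝ} {a b : ℝ} (hab : a ≤ b)
    (hc : ∀ ω t, ContinuousWithinAt (fun s => Y s ω) (Set.Ici t) t) {E : Type*}
    [NormedAddCommGroup E] [NormedSpace ℝ E] [MeasurableSpace E] [BorelSpace E]
    [SecondCountableTopology E] {g : ℝ → E}
    (hg : Measurable g) {T : Set (ℝ × ℝ)} (hT : MeasurableSet T)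
    (hTab : T ⊆ Set.Icc a b ×ˢ Set.Icc a b) :
    Measurable[incrementSigma Y a b] fun ω => ∫ z in T, g (Y z.1 ω - Y z.2 ω) := by
  have h1 : (fun ω => ∫ z in T, g (Y z.1 ω - Y z.2 ω)) =
      fun ω => ∫ z in T, g (clippedProcess Y a b z.1 ω - clippedProcess Y a b z.2 ω) := by
    funext ω
    refine setIntegral_congr_fun hT fun z hz => ?_
    have := hTab hz
    simp only [clippedProcess_of_mem Y this.1, clippedProcess_of_mem Y this.2,
      sub_sub_sub_cancel_right]
  rw [h1]
  let m := incrementSigma Y a b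
  have hm := measurable_clippedProcess hab hc
  have hmeas : @Measurable (Ω × (ℝ × ℝ)) E (@Prod.instMeasurableSpace _ _ m _) _
      (fun x => g (clippedProcess Y a b x.2.1 x.1 - clippedProcess Y a b x.2.2 x.1)) := by
    let _ : MeasurableSpace Ω := m
    refine hg.comp (Measurable.sub ?_ ?_)
    · exact hm.comp (measurable_snd.fst.prodMk measurable_fst)
    · exact hm.comp (measurable_snd.snd.prodMk measurable_fst)
  let _ : MeasurableSpace Ω := m
  exact (hmeas.stronglyMeasurable.integral_prod_right (ν := volume.restrict T)).measurable

end PathSigma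

namespace IsStableMotion

variable {Ω : Type*} [MeasurableSpace Ω] {P : Measure Ω} {α κ : ℝ} {Y : ℝ → Ω → ℝ}

theorem measurable_uncurry (hY : IsStableMotion α κ Y P) :
    Measurable (fun x : ℝ × Ω => Y x.1 x.2) :=
  measurable_uncurry_of_rightContinuous hY.measurable hY.rightCont

theorem incrementSigma_le (hY : IsStableMotion α κ Y P) (a b : ℝ) :
    incrementSigma Y a b ≤ ‹MeasurableSpace Ω› := by
  refine Measurable.comap_le (measurable_pi_lambda _ fun t => ?_)
  exact (hY.measurable _).sub (hY.measurable _)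

/-- It suffices to treat finitely many times on each side. All of them, with `a` and `b`, are put
into one sorted grid. Increments from `a` use the grid steps before `b`, those from `b` the steps
after it, and these are disjoint sets of independent variables. -/
theorem indep_incrementSigma [IsProbabilityMeasure P] (hY : IsStableMotion α κ Y P) (a b c : ℝ) :
    Indep (incrementSigma Y a b) (incrementSigma Y b c) P := by
  refine IndepFun.process_indepFun_process
    (fun t => (hY.measurable _).sub (hY.measurable _))
    (fun t => (hY.measurable _).sub (hY.measurable _)) fun I J => ?_
  classical
  let K : Finset ℝ := insert a (insert b (I.image (↑) ∪ J.image (↑)))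
  have hKne : K.Nonempty := ⟨a, by simp [K]⟩
  have hKpos : 0 < K.card := hKne.card_pos
  -- The enumeration of the grid is continued by its last point, so as to be a monotone sequence
  -- over all of `ℕ`.
  let τ : ℕ → ℝ := fun i => K.orderEmbOfFin rfl ⟨min i (K.card - 1), by omega⟩
  have hτ : Monotone τ := fun i j hij => (K.orderEmbOfFin rfl).monotone (by
    simp only [Fin.mk_le_mk]; omega)
  have hsurj : ∀ t ∈ K, ∃ i < K.card, τ i = t := by
    intro t ht
    have : t ∈ Set.range (K.orderEmbOfFin rfl) := by
      rw [Finset.range_orderEmbOfFin]; exact ht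
    obtain ⟨i, hi⟩ := this
    refine ⟨i, i.2, ?_⟩
    rw [← hi]
    simp only [τ]
    congr 1
    ext
    have := i.2
    simp only
    omega
  choose! ix hixlt hix using hsurj
  have hstrict : ∀ i j, i < K.card → j < K.card → τ i ≤ τ j → i ≤ j := by
    intro i j hi hj hle
    have := (K.orderEmbOfFin rfl).le_iff_le.1 hle
    simp only [Fin.mk_le_mk] at this
    omega
  have hi := hY.indep.nat hτ
  have haK : a ∈ K := by simp [K]
  have hbK : b ∈ K := by simp [K]
  have htel : ∀ s t, s ∈ K → t ∈ K → s ≤ t → ∀ ω, Y t ω - Y s ω =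
      ∑ i ∈ Finset.Ico (ix s) (ix t), (Y (τ (i + 1)) ω - Y (τ i) ω) := by
    intro s t hs ht hst ω
    rw [Finset.sum_Ico_sub (fun i => Y (τ i) ω), hix _ hs, hix _ ht]
    exact hstrict _ _ (hixlt _ hs) (hixlt _ ht) (by rwa [hix _ hs, hix _ ht])
  have hmono : ∀ s t, s ∈ K → t ∈ K → s ≤ t → ix s ≤ ix t := fun s t hs ht hst =>
    hstrict _ _ (hixlt _ hs) (hixlt _ ht) (by rwa [hix _ hs, hix _ ht])
  have hIK : ∀ t : I, ((t : Set.Icc a b) : ℝ) ∈ K := fun t => by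
    simp only [K, Finset.mem_insert, Finset.mem_union, Finset.mem_image]
    exact Or.inr (Or.inr (Or.inl ⟨t, t.2, rfl⟩))
  have hJK : ∀ t : J, ((t : Set.Icc b c) : ℝ) ∈ K := fun t => by
    simp only [K, Finset.mem_insert, Finset.mem_union, Finset.mem_image]
    exact Or.inr (Or.inr (Or.inr ⟨t, t.2, rfl⟩))
  have hdisj : Disjoint (Finset.range (ix b)) (Finset.Ico (ix b) K.card) := by
    rw [Finset.disjoint_left]
    intro i h1 h2
    simp only [Finset.mem_range, Finset.mem_Ico] at h1 h2
    omega
  have hind := hi.indepFun_finset _ _ hdisj fun i => (hY.measurable _).sub (hY.measurable _)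
  let F : (Finset.range (ix b) → ℝ) → I → ℝ := fun d t =>
    ∑ i : Finset.range (ix b), if (i : ℕ) ∈ Finset.Ico (ix a) (ix t) then d i else 0
  let G : (Finset.Ico (ix b) K.card → ℝ) → J → ℝ := fun d t =>
    ∑ i : Finset.Ico (ix b) K.card, if (i : ℕ) ∈ Finset.Ico (ix b) (ix t) then d i else 0
  have hF : Measurable F := measurable_pi_lambda _ fun t => Finset.measurable_sum _ fun i _ => by
    split_ifs <;> fun_prop
  have hG : Measurable G := measurable_pi_lambda _ fun t => Finset.measurable_sum _ fun i _ => by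
    split_ifs <;> fun_prop
  convert! hind.comp hF hG using 1
  · funext ω t
    simp only [Function.comp_apply, F]
    rw [htel a t haK (hIK t) t.1.2.1 ω, Finset.sum_coe_sort (Finset.range (ix b))
      (fun i => if i ∈ Finset.Ico (ix a) (ix t) then Y (τ (i + 1)) ω - Y (τ i) ω else 0),
      ← Finset.sum_filter]
    refine Finset.sum_congr ?_ fun _ _ => rfl
    ext i
    have := hmono t b (hIK t) hbK t.1.2.2
    simp only [Finset.mem_Ico, Finset.mem_filter, Finset.mem_range]
    omega
  · funext ω t
    simp only [Function.comp_apply, G]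
    rw [htel b t hbK (hJK t) t.1.2.1 ω, Finset.sum_coe_sort (Finset.Ico (ix b) K.card)
      (fun i => if i ∈ Finset.Ico (ix b) (ix t) then Y (τ (i + 1)) ω - Y (τ i) ω else 0),
      ← Finset.sum_filter]
    refine Finset.sum_congr ?_ fun _ _ => rfl
    ext i
    have := hixlt t (hJK t)
    simp only [Finset.mem_Ico, Finset.mem_filter]
    omega

/-- The joint characteristic function of successive increments. -/
theorem integral_exp_increments [IsProbabilityMeasure P] (hY : IsStableMotion α κ Y P)
    {n : ℕ} {t : Fin (n + 1) → ℝ} (ht : Monotone t) (h0 : 0 ≤ t 0) (l : Fin n → ℝ) :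
    ∫ ω, Complex.exp ((∑ j, l j * (Y (t j.succ) ω - Y (t j.castSucc) ω) : ℝ) * Complex.I) ∂P =
      (∏ j, Real.exp (-(κ * |l j| ^ α * (t j.succ - t j.castSucc))) : ℝ) := by
  have hprod : ∀ ω, Complex.exp
      ((∑ j, l j * (Y (t j.succ) ω - Y (t j.castSucc) ω) : ℝ) * Complex.I) =
      ∏ j, Complex.exp (l j * (Y (t j.succ) ω - Y (t j.castSucc) ω : ℝ) * Complex.I) := by
    intro ω
    rw [← Complex.exp_sum, ← Finset.sum_mul]
    push_cast
    rfl
  simp_rw [hprod]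
  have hi := hY.indep n t ht
  have hm : ∀ j : Fin n, Measurable fun ω => Y (t j.succ) ω - Y (t j.castSucc) ω :=
    fun j => (hY.measurable _).sub (hY.measurable _)
  rw [hi.integral_fun_prod_comp (f := fun j x => Complex.exp (l j * (x : ℝ) * Complex.I))
    (fun j => (hm j).aemeasurable) (fun j => by fun_prop)]
  rw [Complex.ofReal_prod]
  refine Finset.prod_congr rfl fun j _ => ?_
  have hj : 0 ≤ t j.castSucc := h0.trans (ht (Fin.zero_le _))
  have h := hY.charFun_sub _ _ hj (ht (Fin.castSucc_le_succ j)) (l j)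
  rw [charFun_apply_real, integral_map (hm j).aemeasurable (by fun_prop)] at h
  rw [h, Complex.ofReal_exp, Complex.ofReal_neg]

end IsStableMotion

/-! ### Joint moments of oscillatory time integrals via sorted times -/

section SortedTimes

theorem lintegral_comp_perm {n : ℕ} (σ : Equiv.Perm (Fin n)) (f : (Fin n → ℝ) → ℝ≥0∞) :
    ∫⁻ v : Fin n → ℝ, f (v ∘ σ) = ∫⁻ v, f v := by
  have h := volume_measurePreserving_piCongrLeft (fun _ : Fin n => ℝ) σ
  rw [← h.lintegral_comp_emb (MeasurableEquiv.measurableEmbedding _)]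
  congr 1
  funext v
  congr 1
  funext i
  exact MeasurableEquiv.piCongrLeft_apply_apply (β := fun _ : Fin n => ℝ) σ v i

/-- An upper bound for `∫₀ʰ exp (-κ |l| ^ α u) du`. -/
noncomputable def timeWeight (α κ h l : ℝ) : ℝ := 2 * h / (1 + κ * |l| ^ α * h)

theorem measurable_timeWeight (α κ h : ℝ) : Measurable (timeWeight α κ h) := by
  unfold timeWeight
  fun_prop

theorem timeWeight_nonneg {α κ h : ℝ} (hκ : 0 ≤ κ) (hh : 0 ≤ h) (l : ℝ) :
    0 ≤ timeWeight α κ h l := by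
  unfold timeWeight
  positivity

/-- From `1 - exp (-x) ≤ min x 1` with `x = y * h`. The rational form needs no distinction between
small and large frequencies, nor an exception at `y = 0`. -/
theorem lintegral_exp_le {y h : ℝ} (hy : 0 ≤ y) (hh : 0 < h) :
    ∫⁻ x, (Set.Icc 0 h).indicator (fun x => ENNReal.ofReal (Real.exp (-(y * x)))) x ≤
      ENNReal.ofReal (2 * h / (1 + y * h)) := by
  rw [lintegral_indicator measurableSet_Icc,
    ← ofReal_integral_eq_lintegral_ofReal
      ((by fun_prop : Continuous fun x => Real.exp (-(y * x))).integrableOn_Icc)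
      (Eventually.of_forall fun x => (Real.exp_pos _).le)]
  refine ENNReal.ofReal_le_ofReal ?_
  rw [integral_Icc_eq_integral_Ioc, ← intervalIntegral.integral_of_le hh.le]
  rcases hy.eq_or_lt with rfl | hy
  · simp only [zero_mul, neg_zero, Real.exp_zero, intervalIntegral.integral_const, sub_zero,
      smul_eq_mul, mul_one, add_zero, div_one]
    linarith
  · have h1 : ∀ x ∈ Set.uIcc 0 h, HasDerivAt (fun x => -(Real.exp (-(y * x)) / y))
        (Real.exp (-(y * x))) x := by
      intro x _
      have := (((hasDerivAt_id x).const_mul y).neg.exp.div_const y).neg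
      convert! this using 1
      simp only [Pi.neg_apply, id, mul_one]
      field_simp
    rw [intervalIntegral.integral_eq_sub_of_hasDerivAt h1
      ((by fun_prop : Continuous fun x => Real.exp (-(y * x))).intervalIntegrable _ _)]
    have e1 : Real.exp (-(y * h)) ≥ 1 - y * h := by
      have := Real.add_one_le_exp (-(y * h)); linarith
    have e2 : 0 < Real.exp (-(y * h)) := Real.exp_pos _
    have hyh : 0 < y * h := mul_pos hy hh
    rw [le_div_iff₀ (by positivity), mul_zero, neg_zero, Real.exp_zero]
    have : -(Real.exp (-(y * h)) / y) - -(1 / y) = (1 - Real.exp (-(y * h))) / y := by ring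
    rw [this, div_mul_eq_mul_div, div_le_iff₀ hy]
    nlinarith

theorem monotone_cons_zero {n : ℕ} {v : Fin n → ℝ} (hv : Monotone v) (h0 : ∀ j, 0 ≤ v j) :
    Monotone (Fin.cons 0 v : Fin (n + 1) → ℝ) := by
  refine Fin.monotone_iff_le_succ.2 fun i => ?_
  cases n with
  | zero => exact i.elim0
  | succ n =>
    refine Fin.cases ?_ (fun j => ?_) i
    · simpa using h0 0
    · rw [Fin.castSucc_succ, Fin.cons_succ, Fin.cons_succ]
      exact hv (Fin.castSucc_le_succ j)

variable {Ω : Type*} [MeasurableSpace Ω] {P : Measure Ω} [IsProbabilityMeasure P] {α κ h : ℝ}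

/-- If the increments of `z` over successive times in `[0, h]` are independent with characteristic
functions `exp (-κ |l| ^ α u)`, then the joint moments of the variables `∫₀ʰ exp (i q z_u) du` are
bounded by a sum over the orderings of the times. -/
theorem enorm_integral_prod_le {z : ℝ → Ω → ℝ} (hκ : 0 ≤ κ) (hh : 0 < h)
    (hz : Measurable fun x : ℝ × Ω => z x.1 x.2) (hz0 : ∀ ω, z 0 ω = 0) {n : ℕ}
    (hchar : ∀ v : Fin n → ℝ, Monotone v → (∀ j, v j ∈ Set.Ioc 0 h) → ∀ l : Fin n → ℝ,
      ∫ ω, Complex.exp ((∑ j, l j * (z (v j) ω - z (prevEntry v j) ω) : ℝ) * Complex.I) ∂P =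
        (∏ j, Real.exp (-(κ * |l j| ^ α * (v j - prevEntry v j))) : ℝ))
    (p : Fin n → ℝ) :
    ‖∫ ω, (∏ j, ∫ u in Set.Ioc 0 h, Complex.exp ((p j * z u ω : ℝ) * Complex.I)) ∂P‖ₑ ≤
      ∑ σ : Equiv.Perm (Fin n), ∏ j, ENNReal.ofReal (timeWeight α κ h (tailSum (p ∘ σ) j)) := by
  have hpi : ∀ ω, ∏ j, ∫ u in Set.Ioc 0 h, Complex.exp ((p j * z u ω : ℝ) * Complex.I) =
      ∫ u : Fin n → ℝ in Set.univ.pi fun _ => Set.Ioc 0 h,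
        ∏ j, Complex.exp ((p j * z (u j) ω : ℝ) * Complex.I) := by
    intro ω
    rw [volume_pi, Measure.restrict_pi_pi]
    exact (integral_fintype_prod_eq_prod
      (μ := fun _ : Fin n => volume.restrict (Set.Ioc (0 : ℝ) h))
      (fun j (u : ℝ) => Complex.exp ((p j * z u ω : ℝ) * Complex.I))).symm
  simp_rw [hpi]
  have : IsFiniteMeasure ((volume : Measure (Fin n → ℝ)).restrict
      (Set.univ.pi fun _ => Set.Ioc 0 h)) := by
    rw [volume_pi, Measure.restrict_pi_pi]
    infer_instance
  rw [integral_integral_swap]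
  swap
  · refine Integrable.of_bound (C := 1) (Measurable.aestronglyMeasurable ?_)
      (Eventually.of_forall fun x => ?_)
    · simp only [Function.uncurry_def]
      refine Finset.measurable_prod _ fun j _ => ?_
      have h1 : Measurable fun x : Ω × (Fin n → ℝ) => (x.2 j, x.1) :=
        ((measurable_pi_apply j).comp measurable_snd).prodMk measurable_fst
      have h2 : Measurable fun x : Ω × (Fin n → ℝ) => z (x.2 j) x.1 := hz.comp h1
      fun_prop
    · simp only [Function.uncurry_def, norm_prod, Complex.norm_exp_ofReal_mul_I,
        Finset.prod_const_one, le_refl]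
  let G : Equiv.Perm (Fin n) → Fin n → ℝ → ℝ≥0∞ := fun σ j => (Set.Icc 0 h).indicator
    fun x => ENNReal.ofReal (Real.exp (-(κ * |tailSum (p ∘ σ) j| ^ α * x)))
  have hG : ∀ σ j, Measurable (G σ j) := fun σ j =>
    Measurable.indicator (by fun_prop) measurableSet_Icc
  have hbox : ∀ u ∈ Set.univ.pi fun _ : Fin n => Set.Ioc 0 h,
      ‖∫ ω, ∏ j, Complex.exp ((p j * z (u j) ω : ℝ) * Complex.I) ∂P‖ₑ ≤
        ∑ σ, ∏ j, G σ j ((u ∘ σ) j - prevEntry (u ∘ σ) j) := by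
    intro u hu
    -- The sorting permutation depends on `u`. Its term is bounded by the nonnegative sum over all
    -- permutations, after which the domain no longer has to be cut into orderings.
    let σ := Tuple.sort u
    refine le_trans ?_ (Finset.single_le_sum (f := fun σ : Equiv.Perm (Fin n) =>
      ∏ j, G σ j ((u ∘ σ) j - prevEntry (u ∘ σ) j)) (fun _ _ => zero_le) (Finset.mem_univ σ))
    have hmono : Monotone (u ∘ σ) := Tuple.monotone_sort u
    have hmem : ∀ j, (u ∘ σ) j ∈ Set.Ioc 0 h := fun j => hu (σ j) (Set.mem_univ _)
    have hexp : ∀ ω, ∏ j, Complex.exp ((p j * z (u j) ω : ℝ) * Complex.I) =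
        Complex.exp ((∑ j, tailSum (p ∘ σ) j * (z ((u ∘ σ) j) ω - z (prevEntry (u ∘ σ) j) ω) : ℝ) *
          Complex.I) := by
      intro ω
      rw [← sum_mul_eq_sum_tailSum_mul_increment (p ∘ σ) (u ∘ σ) (fun t => z t ω), hz0,
        ← Complex.exp_sum, ← Finset.sum_mul, ← Complex.ofReal_sum]
      simp only [Function.comp_apply, sub_zero]
      rw [Equiv.sum_comp σ fun j => p j * z (u j) ω]
    simp_rw [hexp]
    rw [hchar _ hmono hmem, ← ofReal_norm, Complex.norm_real, Real.norm_eq_abs,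
      abs_of_nonneg (Finset.prod_nonneg fun j _ => (Real.exp_pos _).le),
      ENNReal.ofReal_prod_of_nonneg fun j _ => (Real.exp_pos _).le]
    refine Finset.prod_le_prod' fun j _ => ?_
    have hj : (u ∘ σ) j - prevEntry (u ∘ σ) j ∈ Set.Icc 0 h := by
      have hle : prevEntry (u ∘ σ) j ≤ (u ∘ σ) j ∧ 0 ≤ prevEntry (u ∘ σ) j := by
        cases n with
        | zero => exact j.elim0
        | succ n =>
          refine Fin.cases ?_ (fun i => ?_) j
          · rw [prevEntry_zero]
            exact ⟨(hmem 0).1.le, le_rfl⟩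
          · rw [prevEntry_succ]
            exact ⟨hmono (Fin.castSucc_le_succ i), (hmem _).1.le⟩
      constructor
      · linarith [hle.1]
      · linarith [hle.2, (hmem j).2]
    simp only [G, Set.indicator_of_mem hj, le_refl]
  refine (enorm_integral_le_lintegral_enorm _).trans ?_
  calc _ ≤ ∫⁻ u in Set.univ.pi fun _ : Fin n => Set.Ioc 0 h,
          ∑ σ, ∏ j, G σ j ((u ∘ σ) j - prevEntry (u ∘ σ) j) :=
        setLIntegral_mono' (MeasurableSet.univ_pi fun _ => measurableSet_Ioc) hbox
    _ ≤ ∫⁻ u : Fin n → ℝ, ∑ σ, ∏ j, G σ j ((u ∘ σ) j - prevEntry (u ∘ σ) j) :=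
        setLIntegral_le_lintegral _ _
    _ = ∑ σ, ∫⁻ u : Fin n → ℝ, ∏ j, G σ j ((u ∘ σ) j - prevEntry (u ∘ σ) j) := by
        refine lintegral_finsetSum _ fun σ _ => Finset.measurable_prod _ fun j _ => ?_
        refine (hG σ j).comp (Measurable.sub ?_ ?_)
        · exact measurable_pi_apply _
        · cases n with
          | zero => exact j.elim0
          | succ n =>
            refine Fin.cases ?_ (fun i => ?_) j
            · simp only [prevEntry_zero]
              exact measurable_const
            · simp only [prevEntry_succ]
              exact measurable_pi_apply _
    _ = ∑ σ, ∏ j, ∫⁻ x, G σ j x := by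
        refine Finset.sum_congr rfl fun σ _ => ?_
        rw [lintegral_comp_perm σ fun u => ∏ j, G σ j (u j - prevEntry u j),
          lintegral_prod_increments _ (hG σ)]
    _ ≤ _ := by
        refine Finset.sum_le_sum fun σ _ => Finset.prod_le_prod' fun j _ => ?_
        exact lintegral_exp_le (by positivity) hh

end SortedTimes

namespace IsStableMotion

variable {Ω : Type*} [MeasurableSpace Ω] {P : Measure Ω} [IsProbabilityMeasure P] {α κ : ℝ}
  {Y : ℝ → Ω → ℝ}

theorem enorm_integral_forward_le (hY : IsStableMotion α κ Y P) (hκ : 0 ≤ κ) {a h : ℝ}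
    (ha : 0 ≤ a) (hh : 0 < h) {n : ℕ} (p : Fin n → ℝ) :
    ‖∫ ω, (∏ j, ∫ t in a..a + h, Complex.exp ((p j * (Y t ω - Y a ω) : ℝ) * Complex.I)) ∂P‖ₑ ≤
      ∑ σ : Equiv.Perm (Fin n), ∏ j, ENNReal.ofReal (timeWeight α κ h (tailSum (p ∘ σ) j)) := by
  have key := enorm_integral_prod_le (P := P) (α := α) (z := fun u ω => Y (a + u) ω - Y a ω) hκ hh
    ((hY.measurable_uncurry.comp ((measurable_fst.const_add a).prodMk measurable_snd)).sub
      ((hY.measurable a).comp measurable_snd)) (by simp) (fun v hv hv0 l => ?_) p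
  · convert key using 7 with ω j
    rw [← intervalIntegral.integral_of_le hh.le, intervalIntegral.integral_comp_add_left
      (fun t => Complex.exp ((p _ * (Y t _ - Y a _) : ℝ) * Complex.I)), add_zero]
  · have h1 := hY.integral_exp_increments (t := fun i => a + (Fin.cons 0 v : Fin (n + 1) → ℝ) i)
      ((monotone_cons_zero hv fun j => (hv0 j).1.le).const_add a) (by simpa using ha) l
    simpa [prevEntry] using h1

/-- Time reversal: the increments of `u ↦ Y a - Y (a - u)` are those of `Y` over the reflected grid,
so the forward argument applies with the indices reversed. -/
theorem enorm_integral_backward_le (hY : IsStableMotion α κ Y P) (hκ : 0 ≤ κ) {a h : ℝ}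
    (ha : 0 ≤ a - h) (hh : 0 < h) {n : ℕ} (p : Fin n → ℝ) :
    ‖∫ ω, (∏ j, ∫ s in a - h..a, Complex.exp ((p j * (Y a ω - Y s ω) : ℝ) * Complex.I)) ∂P‖ₑ ≤
      ∑ σ : Equiv.Perm (Fin n), ∏ j, ENNReal.ofReal (timeWeight α κ h (tailSum (p ∘ σ) j)) := by
  have key := enorm_integral_prod_le (P := P) (α := α) (z := fun u ω => Y a ω - Y (a - u) ω) hκ hh
    (((hY.measurable a).comp measurable_snd).sub
      (hY.measurable_uncurry.comp ((measurable_fst.const_sub a).prodMk measurable_snd)))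
    (by simp) (fun v hv hv0 l => ?_) p
  · convert key using 7 with ω j
    rw [← intervalIntegral.integral_of_le hh.le, intervalIntegral.integral_comp_sub_left
      (fun t => Complex.exp ((p _ * (Y a _ - Y t _) : ℝ) * Complex.I)), sub_zero]
  · have hm := monotone_cons_zero hv fun j => (hv0 j).1.le
    have h0 : 0 ≤ a - (Fin.cons 0 v : Fin (n + 1) → ℝ) (Fin.rev 0) := by
      have : (Fin.cons 0 v : Fin (n + 1) → ℝ) (Fin.rev 0) ≤ h := by
        refine Fin.cases ?_ (fun i => ?_) (Fin.rev (0 : Fin (n + 1)))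
        · simpa using hh.le
        · simpa using (hv0 i).2
      linarith
    have h1 := hY.integral_exp_increments
      (t := fun i => a - (Fin.cons 0 v : Fin (n + 1) → ℝ) (Fin.rev i))
      (fun i j hij => sub_le_sub_left (hm (Fin.rev_le_rev.2 hij)) a) h0 (fun j => l (Fin.rev j))
    simp only [Fin.rev_succ, Fin.rev_castSucc] at h1
    have e1 : ∀ ω, ∑ j, l j * (Y a ω - Y (a - v j) ω - (Y a ω - Y (a - prevEntry v j) ω)) =
        ∑ j, l (Fin.rev j) * (Y (a - (Fin.cons 0 v : Fin (n + 1) → ℝ) (Fin.rev j).castSucc) ω -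
          Y (a - (Fin.cons 0 v : Fin (n + 1) → ℝ) (Fin.rev j).succ) ω) := by
      intro ω
      rw [← Equiv.sum_comp Fin.revPerm fun j =>
        l j * (Y a ω - Y (a - v j) ω - (Y a ω - Y (a - prevEntry v j) ω))]
      refine Finset.sum_congr rfl fun j _ => ?_
      simp only [Fin.revPerm_apply, Fin.cons_succ, prevEntry]
      ring
    simp_rw [e1]
    rw [h1, ← Equiv.prod_comp Fin.revPerm fun j =>
      Real.exp (-(κ * |l j| ^ α * (v j - prevEntry v j)))]
    congr 1
    refine Finset.prod_congr rfl fun j _ => ?_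
    simp only [Fin.revPerm_apply, Fin.cons_succ, prevEntry]
    congr 1
    ring

end IsStableMotion

/-- `g` is the Fourier transform of the integrable function `c`. -/
structure IsFourierKernel (g : ℝ → ℝ) (c : ℝ → ℂ) : Prop where
  measurable : Measurable c
  integrable : Integrable c
  eq_integral : ∀ x, (g x : ℂ) = ∫ p, c p * Complex.exp ((p * x : ℝ) * Complex.I)

namespace IsFourierKernel

variable {g : ℝ → ℝ} {c : ℝ → ℂ}

theorem continuous (hg : IsFourierKernel g c) : Continuous g := by
  have h : Continuous fun x => (g x : ℂ) := by
    simp_rw [hg.eq_integral]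
    refine continuous_of_dominated (bound := fun p => ‖c p‖) (fun x => ?_) (fun x => ?_)
      hg.integrable.norm (Eventually.of_forall fun p => by fun_prop)
    · exact (hg.measurable.mul (by fun_prop)).aestronglyMeasurable
    · exact Eventually.of_forall fun p => by rw [norm_mul, Complex.norm_exp_ofReal_mul_I, mul_one]
  exact Complex.continuous_re.comp h

theorem abs_le (hg : IsFourierKernel g c) (x : ℝ) : |g x| ≤ ∫ p, ‖c p‖ := by
  rw [← Real.norm_eq_abs, ← Complex.norm_real, hg.eq_integral]
  refine (norm_integral_le_integral_norm _).trans_eq ?_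
  simp_rw [norm_mul, Complex.norm_exp_ofReal_mul_I, mul_one]

end IsFourierKernel

/-! ### Moments of the integral over a square -/

section Weight

/-- The constant in the moment bound over a square. -/
noncomputable def weightIntegral (α κ r : ℝ) : ℝ :=
  ∫ y : ℝ, (1 + |y|) ^ (2 * r) / (1 + κ * |y| ^ α) ^ 2

/-- At infinity the weight decays like `|y| ^ (2 * r - 2 * α)`, which is integrable exactly when `r
< α - 1 / 2`. For `r = 1` this is `α > 3 / 2`. -/
theorem integrable_weight {α κ r : ℝ} (hκ : 0 < κ) (hα : 0 < α) (hr : r < α - 1 / 2) :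
    Integrable fun y : ℝ => (1 + |y|) ^ (2 * r) / (1 + κ * |y| ^ α) ^ 2 := by
  have h1 : Integrable fun y : ℝ => (1 + ‖y‖) ^ (-(2 * α - 2 * r)) :=
    integrable_one_add_norm (by simp; linarith)
  refine (h1.const_mul ((2 ^ α * max 1 κ⁻¹) ^ 2)).mono' ?_ (Eventually.of_forall fun y => ?_)
  · exact Measurable.aestronglyMeasurable (by fun_prop)
  · have hM1 : 1 ≤ max 1 κ⁻¹ := le_max_left _ _
    have hMκ : 1 ≤ max 1 κ⁻¹ * κ := by
      calc 1 = κ⁻¹ * κ := (inv_mul_cancel₀ hκ.ne').symm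
        _ ≤ _ := by gcongr; exact le_max_right _ _
    have hy : 0 ≤ |y| ^ α := by positivity
    have key : (1 + |y|) ^ α ≤ 2 ^ α * max 1 κ⁻¹ * (1 + κ * |y| ^ α) := by
      have e1 : (1 + |y|) ^ α ≤ 2 ^ α * (1 + |y| ^ α) := by
        rcases le_total |y| 1 with h | h
        · calc (1 + |y|) ^ α ≤ 2 ^ α := by
                apply Real.rpow_le_rpow (by positivity) (by linarith) hα.le
            _ ≤ _ := le_mul_of_one_le_right (by positivity) (by linarith)
        · calc (1 + |y|) ^ α ≤ (2 * |y|) ^ α := by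
                apply Real.rpow_le_rpow (by positivity) (by linarith) hα.le
            _ = 2 ^ α * |y| ^ α := Real.mul_rpow (by norm_num) (abs_nonneg _)
            _ ≤ _ := by gcongr; linarith
      refine e1.trans ?_
      rw [mul_assoc]
      gcongr
      nlinarith
    rw [Real.norm_of_nonneg (by positivity), Real.norm_eq_abs, div_le_iff₀ (by positivity)]
    calc (1 + |y|) ^ (2 * r) = (1 + |y|) ^ (-(2 * α - 2 * r)) * ((1 + |y|) ^ α) ^ 2 := by
          rw [← Real.rpow_natCast ((1 + |y|) ^ α), ← Real.rpow_mul (by positivity),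
            ← Real.rpow_add (by positivity)]
          congr 1
          push_cast
          ring
      _ ≤ (1 + |y|) ^ (-(2 * α - 2 * r)) * (2 ^ α * max 1 κ⁻¹ * (1 + κ * |y| ^ α)) ^ 2 := by
          gcongr
      _ = _ := by ring

theorem weightIntegral_nonneg {α κ r : ℝ} (hκ : 0 < κ) : 0 ≤ weightIntegral α κ r :=
  integral_nonneg fun y => by
    have : 0 ≤ 1 + κ * |y| ^ α := by positivity
    positivity

/-- Scaling `x = L * y` with `L = h ^ (-1 / α)`, for which `|x| ^ α * h = |y| ^ α`. The factor `L ^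
(r + 1) * h ^ 2` that comes out is `h ^ (2 - (r + 1) / α)`. -/
theorem lintegral_weight {α κ r h A : ℝ} (hκ : 0 < κ) (hα : 0 < α) (hr : r < α - 1 / 2)
    (hh : 0 < h) (hA : 0 ≤ A) :
    ∫⁻ x, ENNReal.ofReal (A * ((h ^ (-1 / α)) ^ r * (1 + |x| / h ^ (-1 / α)) ^ (2 * r)) *
      timeWeight α κ h x ^ 2) =
      ENNReal.ofReal (4 * weightIntegral α κ r * A * h ^ (2 - (r + 1) / α)) := by
  set L : ℝ := h ^ (-1 / α) with hL
  have hLpos : 0 < L := Real.rpow_pos_of_pos hh _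
  have hLα : L ^ α = h⁻¹ := by
    rw [hL, ← Real.rpow_mul hh.le, div_mul_cancel₀ _ hα.ne', Real.rpow_neg_one]
  let q : ℝ → ℝ := fun y => (1 + |y|) ^ (2 * r) / (1 + κ * |y| ^ α) ^ 2
  have hq : ∀ x, A * (L ^ r * (1 + |x| / L) ^ (2 * r)) * timeWeight α κ h x ^ 2 =
      4 * A * L ^ r * h ^ 2 * q (x / L) := by
    intro x
    have e1 : κ * |x| ^ α * h = κ * |x / L| ^ α := by
      rw [abs_div, abs_of_pos hLpos, Real.div_rpow (abs_nonneg _) hLpos.le, hLα]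
      field_simp
    simp only [q, timeWeight, e1]
    rw [abs_div, abs_of_pos hLpos, div_pow]
    ring
  simp_rw [hq]
  have hqi : Integrable q := integrable_weight hκ hα hr
  rw [← ofReal_integral_eq_lintegral_ofReal ((hqi.comp_div hLpos.ne').const_mul _)
    (Eventually.of_forall fun x => by
      have : 0 ≤ q (x / L) := by simp only [q]; positivity
      positivity)]
  congr 1
  rw [integral_const_mul, Measure.integral_comp_div q L, abs_of_pos hLpos, smul_eq_mul]
  have e2 : L ^ r * L * h ^ 2 = h ^ (2 - (r + 1) / α) := by
    rw [← Real.rpow_add_one hLpos.ne', hL, ← Real.rpow_mul hh.le, ← Real.rpow_natCast h 2,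
      ← Real.rpow_add hh]
    congr 1
    push_cast
    ring
  rw [← e2, weightIntegral]
  ring

/-- The bound for the integral of the squared sum over orderings. -/
theorem lintegral_sq_sum_perm_le {α κ r h A : ℝ} (hκ : 0 < κ) (hα : 0 < α) (hr0 : 0 ≤ r)
    (hr : r < α - 1 / 2) (hh : 0 < h) (hA : 0 ≤ A) (n : ℕ) :
    ∫⁻ p : Fin n → ℝ, (∏ j, ENNReal.ofReal (A * |p j| ^ r)) *
      (∑ σ : Equiv.Perm (Fin n), ∏ j, ENNReal.ofReal (timeWeight α κ h (tailSum (p ∘ σ) j))) ^ 2 ≤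
      ENNReal.ofReal ((n.factorial : ℝ) ^ 2 *
        (4 * weightIntegral α κ r * A * h ^ (2 - (r + 1) / α)) ^ n) := by
  set L : ℝ := h ^ (-1 / α) with hL
  have hLpos : 0 < L := Real.rpow_pos_of_pos hh _
  have hm : ∀ l, 0 ≤ timeWeight α κ h l := fun l => timeWeight_nonneg hκ.le hh.le l
  let F : (Fin n → ℝ) → ℝ≥0∞ := fun p =>
    ∏ j, ENNReal.ofReal (A * (L ^ r * (1 + |tailSum p j| / L) ^ (2 * r)) *
      timeWeight α κ h (tailSum p j) ^ 2)
  have hmeasG : Measurable fun x => ENNReal.ofReal (A * (L ^ r * (1 + |x| / L) ^ (2 * r)) *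
      timeWeight α κ h x ^ 2) := by
    have := measurable_timeWeight α κ h
    fun_prop
  have htail : ∀ j : Fin n, Measurable fun p : Fin n → ℝ => tailSum p j := fun j =>
    Finset.measurable_sum _ fun i _ => measurable_pi_apply i
  have hFmeas : Measurable F := Finset.measurable_prod _ fun j _ => hmeasG.comp (htail j)
  have hpt : ∀ p : Fin n → ℝ, (∏ j, ENNReal.ofReal (A * |p j| ^ r)) *
      (∑ σ : Equiv.Perm (Fin n), ∏ j,
        ENNReal.ofReal (timeWeight α κ h (tailSum (p ∘ σ) j))) ^ 2 ≤
      ∑ σ : Equiv.Perm (Fin n), (n.factorial : ℝ≥0∞) * F (p ∘ σ) := by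
    intro p
    have e0 : ∀ σ : Equiv.Perm (Fin n), 0 ≤ ∏ j, timeWeight α κ h (tailSum (p ∘ σ) j) :=
      fun σ => Finset.prod_nonneg fun j _ => hm _
    have e1 : ∑ σ : Equiv.Perm (Fin n), ∏ j,
        ENNReal.ofReal (timeWeight α κ h (tailSum (p ∘ σ) j)) =
        ENNReal.ofReal (∑ σ : Equiv.Perm (Fin n), ∏ j, timeWeight α κ h (tailSum (p ∘ σ) j)) := by
      rw [ENNReal.ofReal_sum_of_nonneg fun σ _ => e0 σ]
      exact Finset.sum_congr rfl fun σ _ =>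
        (ENNReal.ofReal_prod_of_nonneg fun j _ => hm _).symm
    have e2 : 0 ≤ ∏ j, A * |p j| ^ r := Finset.prod_nonneg fun j _ => by positivity
    have hF : ∀ σ : Equiv.Perm (Fin n), F (p ∘ σ) = ENNReal.ofReal (∏ j,
        (A * (L ^ r * (1 + |tailSum (p ∘ σ) j| / L) ^ (2 * r)) *
          timeWeight α κ h (tailSum (p ∘ σ) j) ^ 2)) := fun σ =>
      (ENNReal.ofReal_prod_of_nonneg fun j _ => by positivity).symm
    have hfac : (n.factorial : ℝ≥0∞) = ENNReal.ofReal (n.factorial : ℝ) := by simp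
    simp_rw [hF, hfac]
    simp_rw [← ENNReal.ofReal_mul (Nat.cast_nonneg n.factorial)]
    rw [← ENNReal.ofReal_sum_of_nonneg fun σ _ => mul_nonneg (Nat.cast_nonneg _)
        (Finset.prod_nonneg fun j _ => by positivity), e1,
      ← ENNReal.ofReal_pow (Finset.sum_nonneg fun σ _ => e0 σ),
      ← ENNReal.ofReal_prod_of_nonneg fun j _ => by positivity, ← ENNReal.ofReal_mul e2]
    refine ENNReal.ofReal_le_ofReal ?_
    -- Cauchy-Schwarz over the `n!` orderings costs one factor `n!`. The second one comes from
    -- summing `n!` equal integrals.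
    have hcs := sq_sum_le_card_mul_sum_sq (s := (Finset.univ : Finset (Equiv.Perm (Fin n))))
      (f := fun σ => ∏ j, timeWeight α κ h (tailSum (p ∘ σ) j))
    rw [Finset.card_univ, Fintype.card_perm, Fintype.card_fin] at hcs
    refine (mul_le_mul_of_nonneg_left hcs e2).trans ?_
    rw [mul_left_comm, Finset.mul_sum, Finset.mul_sum]
    refine Finset.sum_le_sum fun σ _ => ?_
    refine mul_le_mul_of_nonneg_left ?_ (Nat.cast_nonneg _)
    rw [← Finset.prod_pow, Finset.prod_mul_distrib (g := fun j => timeWeight _ _ _ _ ^ 2)]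
    refine mul_le_mul_of_nonneg_right ?_ (Finset.prod_nonneg fun j _ => by positivity)
    rw [Finset.prod_mul_distrib, Finset.prod_mul_distrib]
    refine mul_le_mul_of_nonneg_left ?_ (Finset.prod_nonneg fun j _ => hA)
    -- The product of the `|p j| ^ r` does not see the order of the frequencies, so it can be
    -- compared with the tail sums of `p ∘ σ`.
    rw [← Equiv.prod_comp σ fun j => |p j| ^ r]
    exact prod_rpow_abs_le_prod_tailSum (p ∘ σ) hr0 hLpos
  refine (lintegral_mono hpt).trans ?_
  have hcomp : ∀ σ : Equiv.Perm (Fin n), Measurable fun p : Fin n → ℝ => F (p ∘ σ) := fun σ =>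
    hFmeas.comp (measurable_pi_lambda _ fun j => measurable_pi_apply (σ j))
  rw [lintegral_finsetSum _ fun σ _ => (hcomp σ).const_mul _]
  simp_rw [lintegral_const_mul _ (hcomp _), lintegral_comp_perm]
  rw [Finset.sum_const, Finset.card_univ, Fintype.card_perm, Fintype.card_fin]
  simp only [F]
  rw [lintegral_prod_tailSum _ fun _ => hmeasG, lintegral_weight hκ hα hr hh hA,
    Finset.prod_const, Finset.card_univ, Fintype.card_fin]
  have hw := weightIntegral_nonneg (α := α) (r := r) hκ
  rw [ENNReal.ofReal_mul (p := (n.factorial : ℝ) ^ 2) (by positivity),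
    ENNReal.ofReal_pow (Nat.cast_nonneg _), ENNReal.ofReal_pow (by positivity),
    ENNReal.ofReal_natCast, nsmul_eq_mul, sq,
    ← mul_assoc]

end Weight

/-- The integral of `g (Y_t - Y_s)` over the pairs of times `(t, s)` in `T`. -/
noncomputable def incrementIntegral {Ω : Type*} (Y : ℝ → Ω → ℝ) (g : ℝ → ℝ) (T : Set (ℝ × ℝ))
    (ω : Ω) : ℝ := ∫ z in T, g (Y z.1 ω - Y z.2 ω)

theorem measurable_intervalIntegral_increment {Ω : Type*} {Y : ℝ → Ω → ℝ} {a b s u v : ℝ}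
    (hab : a ≤ b) (hc : ∀ ω t, ContinuousWithinAt (fun s => Y s ω) (Set.Ici t) t)
    (hs : s ∈ Set.Icc a b) (hu : u ∈ Set.Icc a b) (huv : u ≤ v) (hv : v ∈ Set.Icc a b)
    {f : ℝ → ℂ} (hf : Measurable f) :
    Measurable[incrementSigma Y a b] fun ω => ∫ t in u..v, f (Y t ω - Y s ω) := by
  have h1 : (fun ω => ∫ t in u..v, f (Y t ω - Y s ω)) =
      fun ω => ∫ t in Set.Ioc u v, f (clippedProcess Y a b t ω - clippedProcess Y a b s ω) := by
    funext ω
    rw [intervalIntegral.integral_of_le huv]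
    refine setIntegral_congr_fun measurableSet_Ioc fun t ht => ?_
    have : t ∈ Set.Icc a b := ⟨hu.1.trans ht.1.le, ht.2.trans hv.2⟩
    simp only [clippedProcess_of_mem Y this, clippedProcess_of_mem Y hs, sub_sub_sub_cancel_right]
  rw [h1]
  let m := incrementSigma Y a b
  have hm := measurable_clippedProcess hab hc
  let _ : MeasurableSpace Ω := m
  have hmeas : Measurable fun x : Ω × ℝ =>
      f (clippedProcess Y a b x.2 x.1 - clippedProcess Y a b s x.1) := by
    refine hf.comp (Measurable.sub ?_ ?_)
    · exact hm.comp (measurable_snd.prodMk measurable_fst)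
    · exact hm.comp (measurable_const.prodMk measurable_fst)
  exact (hmeas.stronglyMeasurable.integral_prod_right
    (ν := volume.restrict (Set.Ioc u v))).measurable

theorem abs_incrementIntegral_le {Ω : Type*} {Y : ℝ → Ω → ℝ} {g : ℝ → ℝ} {c : ℝ → ℂ}
    (hg : IsFourierKernel g c) (T : Set (ℝ × ℝ))
    (hT : volume T ≠ ∞) (ω : Ω) : |incrementIntegral Y g T ω| ≤ (∫ p, ‖c p‖) * volume.real T := by
  rw [← Real.norm_eq_abs]
  exact norm_setIntegral_le_of_norm_le_const (lt_top_iff_ne_top.2 hT) fun z _ => hg.abs_le _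

namespace IsStableMotion

variable {Ω : Type*} [MeasurableSpace Ω] {P : Measure Ω} {α κ : ℝ} {Y : ℝ → Ω → ℝ} {g : ℝ → ℝ}
  {c : ℝ → ℂ}

theorem measurable_incrementIntegral (hY : IsStableMotion α κ Y P) (hg : Measurable g)
    (T : Set (ℝ × ℝ)) : Measurable (incrementIntegral Y g T) := by
  have hmeas : Measurable fun x : Ω × (ℝ × ℝ) => g (Y x.2.1 x.1 - Y x.2.2 x.1) := by
    have h1 : Measurable fun x : Ω × (ℝ × ℝ) => (x.2.1, x.1) := by fun_prop
    have h2 : Measurable fun x : Ω × (ℝ × ℝ) => (x.2.2, x.1) := by fun_prop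
    exact hg.comp ((hY.measurable_uncurry.comp h1).sub (hY.measurable_uncurry.comp h2))
  exact (hmeas.stronglyMeasurable.integral_prod_right (ν := volume.restrict T)).measurable

theorem measurable_increment_path (hY : IsStableMotion α κ Y P) (hg : Measurable g) (ω : Ω) :
    Measurable fun z : ℝ × ℝ => g (Y z.1 ω - Y z.2 ω) := by
  have hp : Measurable fun t => Y t ω := hY.measurable_uncurry.comp measurable_prodMk_right
  exact hg.comp ((hp.comp measurable_fst).sub (hp.comp measurable_snd))

theorem integrableOn_increment_path (hY : IsStableMotion α κ Y P) (hg : IsFourierKernel g c)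
    {T : Set (ℝ × ℝ)} (hT : volume T ≠ ∞) (ω : Ω) :
    IntegrableOn (fun z : ℝ × ℝ => g (Y z.1 ω - Y z.2 ω)) T := by
  refine Measure.integrableOn_of_bounded (M := ∫ p, ‖c p‖) hT
    (hY.measurable_increment_path hg.continuous.measurable ω).aestronglyMeasurable
    (Eventually.of_forall fun z => ?_)
  exact hg.abs_le _

/-- On the square `s ≤ a < t`, so `Y t - Y s` splits at the corner time `a` and the exponential
factorises into a future and a past part. -/
theorem ofReal_incrementIntegral_square (hY : IsStableMotion α κ Y P) (hg : IsFourierKernel g c)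
    {a h : ℝ} (hh : 0 < h) (ω : Ω) :
    (incrementIntegral Y g (Set.Ioc a (a + h) ×ˢ Set.Ioc (a - h) a) ω : ℂ) =
      ∫ p, c p * ((∫ t in a..a + h, Complex.exp ((p * (Y t ω - Y a ω) : ℝ) * Complex.I)) *
        ∫ s in a - h..a, Complex.exp ((p * (Y a ω - Y s ω) : ℝ) * Complex.I)) := by
  rw [incrementIntegral, ← integral_complex_ofReal]
  simp_rw [hg.eq_integral]
  have hp : Measurable fun t => Y t ω := hY.measurable_uncurry.comp measurable_prodMk_right
  have : IsFiniteMeasure ((volume : Measure (ℝ × ℝ)).restrict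
      (Set.Ioc a (a + h) ×ˢ Set.Ioc (a - h) a)) := by
    rw [Measure.volume_eq_prod, ← Measure.prod_restrict]
    infer_instance
  rw [integral_integral_swap]
  swap
  · have h1 : Integrable (fun x : (ℝ × ℝ) × ℝ => ‖c x.2‖)
        ((volume.restrict (Set.Ioc a (a + h) ×ˢ Set.Ioc (a - h) a)).prod volume) :=
      hg.integrable.norm.comp_snd _
    refine h1.mono' ?_ (Eventually.of_forall fun x => ?_)
    · have := hg.measurable
      refine Measurable.aestronglyMeasurable ?_
      simp only [Function.uncurry_def]
      have e1 : Measurable fun x : (ℝ × ℝ) × ℝ => Y x.1.1 ω := hp.comp measurable_fst.fst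
      have e2 : Measurable fun x : (ℝ × ℝ) × ℝ => Y x.1.2 ω := hp.comp measurable_fst.snd
      fun_prop
    · simp only [Function.uncurry_def]
      rw [norm_mul, Complex.norm_exp_ofReal_mul_I, mul_one]
  congr 1
  funext p
  rw [integral_const_mul, intervalIntegral.integral_of_le (by linarith),
    intervalIntegral.integral_of_le (by linarith), Measure.volume_eq_prod,
    ← setIntegral_prod_mul]
  congr 2
  funext z
  rw [← Complex.exp_add]
  congr 1
  push_cast
  ring

/-- The moment bound for the integral over a square of side `h` below the diagonal. -/
theorem abs_integral_square_pow_le [IsProbabilityMeasure P] (hY : IsStableMotion α κ Y P)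
    (hg : IsFourierKernel g c) (hκ : 0 < κ) (hα : 0 < α) {r A : ℝ} (hr0 : 0 ≤ r)
    (hr : r < α - 1 / 2) (hA : 0 ≤ A) (hc : ∀ p, ‖c p‖ ≤ A * |p| ^ r) {a h : ℝ} (hh : 0 < h)
    (ha : 0 ≤ a - h) (n : ℕ) :
    |∫ ω, incrementIntegral Y g (Set.Ioc a (a + h) ×ˢ Set.Ioc (a - h) a) ω ^ n ∂P| ≤
      (n.factorial : ℝ) ^ 2 * (4 * weightIntegral α κ r * A * h ^ (2 - (r + 1) / α)) ^ n := by
  set U : ℝ → Ω → ℂ := fun p ω =>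
    ∫ t in a..a + h, Complex.exp ((p * (Y t ω - Y a ω) : ℝ) * Complex.I) with hU
  set V : ℝ → Ω → ℂ := fun p ω =>
    ∫ s in a - h..a, Complex.exp ((p * (Y a ω - Y s ω) : ℝ) * Complex.I) with hV
  have hUm : Measurable fun x : ℝ × Ω => U x.1 x.2 := by
    have e1 : Measurable fun x : (ℝ × Ω) × ℝ => Y x.2 x.1.2 :=
      hY.measurable_uncurry.comp (measurable_snd.prodMk measurable_fst.snd)
    have e2 : Measurable fun x : (ℝ × Ω) × ℝ => Y a x.1.2 :=
      (hY.measurable a).comp measurable_fst.snd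
    have e3 : Measurable fun x : (ℝ × Ω) × ℝ =>
      Complex.exp ((x.1.1 * (Y x.2 x.1.2 - Y a x.1.2) : ℝ) * Complex.I) :=
      ((Complex.measurable_ofReal.comp (measurable_fst.fst.mul (e1.sub e2))).mul_const _).cexp
    simp only [hU, intervalIntegral.integral_of_le (show a ≤ a + h by linarith)]
    exact (e3.stronglyMeasurable.integral_prod_right
      (ν := volume.restrict (Set.Ioc a (a + h)))).measurable
  have hVm : Measurable fun x : ℝ × Ω => V x.1 x.2 := by
    have e1 : Measurable fun x : (ℝ × Ω) × ℝ => Y x.2 x.1.2 :=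
      hY.measurable_uncurry.comp (measurable_snd.prodMk measurable_fst.snd)
    have e2 : Measurable fun x : (ℝ × Ω) × ℝ => Y a x.1.2 :=
      (hY.measurable a).comp measurable_fst.snd
    have e3 : Measurable fun x : (ℝ × Ω) × ℝ =>
      Complex.exp ((x.1.1 * (Y a x.1.2 - Y x.2 x.1.2) : ℝ) * Complex.I) :=
      ((Complex.measurable_ofReal.comp (measurable_fst.fst.mul (e2.sub e1))).mul_const _).cexp
    simp only [hV, intervalIntegral.integral_of_le (show a - h ≤ a by linarith)]
    exact (e3.stronglyMeasurable.integral_prod_right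
      (ν := volume.restrict (Set.Ioc (a - h) a))).measurable
  have hUb : ∀ p ω, ‖U p ω‖ ≤ h := fun p ω => by
    have := intervalIntegral.norm_integral_le_of_norm_le_const (a := a) (b := a + h) (C := 1)
      (f := fun t => Complex.exp ((p * (Y t ω - Y a ω) : ℝ) * Complex.I))
      fun t _ => (Complex.norm_exp_ofReal_mul_I _).le
    refine this.trans_eq ?_
    simp [abs_of_pos hh]
  have hVb : ∀ p ω, ‖V p ω‖ ≤ h := fun p ω => by
    have := intervalIntegral.norm_integral_le_of_norm_le_const (a := a - h) (b := a) (C := 1)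
      (f := fun t => Complex.exp ((p * (Y a ω - Y t ω) : ℝ) * Complex.I))
      fun t _ => (Complex.norm_exp_ofReal_mul_I _).le
    refine this.trans_eq ?_
    simp [abs_of_pos hh]
  have hpow : ∀ ω, ((incrementIntegral Y g (Set.Ioc a (a + h) ×ˢ Set.Ioc (a - h) a) ω ^ n : ℝ) : ℂ)
      = ∫ p : Fin n → ℝ, ∏ j, (c (p j) * (U (p j) ω * V (p j) ω)) := by
    intro ω
    rw [Complex.ofReal_pow, hY.ofReal_incrementIntegral_square hg hh]
    have := integral_fintype_prod_volume_eq_pow (ι := Fin n) fun p => c p * (U p ω * V p ω)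
    rw [this, Fintype.card_fin]
  have hint : Integrable (Function.uncurry fun ω (p : Fin n → ℝ) =>
      ∏ j, (c (p j) * (U (p j) ω * V (p j) ω))) (P.prod volume) := by
    have h1 : Integrable (fun p : Fin n → ℝ => ∏ j, ‖c (p j)‖ * (h * h)) :=
      Integrable.fintype_prod (f := fun _ p => ‖c p‖ * (h * h)) fun _ =>
        hg.integrable.norm.mul_const _
    refine (h1.comp_snd P).mono' (Measurable.aestronglyMeasurable ?_)
      (Eventually.of_forall fun x => ?_)
    · simp only [Function.uncurry_def]
      refine Finset.measurable_prod _ fun j _ => ?_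
      have e0 : Measurable fun x : Ω × (Fin n → ℝ) => x.2 j :=
        (measurable_pi_apply j).comp measurable_snd
      have e1 : Measurable fun x : Ω × (Fin n → ℝ) => (x.2 j, x.1) := e0.prodMk measurable_fst
      exact (hg.measurable.comp e0).mul ((hUm.comp e1).mul (hVm.comp e1))
    · simp only [Function.uncurry_def, norm_prod, norm_mul]
      gcongr
      · exact hUb _ _
      · exact hVb _ _
  -- The factors `U` depend on the path after `a`, the factors `V` on the path before `a`.
  have hindep : ∀ p : Fin n → ℝ, ∫ ω, ∏ j, (c (p j) * (U (p j) ω * V (p j) ω)) ∂P =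
      (∏ j, c (p j)) * ((∫ ω, (∏ j, U (p j) ω) ∂P) * ∫ ω, (∏ j, V (p j) ω) ∂P) := by
    intro p
    simp_rw [Finset.prod_mul_distrib]
    rw [integral_const_mul]
    congr 1
    have hU1 : Measurable[incrementSigma Y a (a + h)] fun ω => ∏ j, U (p j) ω := by
      refine Finset.measurable_prod _ fun j _ => ?_
      exact measurable_intervalIntegral_increment (by linarith) hY.rightCont
        (Set.left_mem_Icc.2 (by linarith)) (Set.left_mem_Icc.2 (by linarith)) (by linarith)
        (Set.right_mem_Icc.2 (by linarith))
        (f := fun x => Complex.exp ((p j * x : ℝ) * Complex.I)) (by fun_prop)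
    have hV1 : Measurable[incrementSigma Y (a - h) a] fun ω => ∏ j, V (p j) ω := by
      refine Finset.measurable_prod _ fun j _ => ?_
      have := measurable_intervalIntegral_increment (a := a - h) (b := a) (by linarith)
        hY.rightCont (Set.right_mem_Icc.2 (by linarith)) (Set.left_mem_Icc.2 (by linarith))
        (by linarith) (Set.right_mem_Icc.2 (by linarith))
        (f := fun x => Complex.exp ((p j * (-x) : ℝ) * Complex.I)) (by fun_prop)
      simpa only [neg_sub] using this
    have hi := hY.indep_incrementSigma (a - h) a (a + h)
    have hi' : IndepFun (fun ω => ∏ j, U (p j) ω) (fun ω => ∏ j, V (p j) ω) P :=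
      indep_of_indep_of_le_left (indep_of_indep_of_le_right hi.symm hV1.comap_le) hU1.comap_le
    exact hi'.integral_fun_mul_eq_mul_integral
      (hU1.mono (hY.incrementSigma_le _ _) le_rfl).aestronglyMeasurable
      (hV1.mono (hY.incrementSigma_le _ _) le_rfl).aestronglyMeasurable
  have hfinal : ENNReal.ofReal
      |∫ ω, incrementIntegral Y g (Set.Ioc a (a + h) ×ˢ Set.Ioc (a - h) a) ω ^ n ∂P| ≤
      ENNReal.ofReal ((n.factorial : ℝ) ^ 2 *
        (4 * weightIntegral α κ r * A * h ^ (2 - (r + 1) / α)) ^ n) := by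
    rw [← Real.norm_eq_abs, ← Complex.norm_real, ← integral_complex_ofReal, ofReal_norm]
    simp_rw [hpow]
    rw [integral_integral_swap hint]
    simp_rw [hindep]
    refine (enorm_integral_le_lintegral_enorm _).trans
      (le_trans (lintegral_mono fun p => ?_) (lintegral_sq_sum_perm_le hκ hα hr0 hr hh hA n))
    rw [enorm_mul, enorm_mul, sq]
    refine mul_le_mul' ?_ (mul_le_mul' ?_ ?_)
    · rw [← ofReal_norm, norm_prod, ENNReal.ofReal_prod_of_nonneg fun _ _ => norm_nonneg _]
      exact Finset.prod_le_prod' fun j _ => ENNReal.ofReal_le_ofReal (hc _)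
    · exact hY.enorm_integral_forward_le hκ.le (by linarith) hh p
    · exact hY.enorm_integral_backward_le hκ.le ha hh p
  refine (ENNReal.ofReal_le_ofReal_iff ?_).1 hfinal
  have hw := weightIntegral_nonneg (α := α) (r := r) hκ
  positivity

end IsStableMotion

/-- The even moments of `S` satisfy `E S ^ (2 m) ≤ k ^ (2 m) (2 m)! ^ 2`. -/
def HasFactorialMoments {Ω : Type*} [MeasurableSpace Ω] (P : Measure Ω) (S : Ω → ℝ) (k : ℝ) :
    Prop :=
  ∀ m : ℕ, ∫ ω, S ω ^ (2 * m) ∂P ≤ k ^ (2 * m) * ((2 * m).factorial : ℝ) ^ 2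

/-! ### Calculus of factorial moment bounds -/

section FactorialMoments

variable {Ω : Type*} [MeasurableSpace Ω] {P : Measure Ω} [IsProbabilityMeasure P] {S T : Ω → ℝ}
  {k l : ℝ}

omit [IsProbabilityMeasure P] in
theorem HasFactorialMoments.mono (hS : HasFactorialMoments P S k) (hk : 0 ≤ k) (hkl : k ≤ l) :
    HasFactorialMoments P S l := fun m => (hS m).trans (by gcongr)

theorem integrable_pow_of_bounded (hSm : Measurable S) {B : ℝ} (hSb : ∀ ω, |S ω| ≤ B) (n : ℕ) :
    Integrable (fun ω => S ω ^ n) P := by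
  refine Integrable.of_bound (C := B ^ n) (hSm.pow_const n).aestronglyMeasurable
    (Eventually.of_forall fun ω => ?_)
  rw [norm_pow, Real.norm_eq_abs]
  exact pow_le_pow_left₀ (abs_nonneg _) (hSb ω) n

theorem hasFactorialMoments_of_bounded (hSm : Measurable S) {B : ℝ} (hSb : ∀ ω, |S ω| ≤ B) :
    HasFactorialMoments P S B := by
  intro m
  calc ∫ ω, S ω ^ (2 * m) ∂P ≤ ∫ _, B ^ (2 * m) ∂P := by
        refine integral_mono (integrable_pow_of_bounded hSm hSb _) (integrable_const _) fun ω => ?_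
        simp only
        rw [← (even_two_mul m).pow_abs]
        exact pow_le_pow_left₀ (abs_nonneg _) (hSb ω) _
    _ = B ^ (2 * m) := by simp
    _ ≤ _ := by
        have h1 : (1 : ℝ) ≤ ((2 * m).factorial : ℝ) := by exact_mod_cast (2 * m).factorial_pos
        refine le_mul_of_one_le_right ((even_two_mul m).pow_nonneg B) ?_
        exact one_le_pow₀ h1

/-- Triangle inequality for the scale: convexity of `x ^ n`, `n` even, applied to `x / k` and `y /
l` with weights `k / (k + l)` and `l / (k + l)`. -/
theorem HasFactorialMoments.add (hS : HasFactorialMoments P S k) (hT : HasFactorialMoments P T l)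
    (hk : 0 < k) (hl : 0 < l) (hSm : Measurable S) (hTm : Measurable T) {B C : ℝ}
    (hSb : ∀ ω, |S ω| ≤ B) (hTb : ∀ ω, |T ω| ≤ C) :
    HasFactorialMoments P (fun ω => S ω + T ω) (k + l) := by
  intro m
  set n := 2 * m with hn
  have hn2 : Even n := even_two_mul m
  have hpt : ∀ x y : ℝ, (x + y) ^ n ≤
      (k + l) ^ n * (k / (k + l) * (x ^ n / k ^ n) + l / (k + l) * (y ^ n / l ^ n)) := by
    intro x y
    have hc := (hn2.convexOn_pow (𝕜 := ℝ)).2 (Set.mem_univ (x / k)) (Set.mem_univ (y / l))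
      (by positivity : 0 ≤ k / (k + l)) (by positivity : 0 ≤ l / (k + l))
      (by field_simp)
    simp only [smul_eq_mul, div_pow] at hc
    have e1 : k / (k + l) * (x / k) + l / (k + l) * (y / l) = (x + y) / (k + l) := by
      field_simp
    rw [e1, div_pow, div_le_iff₀ (by positivity)] at hc
    linarith
  have hiS := integrable_pow_of_bounded (P := P) hSm hSb n
  have hiT := integrable_pow_of_bounded (P := P) hTm hTb n
  calc ∫ ω, (S ω + T ω) ^ n ∂P
      ≤ ∫ ω, (k + l) ^ n * (k / (k + l) * (S ω ^ n / k ^ n) + l / (k + l) * (T ω ^ n / l ^ n)) ∂P :=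
        integral_mono (integrable_pow_of_bounded (hSm.add hTm) (B := B + C) (fun ω =>
            (abs_add_le _ _).trans (add_le_add (hSb ω) (hTb ω))) n)
          ((((hiS.div_const _).const_mul _).add ((hiT.div_const _).const_mul _)).const_mul _)
          fun ω => hpt _ _
    _ = (k + l) ^ n * (k / (k + l) * ((∫ ω, S ω ^ n ∂P) / k ^ n) +
          l / (k + l) * ((∫ ω, T ω ^ n ∂P) / l ^ n)) := by
        rw [integral_const_mul, integral_add ((hiS.div_const _).const_mul _)
          ((hiT.div_const _).const_mul _), integral_const_mul, integral_const_mul,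
          integral_div, integral_div]
    _ ≤ (k + l) ^ n * (k / (k + l) * (n.factorial : ℝ) ^ 2 +
          l / (k + l) * (n.factorial : ℝ) ^ 2) := by
        gcongr
        · rw [div_le_iff₀ (by positivity), mul_comm]
          exact hS m
        · rw [div_le_iff₀ (by positivity), mul_comm]
          exact hT m
    _ = (k + l) ^ n * (n.factorial : ℝ) ^ 2 := by
        field_simp

/-- An odd moment lies between its two even neighbours by the arithmetic-geometric mean inequality.
The parameter `t` is chosen to make the two resulting bounds equal. The loss is `(2 * i + 2) / (2 *
i + 1) ≤ 4 / 3`, where `j ≥ 2` excludes `i = 0`. -/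
theorem HasFactorialMoments.abs_integral_pow_le (hS : HasFactorialMoments P S k) (hk : 0 < k)
    (hSm : Measurable S) {B : ℝ} (hSb : ∀ ω, |S ω| ≤ B) {j : ℕ} (hj : 2 ≤ j) :
    |∫ ω, S ω ^ j ∂P| ≤ 4 / 3 * (k ^ j * (j.factorial : ℝ) ^ 2) := by
  rcases Nat.even_or_odd' j with ⟨i, rfl | rfl⟩
  · rw [abs_of_nonneg (integral_nonneg fun ω => (even_two_mul i).pow_nonneg _)]
    have : 0 ≤ k ^ (2 * i) * ((2 * i).factorial : ℝ) ^ 2 := by positivity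
    linarith [hS i]
  · have hi : (1 : ℝ) ≤ i := by
      have : 1 ≤ i := by omega
      exact_mod_cast this
    set t : ℝ := k * ((2 * i + 1) * (2 * i + 2)) with ht
    have htpos : 0 < t := by positivity
    have hpt : ∀ x : ℝ, |x ^ (2 * i + 1)| ≤ (t * x ^ (2 * i) + x ^ (2 * (i + 1)) / t) / 2 := by
      intro x
      have h1 : |x| ≤ (t + x ^ 2 / t) / 2 := by
        rw [le_div_iff₀ two_pos, ← sub_nonneg]
        have : t + x ^ 2 / t - |x| * 2 = (t - |x|) ^ 2 / t := by
          rw [← sq_abs]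
          field_simp
          ring
        rw [this]
        positivity
      have h2 : 0 ≤ x ^ (2 * i) := (even_two_mul i).pow_nonneg x
      calc |x ^ (2 * i + 1)| = x ^ (2 * i) * |x| := by rw [pow_succ, abs_mul, abs_of_nonneg h2]
        _ ≤ x ^ (2 * i) * ((t + x ^ 2 / t) / 2) := by gcongr
        _ = _ := by ring
    have hi0 := integrable_pow_of_bounded (P := P) hSm hSb (2 * i)
    have hi2 := integrable_pow_of_bounded (P := P) hSm hSb (2 * (i + 1))
    have hfac : ((2 * (i + 1)).factorial : ℝ) =
        (2 * i + 2) * ((2 * i + 1) * (2 * i).factorial) := by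
      rw [show 2 * (i + 1) = 2 * i + 1 + 1 by ring, Nat.factorial_succ, Nat.factorial_succ]
      push_cast
      ring
    have hfac1 : ((2 * i + 1).factorial : ℝ) = (2 * i + 1) * (2 * i).factorial := by
      rw [Nat.factorial_succ]
      push_cast
      ring
    calc |∫ ω, S ω ^ (2 * i + 1) ∂P| ≤ ∫ ω, |S ω ^ (2 * i + 1)| ∂P := abs_integral_le_integral_abs
      _ ≤ ∫ ω, (t * S ω ^ (2 * i) + S ω ^ (2 * (i + 1)) / t) / 2 ∂P :=
          integral_mono (integrable_pow_of_bounded hSm hSb _).abs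
            (((hi0.const_mul _).add (hi2.div_const _)).div_const _) fun ω => hpt _
      _ = (t * (∫ ω, S ω ^ (2 * i) ∂P) + (∫ ω, S ω ^ (2 * (i + 1)) ∂P) / t) / 2 := by
          rw [integral_div, integral_add (hi0.const_mul _) (hi2.div_const _), integral_const_mul,
            integral_div]
      _ ≤ (t * (k ^ (2 * i) * ((2 * i).factorial : ℝ) ^ 2) +
            (k ^ (2 * (i + 1)) * ((2 * (i + 1)).factorial : ℝ) ^ 2) / t) / 2 := by
          gcongr
          · exact hS i
          · exact hS (i + 1)
      _ = k ^ (2 * i + 1) * ((2 * i + 1) * (2 * i + 2)) * ((2 * i).factorial : ℝ) ^ 2 := by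
          rw [hfac, ht]
          field_simp
          ring
      _ ≤ 4 / 3 * (k ^ (2 * i + 1) * ((2 * i + 1).factorial : ℝ) ^ 2) := by
          rw [hfac1]
          have h3 : ((2 : ℝ) * i + 2) ≤ 4 / 3 * (2 * i + 1) := by linarith
          calc _ = k ^ (2 * i + 1) * (2 * i + 1) * ((2 * i).factorial : ℝ) ^ 2 * (2 * i + 2) := by
                ring
            _ ≤ k ^ (2 * i + 1) * (2 * i + 1) * ((2 * i).factorial : ℝ) ^ 2 *
                  (4 / 3 * (2 * i + 1)) := by gcongr
            _ = _ := by ring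

theorem factorial_mul_factorial_le_two_mul (i l : ℕ) :
    (i + 2).factorial * (l + 2).factorial ≤ 2 * (i + l + 2).factorial := by
  induction i with
  | zero => simp
  | succ i ih =>
    rw [show i + 1 + 2 = (i + 2) + 1 by ring, Nat.factorial_succ (i + 2),
      show i + 1 + l + 2 = (i + l + 2) + 1 by ring, Nat.factorial_succ (i + l + 2)]
    calc (i + 2 + 1) * (i + 2).factorial * (l + 2).factorial
        = (i + 2 + 1) * ((i + 2).factorial * (l + 2).factorial) := by ring
      _ ≤ (i + l + 2 + 1) * (2 * (i + l + 2).factorial) := by gcongr; omega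
      _ = _ := by ring

/-- Sums of two independent centred variables. -/
theorem HasFactorialMoments.add_of_indepFun (hS : HasFactorialMoments P S k)
    (hT : HasFactorialMoments P T k) (hk : 0 < k) (hSm : Measurable S) (hTm : Measurable T)
    {B C : ℝ} (hSb : ∀ ω, |S ω| ≤ B) (hTb : ∀ ω, |T ω| ≤ C) (hind : IndepFun S T P)
    (hS0 : ∫ ω, S ω ∂P = 0) (hT0 : ∫ ω, T ω ∂P = 0) :
    HasFactorialMoments P (fun ω => S ω + T ω) (√2 * k) := by
  intro m
  rcases Nat.eq_zero_or_pos m with rfl | hm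
  · simp
  set n := 2 * m with hn
  let term : ℕ → ℝ := fun j => (∫ ω, S ω ^ j ∂P) * (∫ ω, T ω ^ (n - j) ∂P) * (n.choose j : ℝ)
  have hexpand : ∫ ω, (S ω + T ω) ^ n ∂P = ∑ j ∈ Finset.range (n + 1), term j := by
    simp_rw [add_pow]
    have hprod : ∀ j, Integrable (fun ω => S ω ^ j * T ω ^ (n - j)) P := fun j => by
      have := hind.comp (measurable_id.pow_const j) (measurable_id.pow_const (n - j))
      exact this.integrable_mul (integrable_pow_of_bounded hSm hSb j)
        (integrable_pow_of_bounded hTm hTb (n - j))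
    rw [integral_finsetSum _ fun j _ => (hprod j).mul_const _]
    refine Finset.sum_congr rfl fun j _ => ?_
    rw [integral_mul_const]
    congr 1
    have := hind.comp (measurable_id.pow_const j) (measurable_id.pow_const (n - j))
    exact this.integral_fun_mul_eq_mul_integral (hSm.pow_const j).aestronglyMeasurable
      (hTm.pow_const (n - j)).aestronglyMeasurable
  have hpow : (√2 * k) ^ n = 2 ^ m * k ^ n := by
    rw [mul_pow, hn, pow_mul √2, Real.sq_sqrt zero_le_two]
  rw [hexpand, hpow]
  have hfirst : term 0 ≤ k ^ n * (n.factorial : ℝ) ^ 2 := by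
    simpa [term] using hT m
  have hlast : term n ≤ k ^ n * (n.factorial : ℝ) ^ 2 := by
    simpa [term] using hS m
  obtain ⟨N, hN⟩ : ∃ N, n = N + 2 := ⟨2 * m - 2, by omega⟩
  have hsum : ∑ j ∈ Finset.range (n + 1), term j =
      term 0 + ∑ i ∈ Finset.range (N + 1), term (i + 1) + term n := by
    rw [Finset.sum_range_succ, show Finset.range n = Finset.range (N + 1 + 1) by rw [hN],
      Finset.sum_range_succ']
    ring
  rw [hsum]
  have hn1 : 0 < (n : ℝ) * (n - 1) := by
    rw [hN]; push_cast; nlinarith [(Nat.cast_nonneg N : (0 : ℝ) ≤ N)]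
  -- The terms containing a first moment vanish. In the others `j! (n - j)! ≤ 2 (n - 2)!` gains `1 /
  -- (n (n - 1))` over the square of `n!`; the constant is `2 * (4 / 3) ^ 2 = 32 / 9 ≤ 4`.
  have hmid : ∀ i ∈ Finset.range (N + 1),
      term (i + 1) ≤ 4 / (n * (n - 1)) * (k ^ n * (n.factorial : ℝ) ^ 2) := by
    intro i hi
    have hi' : i < N + 1 := Finset.mem_range.1 hi
    have hnn : 0 ≤ 4 / (n * (n - 1)) * (k ^ n * (n.factorial : ℝ) ^ 2) := by positivity
    rcases Nat.eq_zero_or_pos i with rfl | hi0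
    · simpa [term, hS0] using hnn
    rcases eq_or_ne i N with rfl | hiN
    · have : n - (i + 1) = 1 := by omega
      simpa [term, this, hT0] using hnn
    obtain ⟨a, rfl⟩ : ∃ a, i = a + 1 := ⟨i - 1, by omega⟩
    obtain ⟨b, hb⟩ : ∃ b, n - (a + 1 + 1) = b + 2 := ⟨n - (a + 1 + 1) - 2, by omega⟩
    have hnab : n = a + b + 2 + 2 := by omega
    have hchoose : ((a + 2).factorial : ℝ) * (b + 2).factorial * (n.choose (a + 2) : ℝ) =
        n.factorial := by
      have := Nat.choose_mul_factorial_mul_factorial (show a + 2 ≤ n by omega)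
      rw [show n - (a + 2) = b + 2 by omega] at this
      rw [← this]
      push_cast
      ring
    have hfac : ((a + 2).factorial : ℝ) * (b + 2).factorial * (n * (n - 1)) ≤ 2 * n.factorial := by
      have h1 : ((a + 2).factorial : ℝ) * (b + 2).factorial ≤ 2 * (a + b + 2).factorial := by
        exact_mod_cast factorial_mul_factorial_le_two_mul a b
      have h2 : (n.factorial : ℝ) = n * (n - 1) * (a + b + 2).factorial := by
        rw [hnab, Nat.factorial_succ, Nat.factorial_succ]
        push_cast
        ring
      rw [h2]
      calc _ ≤ 2 * ((a + b + 2).factorial : ℝ) * (n * (n - 1)) :=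
            mul_le_mul_of_nonneg_right h1 hn1.le
        _ = _ := by ring
    have e1 := hS.abs_integral_pow_le hk hSm hSb (j := a + 2) (by omega)
    have e2 := hT.abs_integral_pow_le hk hTm hTb (j := b + 2) (by omega)
    have hkn : k ^ (a + 2) * k ^ (b + 2) = k ^ n := by rw [← pow_add, hnab]; ring_nf
    calc term (a + 1 + 1) ≤ |∫ ω, S ω ^ (a + 2) ∂P| * |∫ ω, T ω ^ (b + 2) ∂P| *
          (n.choose (a + 2) : ℝ) := by
          simp only [term, hb]
          rw [← abs_mul]
          exact mul_le_mul_of_nonneg_right (le_abs_self _) (Nat.cast_nonneg _)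
      _ ≤ (4 / 3 * (k ^ (a + 2) * ((a + 2).factorial : ℝ) ^ 2)) *
          (4 / 3 * (k ^ (b + 2) * ((b + 2).factorial : ℝ) ^ 2)) * (n.choose (a + 2) : ℝ) := by
          gcongr
      _ = 16 / 9 * k ^ n * ((a + 2).factorial * (b + 2).factorial) * n.factorial := by
          rw [← hkn, ← hchoose]
          ring
      _ ≤ 16 / 9 * k ^ n * (2 * n.factorial / (n * (n - 1))) * n.factorial := by
          gcongr
          rwa [le_div_iff₀ hn1]
      _ = 32 / 9 / (n * (n - 1)) * (k ^ n * (n.factorial : ℝ) ^ 2) := by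
          ring
      _ ≤ _ := by
          gcongr
          norm_num
  -- The two extreme terms use up `2` of the available factor `2 ^ m`. For `m ≥ 2` the middle terms
  -- total at most `4 / n ≤ 1`; for `m = 1` the only one is `0`.
  have hmidsum : ∑ i ∈ Finset.range (N + 1), term (i + 1) ≤
      (2 ^ m - 2) * (k ^ n * (n.factorial : ℝ) ^ 2) := by
    rcases eq_or_ne m 1 with rfl | hm1
    · have hN0 : N = 0 := by omega
      simp [hN0, term, hS0]
    · refine (Finset.sum_le_card_nsmul _ _ _ hmid).trans ?_
      rw [Finset.card_range, nsmul_eq_mul, ← mul_assoc]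
      refine mul_le_mul_of_nonneg_right ?_ (by positivity)
      have hm2 : 2 ≤ m := by omega
      have h4 : (4 : ℝ) ≤ 2 ^ m := by
        calc (4 : ℝ) = 2 ^ 2 := by norm_num
          _ ≤ 2 ^ m := pow_le_pow_right₀ one_le_two hm2
      have hn4 : (4 : ℝ) ≤ n := by
        have : 4 ≤ n := by omega
        exact_mod_cast this
      have hNn : ((N + 1 : ℕ) : ℝ) = n - 1 := by rw [hN]; push_cast; ring
      have hpos : 0 < (n : ℝ) - 1 := by linarith
      have : ((N + 1 : ℕ) : ℝ) * (4 / (n * (n - 1))) = 4 / n := by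
        rw [hNn]
        field_simp
      rw [this]
      have : (4 : ℝ) / n ≤ 1 := by rw [div_le_one (by linarith)]; exact hn4
      linarith
  linarith

end FactorialMoments

/-- The pairs of times `(t, s)` with `a < s ≤ t ≤ b`. -/
def timeTriangle (a b : ℝ) : Set (ℝ × ℝ) := {z | a < z.2 ∧ z.2 ≤ z.1 ∧ z.1 ≤ b}

theorem measurableSet_timeTriangle (a b : ℝ) : MeasurableSet (timeTriangle a b) :=
  (measurableSet_lt measurable_const measurable_snd).inter
    ((measurableSet_le measurable_snd measurable_fst).inter
      (measurableSet_le measurable_fst measurable_const))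

theorem timeTriangle_subset (a b : ℝ) : timeTriangle a b ⊆ Set.Icc a b ×ˢ Set.Icc a b :=
  fun _ hz => ⟨⟨hz.1.le.trans hz.2.1, hz.2.2⟩, ⟨hz.1.le, hz.2.1.trans hz.2.2⟩⟩

theorem volume_timeTriangle_ne_top (a b : ℝ) : volume (timeTriangle a b) ≠ ∞ :=
  measure_ne_top_of_subset (timeTriangle_subset a b)
    (isCompact_Icc.prod isCompact_Icc).measure_ne_top

theorem volume_real_timeTriangle_le {a b : ℝ} (hab : a ≤ b) :
    volume.real (timeTriangle a b) ≤ (b - a) ^ 2 := by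
  refine (measureReal_mono (timeTriangle_subset a b)
    (isCompact_Icc.prod isCompact_Icc).measure_ne_top).trans_eq ?_
  rw [Measure.volume_eq_prod, measureReal_prod_prod, Real.volume_real_Icc_of_le hab, sq]

theorem timeTriangle_eq_union {a m b : ℝ} (ham : a ≤ m) (hmb : m ≤ b) :
    timeTriangle a b = (timeTriangle a m ∪ timeTriangle m b) ∪ Set.Ioc m b ×ˢ Set.Ioc a m := by
  ext z
  simp only [timeTriangle, Set.mem_ofPred_eq, Set.mem_union, Set.mem_prod, Set.mem_Ioc]
  constructor
  · rintro ⟨h1, h2, h3⟩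
    rcases le_or_gt z.1 m with h | h
    · exact Or.inl (Or.inl ⟨h1, h2, h⟩)
    · rcases le_or_gt z.2 m with h' | h'
      · exact Or.inr ⟨⟨h, h3⟩, ⟨h1, h'⟩⟩
      · exact Or.inl (Or.inr ⟨h', h2, h3⟩)
  · rintro ((⟨h1, h2, h3⟩ | ⟨h1, h2, h3⟩) | ⟨⟨h1, h2⟩, ⟨h3, h4⟩⟩)
    · exact ⟨h1, h2, h3.trans hmb⟩
    · exact ⟨ham.trans_lt h1, h2, h3⟩
    · exact ⟨h3, h4.trans h1.le, h2⟩

/-! ### Dyadic decomposition of the triangle of times -/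

namespace IsStableMotion

variable {Ω : Type*} [MeasurableSpace Ω] {P : Measure Ω} {α κ : ℝ} {Y : ℝ → Ω → ℝ} {g : ℝ → ℝ}
  {c : ℝ → ℂ}

theorem incrementIntegral_timeTriangle (hY : IsStableMotion α κ Y P) (hg : IsFourierKernel g c)
    {a m b : ℝ} (ham : a ≤ m) (hmb : m ≤ b) (ω : Ω) :
    incrementIntegral Y g (timeTriangle a b) ω = (incrementIntegral Y g (timeTriangle a m) ω +
      incrementIntegral Y g (timeTriangle m b) ω) +
      incrementIntegral Y g (Set.Ioc m b ×ˢ Set.Ioc a m) ω := by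
  have h1 : volume (Set.Ioc m b ×ˢ Set.Ioc a m) ≠ ∞ :=
    measure_ne_top_of_subset (Set.prod_mono Set.Ioc_subset_Icc_self Set.Ioc_subset_Icc_self)
      (isCompact_Icc.prod isCompact_Icc).measure_ne_top
  have i1 := hY.integrableOn_increment_path hg (volume_timeTriangle_ne_top a m) ω
  have i2 := hY.integrableOn_increment_path hg (volume_timeTriangle_ne_top m b) ω
  have i3 := hY.integrableOn_increment_path hg h1 ω
  have d1 : Disjoint (timeTriangle a m) (timeTriangle m b) :=
    Set.disjoint_left.2 fun z h h' => absurd (h'.1.trans_le (h'.2.1.trans h.2.2)) (lt_irrefl m)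
  have d2 : Disjoint (timeTriangle a m ∪ timeTriangle m b) (Set.Ioc m b ×ˢ Set.Ioc a m) := by
    refine Set.disjoint_left.2 ?_
    rintro z (h | h) h'
    · exact absurd (h'.1.1.trans_le h.2.2) (lt_irrefl m)
    · exact absurd (h.1.trans_le h'.2.2) (lt_irrefl m)
  simp only [incrementIntegral]
  rw [timeTriangle_eq_union ham hmb, setIntegral_union d2
      (measurableSet_Ioc.prod measurableSet_Ioc) (i1.union i2) i3,
    setIntegral_union d1 (measurableSet_timeTriangle m b) i1 i2]

/-- The characteristic function of an increment is even in the frequency and `c` is odd. Centring is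
what makes the gain `√2` available for sums of independent triangles. -/
theorem integral_increment_eq_zero [IsProbabilityMeasure P] (hY : IsStableMotion α κ Y P)
    (hg : IsFourierKernel g c)
    (hodd : ∀ p, c (-p) = -c p) {s t : ℝ} (hs : 0 ≤ s) (hst : s ≤ t) :
    ∫ ω, g (Y t ω - Y s ω) ∂P = 0 := by
  have hm : Measurable fun ω => Y t ω - Y s ω := (hY.measurable t).sub (hY.measurable s)
  have h1 : ((∫ ω, g (Y t ω - Y s ω) ∂P : ℝ) : ℂ) =
      ∫ p, c p * Complex.exp (-(κ * |p| ^ α * (t - s) : ℝ)) := by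
    rw [← integral_complex_ofReal]
    simp_rw [hg.eq_integral]
    rw [integral_integral_swap]
    · congr 1
      funext p
      rw [integral_const_mul, ← hY.charFun_sub s t hs hst p, charFun_apply_real,
        integral_map hm.aemeasurable (by fun_prop)]
      simp only [Complex.ofReal_mul]
    · refine (hg.integrable.norm.comp_snd P).mono' ?_ (Eventually.of_forall fun x => ?_)
      · have := hg.measurable
        have h2 : Measurable fun x : Ω × ℝ => Y t x.1 - Y s x.1 := hm.comp measurable_fst
        exact ((this.comp measurable_snd).mul ((Complex.measurable_ofReal.comp
          (measurable_snd.mul h2)).mul_const _).cexp).aestronglyMeasurable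
      · simp only [Function.uncurry_def]
        rw [norm_mul, Complex.norm_exp_ofReal_mul_I, mul_one]
  have h2 := integral_neg_eq_self
    (fun p => c p * Complex.exp (-(κ * |p| ^ α * (t - s) : ℝ))) volume
  simp only [hodd, abs_neg, neg_mul, integral_neg] at h2
  rw [← h1] at h2
  have h3 : -(∫ ω, g (Y t ω - Y s ω) ∂P) = ∫ ω, g (Y t ω - Y s ω) ∂P := by exact_mod_cast h2
  linarith

theorem integral_incrementIntegral_eq_zero [IsProbabilityMeasure P] (hY : IsStableMotion α κ Y P)
    (hg : IsFourierKernel g c)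
    (hodd : ∀ p, c (-p) = -c p) {a b : ℝ} (ha : 0 ≤ a) :
    ∫ ω, incrementIntegral Y g (timeTriangle a b) ω ∂P = 0 := by
  have : IsFiniteMeasure (volume.restrict (timeTriangle a b)) :=
    ⟨by rw [Measure.restrict_apply_univ]; exact (volume_timeTriangle_ne_top a b).lt_top⟩
  simp only [incrementIntegral]
  rw [integral_integral_swap]
  · refine setIntegral_eq_zero_of_forall_eq_zero fun z hz => ?_
    exact hY.integral_increment_eq_zero hg hodd (ha.trans hz.1.le) hz.2.1
  · refine Integrable.of_bound (C := ∫ p, ‖c p‖) (Measurable.aestronglyMeasurable ?_)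
      (Eventually.of_forall fun x => ?_)
    · have h1 : Measurable fun x : Ω × (ℝ × ℝ) => (x.2.1, x.1) := by fun_prop
      have h2 : Measurable fun x : Ω × (ℝ × ℝ) => (x.2.2, x.1) := by fun_prop
      exact hg.continuous.measurable.comp
        ((hY.measurable_uncurry.comp h1).sub (hY.measurable_uncurry.comp h2))
    · exact hg.abs_le _

/-- The even moments of the integral over the triangle, uniformly in the size of the kernel. -/
theorem exists_hasFactorialMoments_timeTriangle [IsProbabilityMeasure P]
    (hY : IsStableMotion α κ Y P) (hκ : 0 < κ) (hα : 1 < α) {r : ℝ} (hr0 : 0 ≤ r)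
    (hr : r < α - 1 / 2) :
    ∃ k : ℝ, 0 < k ∧ ∀ (g : ℝ → ℝ) (c : ℝ → ℂ), IsFourierKernel g c → (∀ p, c (-p) = -c p) →
      ∀ A : ℝ, 0 < A → (∀ p, ‖c p‖ ≤ A * |p| ^ r) →
        HasFactorialMoments P (incrementIntegral Y g (timeTriangle 0 1)) (k * A) := by
  have hα0 : 0 < α := by linarith
  set β : ℝ := 2 - (r + 1) / α with hβ
  -- From `(r + 1) / α < 1 + 1 / (2 * α) < 3 / 2`, as `α > 1`. Exponents above `1 / 2` are those for
  -- which `√2 * 2⁻¹ ^ β < 1`.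
  have hβ2 : 1 / 2 < β := by
    have : (r + 1) / α < 3 / 2 := by rw [div_lt_iff₀ hα0]; linarith
    rw [hβ]
    linarith
  have hw : 0 ≤ weightIntegral α κ r := weightIntegral_nonneg hκ
  have hlt : √2 * 2⁻¹ ^ β < 1 := by
    have h1 : (2⁻¹ : ℝ) ^ β < 2⁻¹ ^ (1 / 2 : ℝ) :=
      Real.rpow_lt_rpow_of_exponent_gt (by norm_num) (by norm_num) hβ2
    have h2 : √2 * (2⁻¹ : ℝ) ^ (1 / 2 : ℝ) = 1 := by
      rw [Real.sqrt_eq_rpow, ← Real.mul_rpow (by norm_num) (by norm_num)]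
      norm_num
    calc √2 * 2⁻¹ ^ β < √2 * 2⁻¹ ^ (1 / 2 : ℝ) := by gcongr
      _ = 1 := h2
  have hden : 0 < 1 - √2 * 2⁻¹ ^ β := by linarith
  refine ⟨(4 * weightIntegral α κ r + 1) / (1 - √2 * 2⁻¹ ^ β), by positivity,
    fun g c hg hodd A hA hc => ?_⟩
  set C₁ : ℝ := (4 * weightIntegral α κ r + 1) * A with hC₁
  have hC₁pos : 0 < C₁ := by positivity
  set C₂ : ℝ := (4 * weightIntegral α κ r + 1) / (1 - √2 * 2⁻¹ ^ β) * A with hC₂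
  have hC₂pos : 0 < C₂ := by positivity
  -- `C₂` is the fixed point of the recursion in which halving the triangle replaces a constant `C`
  -- by `C * (√2 * 2⁻¹ ^ β) + C₁`.
  have hC₂eq : C₂ * (√2 * 2⁻¹ ^ β) + C₁ = C₂ := by
    have h1 : C₂ * (1 - √2 * 2⁻¹ ^ β) = C₁ := by
      rw [hC₂, hC₁, mul_right_comm, div_mul_cancel₀ _ hden.ne']
    linarith
  set G : ℝ := (∫ p, ‖c p‖) + 1 with hG
  have hG0 : 0 ≤ ∫ p, ‖c p‖ := integral_nonneg fun p => norm_nonneg _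
  have hGpos : 0 < G := by positivity
  have hmeas := fun T => hY.measurable_incrementIntegral hg.continuous.measurable T
  have hbound : ∀ a h : ℝ, 0 < h → ∀ ω,
      |incrementIntegral Y g (timeTriangle a (a + h)) ω| ≤ G * h ^ 2 := by
    intro a h hh ω
    refine (abs_incrementIntegral_le hg _ (volume_timeTriangle_ne_top _ _) ω).trans ?_
    have := volume_real_timeTriangle_le (show a ≤ a + h by linarith)
    rw [add_sub_cancel_left] at this
    gcongr
    rw [hG]
    linarith
  -- After `N` halvings the crude bound `G * h ^ 2`, which depends on the kernel through its sup
  -- norm, carries the factor `(√2 / 4) ^ N`: a factor `√2` from the sum and `1 / 4` from the area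
  -- at each step. It disappears as `N → ∞`, leaving a constant linear in `A`.
  have key : ∀ (N : ℕ) (a h : ℝ), 0 ≤ a → 0 < h →
      HasFactorialMoments P (incrementIntegral Y g (timeTriangle a (a + h)))
        (G * h ^ 2 * (√2 / 4) ^ N + C₂ * h ^ β) := by
    intro N
    induction N with
    | zero =>
      intro a h _ hh
      refine (hasFactorialMoments_of_bounded (hmeas _) (hbound a h hh)).mono (by positivity) ?_
      rw [pow_zero, mul_one]
      have : 0 ≤ C₂ * h ^ β := by positivity
      linarith
    | succ N ih =>
      intro a h ha hh
      set b := h / 2 with hb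
      have hbpos : 0 < b := by positivity
      have hbb : a + h = a + b + b := by rw [hb]; ring
      have hsq : HasFactorialMoments P
          (incrementIntegral Y g (Set.Ioc (a + b) (a + b + b) ×ˢ Set.Ioc a (a + b)))
          (C₁ * b ^ β) := by
        intro m
        have := hY.abs_integral_square_pow_le hg hκ hα0 hr0 hr hA.le hc hbpos
          (a := a + b) (by linarith) (2 * m)
        rw [add_sub_cancel_right] at this
        refine (le_abs_self _).trans (this.trans ?_)
        rw [mul_comm]
        gcongr
        rw [hC₁]
        linarith
      have ih1 := ih a b ha hbpos
      have ih2 := ih (a + b) b (by linarith) hbpos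
      have hind : IndepFun (incrementIntegral Y g (timeTriangle a (a + b)))
          (incrementIntegral Y g (timeTriangle (a + b) (a + b + b))) P := by
        have m1 : Measurable[incrementSigma Y a (a + b)]
            (incrementIntegral Y g (timeTriangle a (a + b))) :=
          measurable_setIntegral_increment (by linarith) hY.rightCont hg.continuous.measurable
            (measurableSet_timeTriangle _ _) (timeTriangle_subset _ _)
        have m2 : Measurable[incrementSigma Y (a + b) (a + b + b)]
            (incrementIntegral Y g (timeTriangle (a + b) (a + b + b))) :=
          measurable_setIntegral_increment (by linarith) hY.rightCont hg.continuous.measurable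
            (measurableSet_timeTriangle _ _) (timeTriangle_subset _ _)
        exact indep_of_indep_of_le_left (indep_of_indep_of_le_right
          (hY.indep_incrementSigma a (a + b) (a + b + b)) m2.comap_le) m1.comap_le
      have hsum := ih1.add_of_indepFun ih2 (by positivity) (hmeas _) (hmeas _)
        (hbound a b hbpos) (hbound (a + b) b hbpos) hind
        (hY.integral_incrementIntegral_eq_zero hg hodd ha)
        (hY.integral_incrementIntegral_eq_zero hg hodd (by linarith))
      have hsqtop : volume (Set.Ioc (a + b) (a + b + b) ×ˢ Set.Ioc a (a + b)) ≠ ∞ :=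
        measure_ne_top_of_subset
          (Set.prod_mono Set.Ioc_subset_Icc_self Set.Ioc_subset_Icc_self)
          (isCompact_Icc.prod isCompact_Icc).measure_ne_top
      have htot := hsum.add hsq (by positivity) (by positivity) ((hmeas _).add (hmeas _)) (hmeas _)
        (fun ω => (abs_add_le _ _).trans (add_le_add (hbound a b hbpos ω)
          (hbound (a + b) b hbpos ω))) (fun ω => abs_incrementIntegral_le hg _ hsqtop ω)
      have heq : incrementIntegral Y g (timeTriangle a (a + h)) = fun ω =>
          (incrementIntegral Y g (timeTriangle a (a + b)) ω +
            incrementIntegral Y g (timeTriangle (a + b) (a + b + b)) ω) +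
          incrementIntegral Y g (Set.Ioc (a + b) (a + b + b) ×ˢ Set.Ioc a (a + b)) ω := by
        funext ω
        rw [hbb]
        exact hY.incrementIntegral_timeTriangle hg (by linarith) (by linarith) ω
      rw [heq]
      refine htot.mono (by positivity) ?_
      have hbβ : b ^ β = 2⁻¹ ^ β * h ^ β := by
        rw [← Real.mul_rpow (by norm_num) hh.le, hb]
        congr 1
        ring
      have hhβ : 0 < h ^ β := Real.rpow_pos_of_pos hh _
      have h2β : (2⁻¹ : ℝ) ^ β ≤ 1 := Real.rpow_le_one (by norm_num) (by norm_num) (by linarith)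
      have e1 : C₁ * (2⁻¹ ^ β * h ^ β) ≤ C₁ * h ^ β := by
        refine mul_le_mul_of_nonneg_left ?_ hC₁pos.le
        exact mul_le_of_le_one_left hhβ.le h2β
      have e2 : (C₂ * (√2 * 2⁻¹ ^ β) + C₁) * h ^ β = C₂ * h ^ β := by rw [hC₂eq]
      calc √2 * (G * b ^ 2 * (√2 / 4) ^ N + C₂ * b ^ β) + C₁ * b ^ β
          = G * h ^ 2 * (√2 / 4) ^ (N + 1) + C₂ * (√2 * 2⁻¹ ^ β) * h ^ β +
              C₁ * (2⁻¹ ^ β * h ^ β) := by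
            rw [hbβ, hb, pow_succ]
            ring
        _ ≤ _ := by linarith
  intro m
  have hlim : Tendsto (fun N : ℕ => (G * 1 ^ 2 * (√2 / 4) ^ N + C₂ * 1 ^ β) ^ (2 * m) *
      ((2 * m).factorial : ℝ) ^ 2) atTop
      (𝓝 ((G * 1 ^ 2 * 0 + C₂ * 1 ^ β) ^ (2 * m) * ((2 * m).factorial : ℝ) ^ 2)) := by
    have hs : √2 / 4 < 1 := by
      have : √2 < 2 := by rw [Real.sqrt_lt' two_pos]; norm_num
      linarith
    have := tendsto_pow_atTop_nhds_zero_of_lt_one (by positivity) hs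
    exact (((this.const_mul _).add_const _).pow _).mul_const _
  rw [mul_zero, zero_add, Real.one_rpow, mul_one] at hlim
  refine ge_of_tendsto hlim (Eventually.of_forall fun N => ?_)
  have := key N 0 1 le_rfl one_pos m
  rwa [zero_add, Real.one_rpow, mul_one] at this

end IsStableMotion

/-! ### From factorial moments to exponential integrability -/

section ExponentialMoments

variable {Ω : Type*} [MeasurableSpace Ω] {P : Measure Ω} [IsProbabilityMeasure P]

theorem HasFactorialMoments.eLpNorm_le {S : Ω → ℝ} {k : ℝ} (hS : HasFactorialMoments P S k)
    (hk : 0 ≤ k) (hSm : Measurable S) {B : ℝ} (hSb : ∀ ω, |S ω| ≤ B) {m : ℕ} (hm : m ≠ 0) :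
    eLpNorm S (2 * m : ℕ) P ≤
      ENNReal.ofReal (k * (((2 * m).factorial : ℝ) ^ 2) ^ ((2 * m : ℕ) : ℝ)⁻¹) := by
  have hn : 2 * m ≠ 0 := by omega
  have hmem : MemLp S (2 * m : ℕ) P :=
    MemLp.of_bound hSm.aestronglyMeasurable B (Eventually.of_forall hSb)
  rw [hmem.eLpNorm_eq_integral_rpow_norm (by exact_mod_cast hn) (ENNReal.natCast_ne_top _)]
  refine ENNReal.ofReal_le_ofReal ?_
  simp only [ENNReal.toReal_natCast, Real.rpow_natCast, Real.norm_eq_abs, (even_two_mul m).pow_abs]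
  have h1 : k = (k ^ (2 * m)) ^ ((2 * m : ℕ) : ℝ)⁻¹ := (Real.pow_rpow_inv_natCast hk hn).symm
  conv_rhs => rw [h1, ← Real.mul_rpow (by positivity) (by positivity)]
  exact Real.rpow_le_rpow (integral_nonneg fun ω => (even_two_mul m).pow_nonneg _) (hS m)
    (by positivity)

omit [IsProbabilityMeasure P] in
theorem lintegral_pow_le_of_eLpNorm_le {θ : Ω → ℝ} {k : ℝ} (hk : 0 ≤ k) {m : ℕ} (hm : m ≠ 0)
    (h : eLpNorm θ (2 * m : ℕ) P ≤
      ENNReal.ofReal (k * (((2 * m).factorial : ℝ) ^ 2) ^ ((2 * m : ℕ) : ℝ)⁻¹)) :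
    ∫⁻ ω, ENNReal.ofReal (|θ ω| ^ (2 * m)) ∂P ≤
      ENNReal.ofReal (k ^ (2 * m) * ((2 * m).factorial : ℝ) ^ 2) := by
  have hn : 2 * m ≠ 0 := by omega
  rw [eLpNorm_eq_lintegral_rpow_enorm_toReal (by exact_mod_cast hn) (ENNReal.natCast_ne_top _)] at h
  simp only [ENNReal.toReal_natCast, ENNReal.rpow_natCast] at h
  have h2 := pow_le_pow_left' h (2 * m)
  rw [← ENNReal.rpow_natCast, ← ENNReal.rpow_mul, one_div, inv_mul_cancel₀ (by exact_mod_cast hn),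
    ENNReal.rpow_one, ← ENNReal.ofReal_pow (by positivity), mul_pow,
    Real.rpow_inv_natCast_pow (by positivity) hn] at h2
  refine le_trans (le_of_eq ?_) h2
  congr 1
  funext ω
  rw [ENNReal.ofReal_pow (abs_nonneg _), ← Real.norm_eq_abs, ofReal_norm]

theorem factorial_two_mul_le (n : ℕ) : (2 * n).factorial ≤ 4 ^ n * n.factorial ^ 2 := by
  have h := Nat.choose_mul_factorial_mul_factorial (show n ≤ 2 * n by omega)
  rw [show 2 * n - n = n by omega] at h
  rw [← h, mul_assoc, sq]
  refine Nat.mul_le_mul_right _ ?_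
  calc (2 * n).choose n ≤ 2 ^ (2 * n) := Nat.choose_le_two_pow _ _
    _ = 4 ^ n := by rw [pow_mul]; norm_num

/-- The `n`-th term of the series of `exp (M √|θ|)` involves `|θ| ^ (n / 2)`, whose fourth power is
`|θ| ^ (2 * n)`. A bound by `(2 * n)!²` on the latter therefore gives `C ^ n * n!` for the former,
which cancels the `n!` of the series. -/
theorem exists_integrable_exp_of_eLpNorm_le {θ : Ω → ℝ} (hθ : AEMeasurable θ P) {k : ℝ}
    (hk : 0 < k)
    (h : ∀ m : ℕ, m ≠ 0 → eLpNorm θ (2 * m : ℕ) P ≤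
      ENNReal.ofReal (k * (((2 * m).factorial : ℝ) ^ 2) ^ ((2 * m : ℕ) : ℝ)⁻¹))
    {γ : ℝ} (hγ0 : 0 ≤ γ) (hγ : γ ≤ 1 / 2) :
    ∃ M : ℝ, 0 < M ∧ Integrable (fun ω => Real.exp (M * |θ ω| ^ γ)) P := by
  set M : ℝ := 1 / (4 * √k) with hM
  have hsk : 0 < √k := Real.sqrt_pos.2 hk
  have hMpos : 0 < M := by positivity
  have hterm : ∀ n : ℕ, ∫⁻ ω, ENNReal.ofReal (M ^ n / n.factorial * √|θ ω| ^ n) ∂P ≤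
      ENNReal.ofReal (2 * (1 / 2) ^ n) := by
    intro n
    -- By `(2 * n)! ≤ 4 ^ n * n!²`, `b ^ 4` dominates the moment of order `2 * n`. The choice of `M`
    -- makes `M ^ n / n! * b` equal to `2 ^ (-n)`, which is summable.
    set b : ℝ := (2 * √k) ^ n * n.factorial with hb
    have hbpos : 0 < b := by positivity
    have hpt : ∀ x : ℝ, √|x| ^ n ≤ b + |x| ^ (2 * n) / b ^ 3 := by
      intro x
      set y := √|x| ^ n with hy
      have hy0 : 0 ≤ y := by positivity
      have hy4 : |x| ^ (2 * n) = y ^ 4 := by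
        rw [hy, ← pow_mul, mul_comm n 4, show 4 * n = 2 * (2 * n) by ring, pow_mul √|x|,
          Real.sq_sqrt (abs_nonneg x)]
      rw [hy4]
      rcases le_total y b with hle | hle
      · have : 0 ≤ y ^ 4 / b ^ 3 := by positivity
        linarith
      · have : y ≤ y ^ 4 / b ^ 3 := by
          rw [le_div_iff₀ (by positivity)]
          calc y * b ^ 3 ≤ y * y ^ 3 := by gcongr
            _ = y ^ 4 := by ring
        linarith
    have hmom : ∫⁻ ω, ENNReal.ofReal (|θ ω| ^ (2 * n)) ∂P ≤ ENNReal.ofReal (b ^ 4) := by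
      have hb4 : k ^ (2 * n) * ((2 * n).factorial : ℝ) ^ 2 ≤ b ^ 4 := by
        have h1 : ((2 * n).factorial : ℝ) ≤ 4 ^ n * (n.factorial : ℝ) ^ 2 := by
          exact_mod_cast factorial_two_mul_le n
        have h2 : b ^ 4 = k ^ (2 * n) * (4 ^ n * (n.factorial : ℝ) ^ 2) ^ 2 := by
          have e1 : k ^ (2 * n) = (√k ^ n) ^ 4 := by
            rw [← pow_mul, mul_comm n 4, show 4 * n = 2 * (2 * n) by ring, pow_mul √k,
              Real.sq_sqrt hk.le]
          have e2 : (4 : ℝ) ^ n = (2 ^ n) ^ 2 := by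
            rw [← pow_mul, mul_comm, pow_mul]; norm_num
          rw [e1, e2, hb, mul_pow 2]
          ring
        rw [h2]
        gcongr
      rcases eq_or_ne n 0 with rfl | hn
      · simp [hb]
      · exact (lintegral_pow_le_of_eLpNorm_le hk.le hn (h n hn)).trans
          (ENNReal.ofReal_le_ofReal hb4)
    have hMb : M ^ n / n.factorial * b = (1 / 2) ^ n := by
      rw [hM, hb, mul_pow, div_pow, mul_pow]
      have : (4 : ℝ) ^ n = 2 ^ n * 2 ^ n := by rw [← mul_pow]; norm_num
      field_simp
      rw [this]
      field_simp
      simp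
    calc ∫⁻ ω, ENNReal.ofReal (M ^ n / n.factorial * √|θ ω| ^ n) ∂P
        ≤ ∫⁻ ω, (ENNReal.ofReal (M ^ n / n.factorial * b) +
            ENNReal.ofReal (M ^ n / n.factorial / b ^ 3) *
              ENNReal.ofReal (|θ ω| ^ (2 * n))) ∂P := by
          refine lintegral_mono fun ω => ?_
          rw [← ENNReal.ofReal_mul (by positivity), ← ENNReal.ofReal_add (by positivity)
            (by positivity)]
          refine ENNReal.ofReal_le_ofReal ?_
          calc _ ≤ M ^ n / n.factorial * (b + |θ ω| ^ (2 * n) / b ^ 3) := by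
                gcongr
                exact hpt _
            _ = _ := by ring
      _ = ENNReal.ofReal (M ^ n / n.factorial * b) + ENNReal.ofReal (M ^ n / n.factorial / b ^ 3) *
            ∫⁻ ω, ENNReal.ofReal (|θ ω| ^ (2 * n)) ∂P := by
          rw [lintegral_add_left measurable_const, lintegral_const, measure_univ, mul_one,
            lintegral_const_mul' _ _ ENNReal.ofReal_ne_top]
      _ ≤ ENNReal.ofReal (M ^ n / n.factorial * b) + ENNReal.ofReal (M ^ n / n.factorial / b ^ 3) *
            ENNReal.ofReal (b ^ 4) := by gcongr
      _ = ENNReal.ofReal (2 * (1 / 2) ^ n) := by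
          rw [← ENNReal.ofReal_mul (by positivity), ← ENNReal.ofReal_add (by positivity)
            (by positivity)]
          congr 1
          have : M ^ n / n.factorial / b ^ 3 * b ^ 4 = M ^ n / n.factorial * b := by
            field_simp
          rw [this, hMb]
          ring
  have hy : AEMeasurable (fun ω => √|θ ω|) P :=
    Real.continuous_sqrt.measurable.comp_aemeasurable
      (continuous_abs.measurable.comp_aemeasurable hθ)
  have hexp : Integrable (fun ω => Real.exp (M * √|θ ω|)) P := by
    refine ⟨((hy.const_mul M).exp).aestronglyMeasurable, ?_⟩
    rw [hasFiniteIntegral_iff_ofReal (Eventually.of_forall fun ω => (Real.exp_pos _).le)]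
    have hser : ∀ ω, ENNReal.ofReal (Real.exp (M * √|θ ω|)) =
        ∑' n : ℕ, ENNReal.ofReal (M ^ n / n.factorial * √|θ ω| ^ n) := by
      intro ω
      have e1 : (fun n : ℕ => M ^ n / n.factorial * √|θ ω| ^ n) =
          fun n : ℕ => (M * √|θ ω|) ^ n / n.factorial := by
        funext n
        rw [mul_pow]
        ring
      rw [← ENNReal.ofReal_tsum_of_nonneg (fun n => by positivity)
        (by rw [e1]; exact Real.summable_pow_div_factorial _), e1, Real.exp_eq_exp_ℝ,
        NormedSpace.exp_eq_tsum_div]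
    simp_rw [hser]
    rw [lintegral_tsum fun n => ((hy.pow_const n).const_mul _).ennreal_ofReal]
    refine lt_of_le_of_lt (ENNReal.tsum_le_tsum hterm) ?_
    rw [← ENNReal.ofReal_tsum_of_nonneg (fun n => by positivity)
      ((summable_geometric_of_lt_one (by norm_num) (by norm_num)).mul_left 2)]
    exact ENNReal.ofReal_lt_top
  refine ⟨M, hMpos, (hexp.const_mul (Real.exp M)).mono' ?_ (Eventually.of_forall fun ω => ?_)⟩
  · have : AEMeasurable (fun ω => |θ ω| ^ γ) P :=
      (continuous_abs.measurable.comp_aemeasurable hθ).pow_const γ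
    exact ((this.const_mul M).exp).aestronglyMeasurable
  · rw [Real.norm_of_nonneg (Real.exp_pos _).le, ← Real.exp_add]
    refine Real.exp_le_exp.2 ?_
    have : |θ ω| ^ γ ≤ 1 + √|θ ω| := by
      rcases le_total |θ ω| 1 with h1 | h1
      · have := Real.rpow_le_one (abs_nonneg (θ ω)) h1 hγ0
        have := Real.sqrt_nonneg |θ ω|
        linarith
      · have := Real.rpow_le_rpow_of_exponent_le h1 hγ
        rw [← Real.sqrt_eq_rpow] at this
        linarith
    calc M * |θ ω| ^ γ ≤ M * (1 + √|θ ω|) := by gcongr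
      _ = M + M * √|θ ω| := by ring

end ExponentialMoments

/-! ### Gaussian weights and derivative kernels -/

section WeightKernel

/-- The Fourier coefficients `i p w(p) / 2π` of the derivative of the inverse transform of `w`. -/
noncomputable def derivCoeff (w : ℝ → ℝ) (p : ℝ) : ℂ :=
  Complex.I / (2 * Real.pi) * (p * w p : ℝ)

/-- The derivative of the inverse Fourier transform of `w`. -/
noncomputable def derivKernel (w : ℝ → ℝ) (x : ℝ) : ℝ :=
  (∫ p, derivCoeff w p * Complex.exp ((p * x : ℝ) * Complex.I)).re

/-- The weight `exp (-ε p² / 2)`. -/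
noncomputable def gaussWeight (ε p : ℝ) : ℝ := Real.exp (-(ε * p ^ 2 / 2))

theorem gaussWeight_neg (ε p : ℝ) : gaussWeight ε (-p) = gaussWeight ε p := by simp [gaussWeight]

theorem gaussWeight_pos (ε p : ℝ) : 0 < gaussWeight ε p := Real.exp_pos _

theorem gaussWeight_le_one {ε : ℝ} (hε : 0 ≤ ε) (p : ℝ) : gaussWeight ε p ≤ 1 :=
  Real.exp_le_one_iff.2 (neg_nonpos.2 (by positivity))

theorem measurable_gaussWeight (ε : ℝ) : Measurable (gaussWeight ε) := by
  unfold gaussWeight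
  fun_prop

theorem integrable_mul_gaussWeight {ε : ℝ} (hε : 0 < ε) :
    Integrable fun p => p * gaussWeight ε p := by
  refine (integrable_mul_exp_neg_mul_sq (half_pos hε)).congr (Eventually.of_forall fun p => ?_)
  simp only [gaussWeight]
  ring_nf

theorem derivCoeff_neg {w : ℝ → ℝ} (hw : ∀ p, w (-p) = w p) (p : ℝ) :
    derivCoeff w (-p) = -derivCoeff w p := by
  simp only [derivCoeff, hw]
  push_cast
  ring

/-- The coefficients are purely imaginary and odd, so the integral is invariant under conjugation
combined with `p ↦ -p`, hence real. -/
theorem isFourierKernel_derivKernel {w : ℝ → ℝ} (hwm : Measurable w) (hw : ∀ p, w (-p) = w p)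
    (hwi : Integrable fun p => p * w p) : IsFourierKernel (derivKernel w) (derivCoeff w) where
  measurable := by
    unfold derivCoeff
    fun_prop
  integrable := hwi.ofReal.const_mul _
  eq_integral x := by
    refine Complex.conj_eq_iff_re.1 ?_
    rw [← integral_conj, ← integral_neg_eq_self]
    congr 1
    funext p
    rw [derivCoeff_neg hw, map_mul, map_neg, ← Complex.exp_conj]
    simp only [derivCoeff, map_mul, map_div₀, Complex.conj_I, Complex.conj_ofReal, map_ofNat]
    push_cast
    ring_nf

theorem norm_derivCoeff_le {w : ℝ → ℝ} (p : ℝ) : ‖derivCoeff w p‖ ≤ |p| * |w p| := by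
  rw [derivCoeff, norm_mul, Complex.norm_real, Real.norm_eq_abs, abs_mul]
  refine mul_le_of_le_one_left (by positivity) ?_
  rw [norm_div, Complex.norm_I, norm_mul, Complex.norm_real, Real.norm_of_nonneg Real.pi_pos.le]
  rw [div_le_one (by simp [Real.pi_pos])]
  have := Real.pi_gt_three
  simp only [Complex.norm_ofNat]
  linarith

theorem derivKernel_sub {w v : ℝ → ℝ} (hw : Integrable fun p => p * w p)
    (hv : Integrable fun p => p * v p) (x : ℝ) :
    derivKernel (fun p => w p - v p) x = derivKernel w x - derivKernel v x := by
  have key : ∀ u : ℝ → ℝ, Integrable (fun p => p * u p) →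
      Integrable fun p => derivCoeff u p * Complex.exp ((p * x : ℝ) * Complex.I) := by
    intro u hu
    refine Integrable.mono (g := derivCoeff u) (hu.ofReal.const_mul _) ?_
      (Eventually.of_forall fun p => ?_)
    · exact (hu.ofReal.const_mul _ : Integrable (derivCoeff u)).aestronglyMeasurable.mul
        (by fun_prop : Continuous fun p : ℝ =>
          Complex.exp ((p * x : ℝ) * Complex.I)).aestronglyMeasurable
    · rw [norm_mul, Complex.norm_exp_ofReal_mul_I, mul_one]
  rw [derivKernel, derivKernel, derivKernel, ← Complex.sub_re, ← integral_sub (key w hw) (key v hv)]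
  congr 2
  funext p
  simp only [derivCoeff]
  push_cast
  ring

/-- Interpolation: the difference is at most `min 1 (e * p ^ 2)`, hence at most `(e * p ^ 2) ^ η`. A
little growth in `p` is exchanged for smallness in `e`. -/
theorem abs_gaussWeight_sub_le {ε δ e η : ℝ} (hε : 0 < ε) (hδ : 0 < δ) (hεe : ε ≤ e) (hδe : δ ≤ e)
    (hη0 : 0 < η) (hη1 : η ≤ 1) (p : ℝ) :
    |gaussWeight ε p - gaussWeight δ p| ≤ e ^ η * |p| ^ (2 * η) := by
  have he : 0 < e := hε.trans_le hεe
  have h1 : ∀ d, 0 < d → d ≤ e → gaussWeight d p ∈ Set.Icc (max 0 (1 - e * p ^ 2)) 1 := by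
    intro d hd hde
    refine ⟨max_le (gaussWeight_pos _ _).le ?_, gaussWeight_le_one hd.le p⟩
    have h2 := Real.add_one_le_exp (-(d * p ^ 2 / 2))
    have h3 : d * p ^ 2 ≤ e * p ^ 2 := by gcongr
    have h4 : 0 ≤ d * p ^ 2 := by positivity
    simp only [gaussWeight]
    linarith
  have h2 : |gaussWeight ε p - gaussWeight δ p| ≤ min 1 (e * p ^ 2) := by
    have a1 := h1 ε hε hεe
    have a2 := h1 δ hδ hδe
    have b1 := (max_le_iff.1 a1.1)
    have b2 := (max_le_iff.1 a2.1)
    refine le_min (abs_le.2 ⟨?_, ?_⟩) (abs_le.2 ⟨?_, ?_⟩) <;>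
      linarith [a1.2, a2.2, b1.1, b1.2, b2.1, b2.2]
  refine h2.trans ?_
  have h3 : e ^ η * |p| ^ (2 * η) = (e * p ^ 2) ^ η := by
    rw [Real.mul_rpow he.le (sq_nonneg p), Real.rpow_mul (abs_nonneg p), Real.rpow_two, sq_abs]
  rw [h3]
  rcases le_total (e * p ^ 2) 1 with h | h
  · refine (min_le_right _ _).trans ?_
    have := Real.rpow_le_rpow_of_exponent_ge' (by positivity : 0 ≤ e * p ^ 2) h hη0.le hη1
    rwa [Real.rpow_one] at this
  · exact (min_le_left _ _).trans (Real.one_le_rpow h hη0.le)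

end WeightKernel

/-- The real form of the approximation of the derivative of self-intersection local time. -/
noncomputable def realApprox {Ω : Type*} (Y : ℝ → Ω → ℝ) (ε : ℝ) : Ω → ℝ :=
  incrementIntegral Y (derivKernel (gaussWeight ε)) (timeTriangle 0 1)

theorem isFourierKernel_gaussWeight {ε : ℝ} (hε : 0 < ε) :
    IsFourierKernel (derivKernel (gaussWeight ε)) (derivCoeff (gaussWeight ε)) :=
  isFourierKernel_derivKernel (measurable_gaussWeight ε) (gaussWeight_neg ε)
    (integrable_mul_gaussWeight hε)

/-! ### Existence of the limit and its exponential moments for `α > 3 / 2` -/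

namespace IsStableMotion

variable {Ω : Type*} [MeasurableSpace Ω] {P : Measure Ω} {α κ : ℝ} {Y : ℝ → Ω → ℝ}

theorem dsltApprox_eq (hY : IsStableMotion α κ Y P) {X : ℝ≥0 → Ω → ℝ} {ω : Ω}
    (hXY : ∀ t : ℝ, X t.toNNReal ω = Y t ω) {ε : ℝ} (hε : 0 < ε) :
    dsltApprox X ε ω = (realApprox Y ε ω : ℂ) := by
  have hg := isFourierKernel_gaussWeight hε
  have hinner : ∀ t s : ℝ, Complex.I / (2 * Real.pi) * ∫ p : ℝ,
      (p : ℂ) * Complex.exp (Complex.I * p * (X t.toNNReal ω - X s.toNNReal ω : ℝ)) *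
        Complex.exp (-(ε * p ^ 2 / 2 : ℝ)) =
      (derivKernel (gaussWeight ε) (Y t ω - Y s ω) : ℂ) := by
    intro t s
    rw [hg.eq_integral, ← integral_const_mul]
    congr 1
    funext p
    rw [hXY, hXY, derivCoeff, gaussWeight]
    push_cast
    have e1 : (p : ℂ) * ((Y t ω : ℂ) - Y s ω) * Complex.I =
      Complex.I * p * ((Y t ω : ℂ) - Y s ω) := by ring
    rw [e1]
    ring
  rw [dsltApprox, ← intervalIntegral.integral_const_mul]
  simp_rw [← intervalIntegral.integral_const_mul, hinner]
  simp_rw [intervalIntegral.integral_ofReal]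
  congr 1
  rw [realApprox, incrementIntegral, ← integral_indicator (measurableSet_timeTriangle 0 1),
    Measure.volume_eq_prod, integral_prod, intervalIntegral.integral_of_le zero_le_one,
    ← integral_indicator measurableSet_Ioc]
  · congr 1
    funext t
    by_cases ht : t ∈ Set.Ioc (0 : ℝ) 1
    · rw [Set.indicator_of_mem ht, intervalIntegral.integral_of_le ht.1.le,
        ← integral_indicator measurableSet_Ioc]
      congr 1
      funext s
      have : (t, s) ∈ timeTriangle 0 1 ↔ s ∈ Set.Ioc 0 t :=
        ⟨fun h => ⟨h.1, h.2.1⟩, fun h => ⟨h.1, h.2, ht.2⟩⟩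
      by_cases hs : s ∈ Set.Ioc 0 t
      · rw [Set.indicator_of_mem hs, Set.indicator_of_mem (this.2 hs)]
      · rw [Set.indicator_of_notMem hs, Set.indicator_of_notMem (mt this.1 hs)]
    · rw [Set.indicator_of_notMem ht]
      symm
      refine integral_eq_zero_of_ae (Eventually.of_forall fun s => ?_)
      refine Set.indicator_of_notMem (fun h => ht ⟨h.1.trans_le h.2.1, h.2.2⟩) _
  · exact (hY.integrableOn_increment_path hg
      (volume_timeTriangle_ne_top 0 1) ω).integrable_indicator (measurableSet_timeTriangle 0 1)

theorem measurable_realApprox (hY : IsStableMotion α κ Y P) {ε : ℝ} (hε : 0 < ε) :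
    Measurable (realApprox Y ε) :=
  hY.measurable_incrementIntegral (isFourierKernel_gaussWeight hε).continuous.measurable _

omit [MeasurableSpace Ω] in
theorem exists_abs_realApprox_le (Y : ℝ → Ω → ℝ) {ε : ℝ} (hε : 0 < ε) :
    ∃ B, ∀ ω, |realApprox Y ε ω| ≤ B :=
  ⟨_, abs_incrementIntegral_le (isFourierKernel_gaussWeight hε) _ (volume_timeTriangle_ne_top 0 1)⟩

variable [IsProbabilityMeasure P]

/-- The normalized moment constant `((2 m)!²) ^ (1 / 2m)`. -/
noncomputable def momentRoot (m : ℕ) : ℝ := (((2 * m).factorial : ℝ) ^ 2) ^ ((2 * m : ℕ) : ℝ)⁻¹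

theorem momentRoot_nonneg (m : ℕ) : 0 ≤ momentRoot m := by
  unfold momentRoot
  positivity

theorem exists_eLpNorm_realApprox_le (hY : IsStableMotion α κ Y P) (hκ : 0 < κ) (hα : 3 / 2 < α) :
    ∃ k : ℝ, 0 < k ∧ ∀ ε : ℝ, 0 < ε → ∀ m : ℕ, m ≠ 0 →
      eLpNorm (realApprox Y ε) (2 * m : ℕ) P ≤ ENNReal.ofReal (k * momentRoot m) := by
  obtain ⟨k, hk, h⟩ := hY.exists_hasFactorialMoments_timeTriangle hκ (by linarith)
    (r := 1) zero_le_one (by linarith)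
  refine ⟨k, hk, fun ε hε m hm => ?_⟩
  obtain ⟨B, hB⟩ := exists_abs_realApprox_le Y hε
  have h1 := h _ _ (isFourierKernel_gaussWeight hε) (derivCoeff_neg (gaussWeight_neg ε)) 1 one_pos
    fun p => by
      refine (norm_derivCoeff_le p).trans ?_
      rw [Real.rpow_one, one_mul, abs_of_pos (gaussWeight_pos _ _)]
      exact mul_le_of_le_one_right (abs_nonneg _) (gaussWeight_le_one hε.le p)
  rw [mul_one] at h1
  exact h1.eLpNorm_le hk.le (hY.measurable_realApprox hε) hB hm

omit [IsProbabilityMeasure P] in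
theorem realApprox_sub (hY : IsStableMotion α κ Y P) {ε δ : ℝ} (hε : 0 < ε) (hδ : 0 < δ) :
    (fun ω => realApprox Y ε ω - realApprox Y δ ω) = incrementIntegral Y
      (derivKernel fun p => gaussWeight ε p - gaussWeight δ p) (timeTriangle 0 1) := by
  funext ω
  have h1 := hY.integrableOn_increment_path (isFourierKernel_gaussWeight hε)
    (volume_timeTriangle_ne_top 0 1) ω
  have h2 := hY.integrableOn_increment_path (isFourierKernel_gaussWeight hδ)
    (volume_timeTriangle_ne_top 0 1) ω
  simp only [realApprox, incrementIntegral]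
  rw [← integral_sub h1 h2]
  simp_rw [derivKernel_sub (integrable_mul_gaussWeight hε) (integrable_mul_gaussWeight hδ)]

/-- The coefficients of the difference are `O (e ^ η |p| ^ (1 + 2 η))`. With `η = (α - 3 / 2) / 4`
the exponent `r = 1 + 2 η` stays below `α - 1 / 2`. -/
theorem exists_eLpNorm_realApprox_sub_le (hY : IsStableMotion α κ Y P) (hκ : 0 < κ)
    (hα : 3 / 2 < α) (hα₂ : α ≤ 2) :
    ∃ k η : ℝ, 0 < k ∧ 0 < η ∧ ∀ e ε δ : ℝ, 0 < ε → 0 < δ → ε ≤ e → δ ≤ e → ∀ m : ℕ, m ≠ 0 →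
      eLpNorm (fun ω => realApprox Y ε ω - realApprox Y δ ω) (2 * m : ℕ) P ≤
        ENNReal.ofReal (k * e ^ η * momentRoot m) := by
  obtain ⟨k, hk, h⟩ := hY.exists_hasFactorialMoments_timeTriangle hκ (by linarith)
    (r := 1 + 2 * ((α - 3 / 2) / 4)) (by linarith) (by linarith)
  refine ⟨k, (α - 3 / 2) / 4, hk, by linarith, fun e ε δ hε hδ hεe hδe m hm => ?_⟩
  have hη : 0 < (α - 3 / 2) / 4 := by linarith
  have he : 0 < e := hε.trans_le hεe
  obtain ⟨B, hB⟩ := exists_abs_realApprox_le Y hε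
  obtain ⟨C, hC⟩ := exists_abs_realApprox_le Y hδ
  have hsub := hY.realApprox_sub hε hδ
  have hneg : ∀ p, gaussWeight ε (-p) - gaussWeight δ (-p) = gaussWeight ε p - gaussWeight δ p :=
    fun p => by rw [gaussWeight_neg, gaussWeight_neg]
  have hker := isFourierKernel_derivKernel (w := fun p => gaussWeight ε p - gaussWeight δ p)
    ((measurable_gaussWeight ε).sub (measurable_gaussWeight δ)) hneg (by
      simp_rw [mul_sub]
      exact (integrable_mul_gaussWeight hε).sub (integrable_mul_gaussWeight hδ))
  have h1 := h _ _ hker (derivCoeff_neg hneg) (e ^ ((α - 3 / 2) / 4)) (by positivity) fun p => by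
    refine (norm_derivCoeff_le p).trans ?_
    have h2 := abs_gaussWeight_sub_le hε hδ hεe hδe hη (by linarith) p
    rcases eq_or_ne p 0 with rfl | hp
    · rw [abs_zero, zero_mul]
      positivity
    · rw [Real.rpow_add (abs_pos.2 hp), Real.rpow_one]
      calc |p| * |gaussWeight ε p - gaussWeight δ p|
          ≤ |p| * (e ^ ((α - 3 / 2) / 4) * |p| ^ (2 * ((α - 3 / 2) / 4))) := by gcongr
        _ = _ := by ring
  rw [← hsub] at h1
  exact h1.eLpNorm_le (by positivity)
    ((hY.measurable_realApprox hε).sub (hY.measurable_realApprox hδ))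
    (B := B + C) (fun ω => (abs_sub _ _).trans (add_le_add (hB ω) (hC ω))) hm

/-- The approximations have a common limit in all `L^(2 m)`. -/
theorem exists_limit_realApprox (hY : IsStableMotion α κ Y P) (hκ : 0 < κ)
    (hα : 3 / 2 < α) (hα₂ : α ≤ 2) :
    ∃ (θ : Ω → ℝ) (k η : ℝ), Measurable θ ∧ 0 < η ∧ ∀ ε : ℝ, 0 < ε → ∀ m : ℕ, m ≠ 0 →
      eLpNorm (fun ω => realApprox Y ε ω - θ ω) (2 * m : ℕ) P ≤
        ENNReal.ofReal (k * ε ^ η * momentRoot m) := by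
  obtain ⟨k, η, hk, hη, h⟩ := hY.exists_eLpNorm_realApprox_sub_le hκ hα hα₂
  let u : ℕ → ℝ := fun n => (1 / 2) ^ n
  have hu : ∀ n, 0 < u n := fun n => by positivity
  have hanti : ∀ {n m}, n ≤ m → u m ≤ u n := fun hnm =>
    pow_le_pow_of_le_one (by norm_num) (by norm_num) hnm
  have hmeas : ∀ n, AEStronglyMeasurable (realApprox Y (u n)) P := fun n =>
    (hY.measurable_realApprox (hu n)).aestronglyMeasurable
  let q : ℝ := (1 / 2) ^ η
  have hq1 : q < 1 := Real.rpow_lt_one (by norm_num) (by norm_num) hη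
  have hq0 : 0 < q := by positivity
  have hlim : ∀ᵐ ω ∂P, ∃ l, Tendsto (fun n => realApprox Y (u n) ω) atTop (𝓝 l) := by
    -- Along `ε = 2 ^ (-n)` the `L²` distances are geometrically summable, which gives an almost
    -- sure limit. The `+ 1` makes the required inequality strict.
    refine Lp.ae_tendsto_of_cauchy_eLpNorm (p := (2 * 1 : ℕ))
      (B := fun N => ENNReal.ofReal ((k * momentRoot 1 + 1) * q ^ N)) hmeas (by simp) ?_ ?_
    · have := momentRoot_nonneg 1
      rw [← ENNReal.ofReal_tsum_of_nonneg (fun n => by positivity)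
        ((summable_geometric_of_lt_one hq0.le hq1).mul_left _)]
      exact ENNReal.ofReal_ne_top
    · intro N n m hn hm
      have := momentRoot_nonneg 1
      refine (h (u N) (u n) (u m) (hu n) (hu m) (hanti hn) (hanti hm) 1 one_ne_zero).trans_lt ?_
      have hqN : u N ^ η = q ^ N := by
        simp only [u, q]
        rw [← Real.rpow_natCast, ← Real.rpow_natCast, ← Real.rpow_mul (by norm_num),
          ← Real.rpow_mul (by norm_num), mul_comm]
      rw [hqN]
      refine (ENNReal.ofReal_lt_ofReal_iff (by positivity)).2 ?_
      have : 0 < q ^ N := by positivity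
      nlinarith
  obtain ⟨θ, hθm, hθ⟩ := exists_stronglyMeasurable_limit_of_tendsto_ae hmeas hlim
  refine ⟨θ, k, η, hθm.measurable, hη, fun ε hε m hm => ?_⟩
  -- Fatou's lemma: the same almost sure limit inherits the bound for every `m`.
  refine Lp.eLpNorm_le_of_ae_tendsto (u := atTop)
    (f := fun n ω => realApprox Y ε ω - realApprox Y (u n) ω) ?_
    (fun n => (hY.measurable_realApprox hε).aestronglyMeasurable.sub (hmeas n)) ?_
  · have hu0 : Tendsto u atTop (𝓝 0) :=
      tendsto_pow_atTop_nhds_zero_of_lt_one (by norm_num) (by norm_num)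
    filter_upwards [hu0.eventually (gt_mem_nhds hε)] with n hn
    exact h ε ε (u n) hε (hu n) le_rfl hn.le m hm
  · filter_upwards [hθ] with ω hω
    exact tendsto_const_nhds.sub hω

omit [IsProbabilityMeasure P] in
theorem eLpNorm_dsltApprox_sub (hY : IsStableMotion α κ Y P) {X : ℝ≥0 → Ω → ℝ}
    (hXY : ∀ᵐ ω ∂P, ∀ t : ℝ, X t.toNNReal ω = Y t ω) {ε : ℝ} (hε : 0 < ε) (θ : Ω → ℝ) (q : ℝ≥0∞) :
    eLpNorm (fun ω => dsltApprox X ε ω - (θ ω : ℂ)) q P =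
      eLpNorm (fun ω => realApprox Y ε ω - θ ω) q P := by
  refine eLpNorm_congr_norm_ae ?_
  filter_upwards [hXY] with ω hω
  rw [hY.dsltApprox_eq hω hε, ← Complex.ofReal_sub, Complex.norm_real]

theorem exists_isDSLT (hY : IsStableMotion α κ Y P) (hκ : 0 < κ) (hα : 3 / 2 < α) (hα₂ : α ≤ 2)
    {X : ℝ≥0 → Ω → ℝ} (hXY : ∀ᵐ ω ∂P, ∀ t : ℝ, X t.toNNReal ω = Y t ω) :
    ∃ θ : Ω → ℝ, IsDSLT X P θ := by
  obtain ⟨θ, k, η, hθ, hη, h⟩ := hY.exists_limit_realApprox hκ hα hα₂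
  refine ⟨θ, hθ.aemeasurable, fun q hq => ?_⟩
  obtain ⟨m, hm⟩ := exists_nat_ge q
  have hm0 : m ≠ 0 := by
    rintro rfl
    exact absurd (hq.trans_le hm) (by simp)
  have hlim : Tendsto (fun ε : ℝ => ENNReal.ofReal (k * ε ^ η * momentRoot m)) (𝓝[>] 0) (𝓝 0) := by
    have h1 : Tendsto (fun ε : ℝ => k * ε ^ η * momentRoot m) (𝓝[>] 0)
        (𝓝 (k * 0 ^ η * momentRoot m)) :=
      ((((Real.continuous_rpow_const hη.le).tendsto 0).mono_left nhdsWithin_le_nhds).const_mul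
        k).mul_const _
    have h2 := ENNReal.tendsto_ofReal h1
    rwa [Real.zero_rpow hη.ne', mul_zero, zero_mul, ENNReal.ofReal_zero] at h2
  refine tendsto_of_tendsto_of_tendsto_of_le_of_le' tendsto_const_nhds hlim
    (Eventually.of_forall fun _ => zero_le) ?_
  filter_upwards [self_mem_nhdsWithin] with ε hε
  rw [hY.eLpNorm_dsltApprox_sub hXY hε]
  refine le_trans (eLpNorm_le_eLpNorm_of_exponent_le ?_
    ((hY.measurable_realApprox hε).sub hθ).aestronglyMeasurable) (h ε hε m hm0)
  have : (q : ℝ≥0∞) ≤ (m : ℝ≥0∞) := by exact_mod_cast hm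
  refine this.trans ?_
  exact_mod_cast (by omega : m ≤ 2 * m)

/-- The moment bounds on the approximations are uniform in `ε` and pass to any `L^(2 m)` limit, so
the argument does not depend on how `θ` was obtained. -/
theorem exists_integrable_exp (hY : IsStableMotion α κ Y P) (hκ : 0 < κ) (hα : 3 / 2 < α)
    {X : ℝ≥0 → Ω → ℝ} (hXY : ∀ᵐ ω ∂P, ∀ t : ℝ, X t.toNNReal ω = Y t ω) {θ : Ω → ℝ}
    (hθ : IsDSLT X P θ) {γ : ℝ} (hγ0 : 0 ≤ γ) (hγ : γ ≤ 1 / 2) :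
    ∃ M : ℝ, 0 < M ∧ Integrable (fun ω => Real.exp (M * |θ ω| ^ γ)) P := by
  obtain ⟨k, hk, h⟩ := hY.exists_eLpNorm_realApprox_le hκ hα
  refine exists_integrable_exp_of_eLpNorm_le hθ.aemeasurable hk (fun m hm => ?_) hγ0 hγ
  have hlim := hθ.tendsto (2 * m : ℕ) (by positivity)
  have hlim2 := hlim.const_add (ENNReal.ofReal (k * momentRoot m))
  rw [add_zero] at hlim2
  refine ge_of_tendsto hlim2 ?_
  filter_upwards [self_mem_nhdsWithin] with ε hε
  rw [hY.eLpNorm_dsltApprox_sub hXY hε, ENNReal.coe_natCast]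
  have hm1 := (hY.measurable_realApprox hε).aestronglyMeasurable (μ := P)
  have heq : θ = realApprox Y ε - fun ω => realApprox Y ε ω - θ ω := by
    funext ω
    simp
  calc eLpNorm θ (2 * m : ℕ) P
      = eLpNorm (realApprox Y ε - fun ω => realApprox Y ε ω - θ ω) (2 * m : ℕ) P := by rw [← heq]
    _ ≤ eLpNorm (realApprox Y ε) (2 * m : ℕ) P +
          eLpNorm (fun ω => realApprox Y ε ω - θ ω) (2 * m : ℕ) P :=
        eLpNorm_sub_le hm1 (hm1.sub hθ.aemeasurable.aestronglyMeasurable)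
          (by exact_mod_cast (by omega : 1 ≤ 2 * m))
    _ ≤ _ := by
        gcongr
        exact h ε hε m hm

end IsStableMotion

/-! ### Divergence of the second moments for `α ≤ 3 / 2` -/

section SineForm

/-- The density of the real approximation with respect to the frequency and the pair of times. -/
noncomputable def sineDensity {Ω : Type*} (Y : ℝ → Ω → ℝ) (ε : ℝ) (x : ℝ × (ℝ × ℝ)) (ω : Ω) : ℝ :=
  -(2 * Real.pi)⁻¹ * (x.1 * gaussWeight ε x.1) * Real.sin (x.1 * (Y x.2.1 ω - Y x.2.2 ω))

/-- Lebesgue measure on the pairs of a frequency and a pair of times in the triangle. -/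
noncomputable def frequencyTimeMeasure : Measure (ℝ × (ℝ × ℝ)) :=
  volume.prod (volume.restrict (timeTriangle 0 1))

instance : SFinite frequencyTimeMeasure := by
  unfold frequencyTimeMeasure
  infer_instance

/-- The sine form has a real integrand, and the sign of its covariances can be read off. -/
theorem derivKernel_eq_integral_sin {w : ℝ → ℝ} (hw : Integrable fun p => p * w p) (x : ℝ) :
    derivKernel w x = ∫ p, -(2 * Real.pi)⁻¹ * (p * w p) * Real.sin (p * x) := by
  have hint : Integrable fun p => derivCoeff w p * Complex.exp ((p * x : ℝ) * Complex.I) := by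
    refine Integrable.mono (g := derivCoeff w) (hw.ofReal.const_mul _) ?_
      (Eventually.of_forall fun p => ?_)
    · exact (hw.ofReal.const_mul _ : Integrable (derivCoeff w)).aestronglyMeasurable.mul
        (by fun_prop : Continuous fun p : ℝ =>
          Complex.exp ((p * x : ℝ) * Complex.I)).aestronglyMeasurable
    · rw [norm_mul, Complex.norm_exp_ofReal_mul_I, mul_one]
  have h := integral_re hint
  simp only [RCLike.re_to_complex] at h
  rw [derivKernel, ← h]
  congr 1
  funext p
  have e : derivCoeff w p * Complex.exp ((p * x : ℝ) * Complex.I) =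
      (((2 * Real.pi)⁻¹ * (p * w p) : ℝ) : ℂ) *
        (Complex.I * Complex.exp ((p * x : ℝ) * Complex.I)) := by
    rw [derivCoeff]
    push_cast
    rw [div_eq_mul_inv]
    ring
  rw [e, Complex.re_ofReal_mul, Complex.I_mul_re, Complex.exp_ofReal_mul_I_im]
  ring

theorem abs_sineDensity_le {Ω : Type*} (Y : ℝ → Ω → ℝ) (ε : ℝ) (x : ℝ × (ℝ × ℝ)) (ω : Ω) :
    |sineDensity Y ε x ω| ≤ |x.1 * gaussWeight ε x.1| := by
  have h1 : |(2 * Real.pi)⁻¹| ≤ 1 := by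
    rw [abs_of_pos (by positivity)]
    exact inv_le_one_of_one_le₀ (by linarith [Real.pi_gt_three])
  rw [sineDensity, abs_mul, abs_mul, abs_neg]
  calc |(2 * Real.pi)⁻¹| * |x.1 * gaussWeight ε x.1| * |Real.sin (x.1 * (Y x.2.1 ω - Y x.2.2 ω))|
      ≤ 1 * |x.1 * gaussWeight ε x.1| * 1 := by
        gcongr
        exact Real.abs_sin_le_one _
    _ = _ := by ring

theorem integrable_frequency_weight {ε : ℝ} (hε : 0 < ε) :
    Integrable (fun x : ℝ × (ℝ × ℝ) => |x.1 * gaussWeight ε x.1|) frequencyTimeMeasure := by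
  have : IsFiniteMeasure ((volume : Measure (ℝ × ℝ)).restrict (timeTriangle 0 1)) :=
    ⟨by rw [Measure.restrict_apply_univ]; exact (volume_timeTriangle_ne_top 0 1).lt_top⟩
  exact (integrable_mul_gaussWeight hε).abs.comp_fst _

end SineForm

namespace IsStableMotion

variable {Ω : Type*} [MeasurableSpace Ω] {P : Measure Ω} {α κ : ℝ} {Y : ℝ → Ω → ℝ}

theorem measurable_sineDensity (hY : IsStableMotion α κ Y P) (ε : ℝ) :
    Measurable fun y : (ℝ × (ℝ × ℝ)) × Ω => sineDensity Y ε y.1 y.2 := by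
  have e1 : Measurable fun y : (ℝ × (ℝ × ℝ)) × Ω => Y y.1.2.1 y.2 :=
    hY.measurable_uncurry.comp (measurable_fst.snd.fst.prodMk measurable_snd)
  have e2 : Measurable fun y : (ℝ × (ℝ × ℝ)) × Ω => Y y.1.2.2 y.2 :=
    hY.measurable_uncurry.comp (measurable_fst.snd.snd.prodMk measurable_snd)
  have e3 : Measurable fun y : (ℝ × (ℝ × ℝ)) × Ω => gaussWeight ε y.1.1 :=
    (measurable_gaussWeight ε).comp measurable_fst.fst
  have e4 : Measurable fun y : (ℝ × (ℝ × ℝ)) × Ω => y.1.1 := measurable_fst.fst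
  exact ((e4.mul e3).const_mul _).mul (e4.mul (e1.sub e2)).sin

theorem integrable_sineDensity (hY : IsStableMotion α κ Y P) {ε : ℝ} (hε : 0 < ε) (ω : Ω) :
    Integrable (fun x => sineDensity Y ε x ω) frequencyTimeMeasure :=
  (integrable_frequency_weight hε).mono'
    ((hY.measurable_sineDensity ε).comp measurable_prodMk_right).aestronglyMeasurable
    (Eventually.of_forall fun x => abs_sineDensity_le Y ε x ω)

theorem realApprox_eq_integral_sineDensity (hY : IsStableMotion α κ Y P) {ε : ℝ} (hε : 0 < ε)
    (ω : Ω) : realApprox Y ε ω = ∫ x, sineDensity Y ε x ω ∂frequencyTimeMeasure := by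
  have h := hY.integrable_sineDensity hε ω
  unfold frequencyTimeMeasure at h ⊢
  rw [integral_prod_symm _ h, realApprox, incrementIntegral]
  congr 1
  funext z
  exact derivKernel_eq_integral_sin (integrable_mul_gaussWeight hε) _

variable [IsProbabilityMeasure P]

/-- The covariance of the sines of two increments of the path. -/
noncomputable def sineCov (Y : ℝ → Ω → ℝ) (P : Measure Ω) (p q : ℝ) (z z' : ℝ × ℝ) : ℝ :=
  ∫ ω, Real.sin (p * (Y z.1 ω - Y z.2 ω)) * Real.sin (q * (Y z'.1 ω - Y z'.2 ω)) ∂P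

omit [IsProbabilityMeasure P] in
theorem integral_sineDensity_mul (Y : ℝ → Ω → ℝ) (ε : ℝ) (x y : ℝ × (ℝ × ℝ)) :
    ∫ ω, sineDensity Y ε x ω * sineDensity Y ε y ω ∂P =
      (2 * Real.pi)⁻¹ ^ 2 * (gaussWeight ε x.1 * gaussWeight ε y.1) *
        (x.1 * y.1 * sineCov Y P x.1 y.1 x.2 y.2) := by
  rw [sineCov, ← mul_assoc, ← integral_const_mul]
  congr 1
  funext ω
  rw [sineDensity, sineDensity]
  ring

theorem integrable_sineDensity_mul (hY : IsStableMotion α κ Y P) {ε : ℝ} (hε : 0 < ε) :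
    Integrable (fun y : Ω × ((ℝ × (ℝ × ℝ)) × (ℝ × (ℝ × ℝ))) =>
      sineDensity Y ε y.2.1 y.1 * sineDensity Y ε y.2.2 y.1)
      (P.prod (frequencyTimeMeasure.prod frequencyTimeMeasure)) := by
  have h := ((integrable_frequency_weight hε).mul_prod (integrable_frequency_weight hε)).comp_snd P
  refine h.mono' (Measurable.aestronglyMeasurable ?_) (Eventually.of_forall fun y => ?_)
  · exact ((hY.measurable_sineDensity ε).comp (measurable_snd.fst.prodMk measurable_fst)).mul
      ((hY.measurable_sineDensity ε).comp (measurable_snd.snd.prodMk measurable_fst))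
  · rw [Real.norm_eq_abs, abs_mul]
    exact mul_le_mul (abs_sineDensity_le _ _ _ _) (abs_sineDensity_le _ _ _ _) (abs_nonneg _)
      (abs_nonneg _)

theorem integral_realApprox_sq (hY : IsStableMotion α κ Y P) {ε : ℝ} (hε : 0 < ε) :
    ∫ ω, realApprox Y ε ω ^ 2 ∂P = ∫ x, (∫ ω, sineDensity Y ε x.1 ω * sineDensity Y ε x.2 ω ∂P)
      ∂(frequencyTimeMeasure.prod frequencyTimeMeasure) := by
  rw [← integral_integral_swap (hY.integrable_sineDensity_mul hε)]
  congr 1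
  funext ω
  rw [sq, hY.realApprox_eq_integral_sineDensity hε, ← integral_prod_mul]

/-- The characteristic function of three successive increments. -/
theorem integral_cos_three_increments (hY : IsStableMotion α κ Y P) {a b c d : ℝ} (ha : 0 ≤ a)
    (hab : a ≤ b) (hbc : b ≤ c) (hcd : c ≤ d) (u v w : ℝ) :
    ∫ ω, Real.cos (u * (Y b ω - Y a ω) + v * (Y c ω - Y b ω) + w * (Y d ω - Y c ω)) ∂P =
      Real.exp (-(κ * |u| ^ α * (b - a))) * Real.exp (-(κ * |v| ^ α * (c - b))) *
        Real.exp (-(κ * |w| ^ α * (d - c))) := by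
  have hmono : Monotone ![a, b, c, d] := by
    refine Fin.monotone_iff_le_succ.2 fun i => ?_
    fin_cases i <;> simp [hab, hbc, hcd]
  have h := hY.integral_exp_increments hmono ha ![u, v, w]
  simp only [Fin.sum_univ_three, Fin.prod_univ_three] at h
  have h2 := congrArg Complex.re h
  rw [Complex.ofReal_re, ← RCLike.re_to_complex, ← integral_re] at h2
  · simp only [RCLike.re_to_complex, Complex.exp_ofReal_mul_I_re] at h2
    exact h2
  · have e : ∀ t, Measurable (Y t) := hY.measurable
    refine (integrable_const (1 : ℝ)).mono' (Measurable.aestronglyMeasurable ?_)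
      (Eventually.of_forall fun ω => (Complex.norm_exp_ofReal_mul_I _).le)
    fun_prop

/-- Product-to-sum formula for sines. Two time intervals have four endpoints, so three successive
increments cover every relative position. -/
theorem integral_sin_mul_sin_three_increments (hY : IsStableMotion α κ Y P) {a b c d : ℝ}
    (ha : 0 ≤ a) (hab : a ≤ b) (hbc : b ≤ c) (hcd : c ≤ d) (u v w u' v' w' : ℝ) :
    ∫ ω, Real.sin (u * (Y b ω - Y a ω) + v * (Y c ω - Y b ω) + w * (Y d ω - Y c ω)) *
      Real.sin (u' * (Y b ω - Y a ω) + v' * (Y c ω - Y b ω) + w' * (Y d ω - Y c ω)) ∂P =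
      (Real.exp (-(κ * |u - u'| ^ α * (b - a))) * Real.exp (-(κ * |v - v'| ^ α * (c - b))) *
        Real.exp (-(κ * |w - w'| ^ α * (d - c))) -
      Real.exp (-(κ * |u + u'| ^ α * (b - a))) * Real.exp (-(κ * |v + v'| ^ α * (c - b))) *
        Real.exp (-(κ * |w + w'| ^ α * (d - c)))) / 2 := by
  have hint : ∀ u v w : ℝ, Integrable (fun ω =>
      Real.cos (u * (Y b ω - Y a ω) + v * (Y c ω - Y b ω) + w * (Y d ω - Y c ω))) P := by
    intro u v w
    have e : ∀ t, Measurable (Y t) := hY.measurable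
    exact (integrable_const (1 : ℝ)).mono' (Measurable.aestronglyMeasurable (by fun_prop))
      (Eventually.of_forall fun ω => Real.abs_cos_le_one _)
  rw [← hY.integral_cos_three_increments ha hab hbc hcd,
    ← hY.integral_cos_three_increments ha hab hbc hcd, ← integral_sub (hint _ _ _) (hint _ _ _),
    ← integral_div]
  congr 1
  funext ω
  set A := u * (Y b ω - Y a ω) + v * (Y c ω - Y b ω) + w * (Y d ω - Y c ω) with hA
  set B := u' * (Y b ω - Y a ω) + v' * (Y c ω - Y b ω) + w' * (Y d ω - Y c ω) with hB
  have e1 : (u - u') * (Y b ω - Y a ω) + (v - v') * (Y c ω - Y b ω) +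
      (w - w') * (Y d ω - Y c ω) = A - B := by rw [hA, hB]; ring
  have e2 : (u + u') * (Y b ω - Y a ω) + (v + v') * (Y c ω - Y b ω) +
      (w + w') * (Y d ω - Y c ω) = A + B := by rw [hA, hB]; ring
  rw [e1, e2]
  clear_value A B
  rw [Real.cos_sub, Real.cos_add]
  ring

omit [IsProbabilityMeasure P] in
theorem sineCov_comm (Y : ℝ → Ω → ℝ) (p q : ℝ) (z z' : ℝ × ℝ) :
    sineCov Y P p q z z' = sineCov Y P q p z' z := by
  simp only [sineCov, mul_comm]

theorem sineCov_disjoint (hY : IsStableMotion α κ Y P) {a b c d : ℝ} (ha : 0 ≤ a)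
    (hab : a ≤ b) (hbc : b ≤ c) (hcd : c ≤ d) (p q : ℝ) :
    sineCov Y P p q (b, a) (d, c) = 0 := by
  have h := hY.integral_sin_mul_sin_three_increments ha hab hbc hcd p 0 0 0 0 q
  simp only [zero_mul, add_zero, zero_add, sub_zero, zero_sub, abs_neg, sub_self, zero_div] at h
  exact h

theorem sineCov_interlaced (hY : IsStableMotion α κ Y P) {a b c d : ℝ} (ha : 0 ≤ a)
    (hab : a ≤ b) (hbc : b ≤ c) (hcd : c ≤ d) (p q : ℝ) :
    sineCov Y P p q (c, a) (d, b) =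
      Real.exp (-(κ * |p| ^ α * (b - a))) * Real.exp (-(κ * |q| ^ α * (d - c))) / 2 *
      (Real.exp (-(κ * |p - q| ^ α * (c - b))) - Real.exp (-(κ * |p + q| ^ α * (c - b)))) := by
  have h := hY.integral_sin_mul_sin_three_increments ha hab hbc hcd p p 0 0 q q
  simp only [zero_mul, add_zero, zero_add, sub_zero, zero_sub, abs_neg, ← mul_add,
    sub_add_sub_cancel'] at h
  rw [sineCov]
  simp only
  rw [h]
  ring

theorem sineCov_nested (hY : IsStableMotion α κ Y P) {a b c d : ℝ} (ha : 0 ≤ a)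
    (hab : a ≤ b) (hbc : b ≤ c) (hcd : c ≤ d) (p q : ℝ) :
    sineCov Y P p q (c, b) (d, a) =
      Real.exp (-(κ * |q| ^ α * (b - a))) * Real.exp (-(κ * |q| ^ α * (d - c))) / 2 *
      (Real.exp (-(κ * |p - q| ^ α * (c - b))) - Real.exp (-(κ * |p + q| ^ α * (c - b)))) := by
  have h := hY.integral_sin_mul_sin_three_increments ha hab hbc hcd 0 p 0 q q q
  simp only [zero_mul, add_zero, zero_add, zero_sub, abs_neg, ← mul_add,
    sub_add_sub_cancel'] at h
  rw [sineCov]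
  simp only
  rw [h]
  ring

/-- `p * q` has the sign of `|p + q| - |p - q|`. -/
theorem mul_exp_sub_exp_nonneg {κ α b : ℝ} (hκ : 0 ≤ κ) (hα : 0 ≤ α) (hb : 0 ≤ b) (p q : ℝ) :
    0 ≤ p * q * (Real.exp (-(κ * |p - q| ^ α * b)) - Real.exp (-(κ * |p + q| ^ α * b))) := by
  rcases le_total 0 (p * q) with h | h
  · refine mul_nonneg h (sub_nonneg.2 (Real.exp_le_exp.2 (neg_le_neg ?_)))
    have : |p - q| ≤ |p + q| := sq_le_sq.1 (by nlinarith)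
    gcongr
  · refine mul_nonneg_of_nonpos_of_nonpos h (sub_nonpos.2 (Real.exp_le_exp.2 (neg_le_neg ?_)))
    have : |p + q| ≤ |p - q| := sq_le_sq.1 (by nlinarith)
    gcongr

/-- After ordering the intervals by their left endpoints they are disjoint, interlaced or nested,
and each case is explicit. Nonnegativity allows the second moment to be bounded below by restricting
to any convenient region. -/
theorem mul_sineCov_nonneg (hY : IsStableMotion α κ Y P) (hκ : 0 ≤ κ) (hα : 0 ≤ α) {z z' : ℝ × ℝ}
    (hz : z ∈ timeTriangle 0 1) (hz' : z' ∈ timeTriangle 0 1) (p q : ℝ) :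
    0 ≤ p * q * sineCov Y P p q z z' := by
  wlog h : z.2 ≤ z'.2 generalizing z z' p q
  · rw [sineCov_comm, mul_comm p q]
    exact this hz' hz q p (le_of_not_ge h)
  obtain ⟨t, s⟩ := z
  obtain ⟨t', s'⟩ := z'
  obtain ⟨hs, hst, -⟩ := hz
  obtain ⟨-, hst', -⟩ := hz'
  simp only at h hs hst hst'
  rcases le_total t s' with h1 | h1
  · rw [hY.sineCov_disjoint hs.le hst h1 hst', mul_zero]
  rcases le_total t t' with h2 | h2
  · rw [hY.sineCov_interlaced hs.le h h1 h2, mul_left_comm]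
    exact mul_nonneg (by positivity) (mul_exp_sub_exp_nonneg hκ hα (sub_nonneg.2 h1) p q)
  · rw [sineCov_comm, hY.sineCov_nested hs.le h hst' h2, mul_left_comm, mul_comm p q]
    exact mul_nonneg (by positivity) (mul_exp_sub_exp_nonneg hκ hα (sub_nonneg.2 hst') q p)

/-- A lower bound for the covariance at nearly equal frequencies, over nearly equal time
intervals. -/
theorem le_sineCov (hY : IsStableMotion α κ Y P) (hκ : 0 < κ) (hα₁ : 1 ≤ α) (hα₂ : α ≤ 2)
    {p q a b c d : ℝ} (hp : 8 + 4 / κ ≤ p) (hpq : p ≤ q) (hqp : q ≤ p + 1) (ha : 0 ≤ a)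
    (hab : a ≤ b) (hcd : c ≤ d) (hba : b - a ≤ p ^ (-α)) (hdc : d - c ≤ p ^ (-α))
    (hbc : b + 1 / 4 ≤ c) (hcb : c ≤ b + 1 / 2) :
    Real.exp (-(9 * κ)) / 4 ≤ sineCov Y P p q (c, b) (d, a) := by
  have hκ4 : 0 < 4 / κ := by positivity
  have hp0 : 0 < p := by linarith
  have hq : q ^ α ≤ 4 * p ^ α := by
    calc q ^ α ≤ (2 * p) ^ α := Real.rpow_le_rpow (by linarith) (by linarith) (by linarith)
      _ = 2 ^ α * p ^ α := Real.mul_rpow (by norm_num) hp0.le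
      _ ≤ 2 ^ (2 : ℝ) * p ^ α := by gcongr; norm_num
      _ = 4 * p ^ α := by norm_num
  -- The two outer increments have frequency `q ≤ 2 * p` and length at most `p ^ (-α)`, so their
  -- exponentials stay bounded below.
  have hexp : ∀ x, 0 ≤ x → x ≤ p ^ (-α) → Real.exp (-(4 * κ)) ≤ Real.exp (-(κ * |q| ^ α * x)) := by
    intro x hx0 hx
    refine Real.exp_le_exp.2 (neg_le_neg ?_)
    rw [abs_of_pos (by linarith)]
    calc κ * q ^ α * x ≤ κ * (4 * p ^ α) * p ^ (-α) := by gcongr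
      _ = 4 * κ * (p ^ α * p ^ (-α)) := by ring
      _ = 4 * κ := by rw [← Real.rpow_add hp0, add_neg_cancel, Real.rpow_zero, mul_one]
  have h1 : Real.exp (-(κ / 2)) ≤ Real.exp (-(κ * |p - q| ^ α * (c - b))) := by
    refine Real.exp_le_exp.2 (neg_le_neg ?_)
    have : |p - q| ^ α ≤ 1 := Real.rpow_le_one (abs_nonneg _)
      (abs_le.2 ⟨by linarith, by linarith⟩) (by linarith)
    calc κ * |p - q| ^ α * (c - b) ≤ κ * 1 * (1 / 2) := by gcongr; linarith; linarith
      _ = κ / 2 := by ring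
  -- The threshold `8 + 4 / κ` is chosen to make this exponent at least `κ / 2 + 1`, so that the
  -- subtracted exponential is at most half of the bound `h1` for the other.
  have h2 : Real.exp (-(κ * |p + q| ^ α * (c - b))) ≤ Real.exp (-(κ / 2)) / 2 := by
    have h3 : p ≤ |p + q| ^ α := by
      rw [abs_of_pos (by linarith)]
      calc p ≤ p + q := by linarith
        _ ≤ (p + q) ^ α := Real.self_le_rpow_of_one_le (by linarith) hα₁
    have h4 : κ / 2 + 1 ≤ κ * |p + q| ^ α * (c - b) := by
      calc κ / 2 + 1 ≤ κ * (8 + 4 / κ) * (1 / 4) := by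
            rw [mul_add, mul_div_cancel₀ _ hκ.ne']
            linarith
        _ ≤ κ * p * (1 / 4) := by gcongr
        _ ≤ _ := by gcongr; linarith
    have h5 : Real.exp (-1) ≤ 1 / 2 := by
      rw [Real.exp_neg, inv_le_comm₀ (Real.exp_pos _) (by norm_num)]
      linarith [Real.add_one_le_exp 1]
    calc Real.exp (-(κ * |p + q| ^ α * (c - b))) ≤ Real.exp (-(κ / 2) + -1) :=
          Real.exp_le_exp.2 (by linarith)
      _ ≤ _ := by
        rw [Real.exp_add]
        linarith [mul_le_mul_of_nonneg_left h5 (Real.exp_pos (-(κ / 2))).le]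
  rw [hY.sineCov_nested ha hab (by linarith) hcd]
  have h6 : Real.exp (-(9 * κ)) ≤ Real.exp (-(4 * κ)) * Real.exp (-(4 * κ)) *
      Real.exp (-(κ / 2)) := by
    rw [← Real.exp_add, ← Real.exp_add]
    exact Real.exp_le_exp.2 (by linarith)
  calc Real.exp (-(9 * κ)) / 4
      ≤ Real.exp (-(4 * κ)) * Real.exp (-(4 * κ)) / 2 * (Real.exp (-(κ / 2)) / 2) := by linarith
    _ ≤ _ := mul_le_mul (div_le_div_of_nonneg_right (mul_le_mul (hexp _ (by linarith) hba)
        (hexp _ (by linarith) hdc) (Real.exp_pos _).le (Real.exp_pos _).le) zero_le_two)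
        (by linarith) (by positivity) (by positivity)

/-- Tonelli, available because the integrand is nonnegative. Lower integrals can then be restricted
to sets depending on the outer variables without further integrability checks. -/
theorem ofReal_integral_realApprox_sq (hY : IsStableMotion α κ Y P) (hκ : 0 ≤ κ) (hα : 0 ≤ α)
    {ε : ℝ} (hε : 0 < ε) :
    ENNReal.ofReal (∫ ω, realApprox Y ε ω ^ 2 ∂P) =
      ∫⁻ p, ∫⁻ z in timeTriangle 0 1, ∫⁻ q, ∫⁻ z' in timeTriangle 0 1,
        ENNReal.ofReal (∫ ω, sineDensity Y ε (p, z) ω * sineDensity Y ε (q, z') ω ∂P) := by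
  have hmeas : Measurable fun x : (ℝ × (ℝ × ℝ)) × (ℝ × (ℝ × ℝ)) =>
      ∫ ω, sineDensity Y ε x.1 ω * sineDensity Y ε x.2 ω ∂P := by
    have h : Measurable fun y : ((ℝ × (ℝ × ℝ)) × (ℝ × (ℝ × ℝ))) × Ω =>
        sineDensity Y ε y.1.1 y.2 * sineDensity Y ε y.1.2 y.2 :=
      ((hY.measurable_sineDensity ε).comp (measurable_fst.fst.prodMk measurable_snd)).mul
        ((hY.measurable_sineDensity ε).comp (measurable_fst.snd.prodMk measurable_snd))
    exact (h.stronglyMeasurable.integral_prod_right (ν := P)).measurable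
  have hmem : ∀ᵐ x ∂frequencyTimeMeasure, x.2 ∈ timeTriangle 0 1 :=
    Measure.quasiMeasurePreserving_snd.ae (ae_restrict_mem (measurableSet_timeTriangle 0 1))
  rw [hY.integral_realApprox_sq hε, ofReal_integral_eq_lintegral_ofReal
    (hY.integrable_sineDensity_mul hε).integral_prod_right,
    lintegral_prod _ hmeas.ennreal_ofReal.aemeasurable]
  · have h1 : Measurable fun x : ℝ × (ℝ × ℝ) => ∫⁻ y, ENNReal.ofReal
        (∫ ω, sineDensity Y ε x ω * sineDensity Y ε y ω ∂P) ∂frequencyTimeMeasure :=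
      hmeas.ennreal_ofReal.lintegral_prod_right
    refine (lintegral_prod _ h1.aemeasurable).trans ?_
    refine lintegral_congr fun p => lintegral_congr fun z => ?_
    refine lintegral_prod _ ?_
    exact (hmeas.ennreal_ofReal.comp measurable_prodMk_left).aemeasurable
  · filter_upwards [Measure.quasiMeasurePreserving_fst.ae hmem,
      Measure.quasiMeasurePreserving_snd.ae hmem] with x hx1 hx2
    rw [Pi.zero_apply, integral_sineDensity_mul]
    have h1 := gaussWeight_pos ε x.1.1
    have h2 := gaussWeight_pos ε x.2.1
    exact mul_nonneg (by positivity) (hY.mul_sineCov_nonneg hκ hα hx1 hx2 _ _)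

theorem le_ofReal_integral_sineDensity_mul (hY : IsStableMotion α κ Y P) (hκ : 0 < κ)
    (hα₁ : 1 ≤ α) (hα₂ : α ≤ 2) {ε L p q a b c d : ℝ} (hε : 0 ≤ ε) (hεL : ε * (L + 1) ^ 2 ≤ 2)
    (hpL : p ≤ L) (hp : 8 + 4 / κ ≤ p) (hpq : p ≤ q) (hqp : q ≤ p + 1) (ha : 0 ≤ a)
    (hab : a ≤ b) (hcd : c ≤ d) (hba : b - a ≤ p ^ (-α)) (hdc : d - c ≤ p ^ (-α))
    (hbc : b + 1 / 4 ≤ c) (hcb : c ≤ b + 1 / 2) :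
    ENNReal.ofReal ((2 * Real.pi)⁻¹ ^ 2 * Real.exp (-2) * (Real.exp (-(9 * κ)) / 4) * p ^ 2) ≤
      ENNReal.ofReal
        (∫ ω, sineDensity Y ε (p, (c, b)) ω * sineDensity Y ε (q, (d, a)) ω ∂P) := by
  refine ENNReal.ofReal_le_ofReal ?_
  have hκ4 : 0 < 4 / κ := by positivity
  have h := hY.le_sineCov hκ hα₁ hα₂ hp hpq hqp ha hab hcd hba hdc hbc hcb
  -- Below the cutoff `L + 1` the Gaussian weights are at least `exp (-1)`.
  have hw : ∀ r, 0 ≤ r → r ≤ L + 1 → Real.exp (-1) ≤ gaussWeight ε r := by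
    intro r hr hrL
    refine Real.exp_le_exp.2 (neg_le_neg ?_)
    have : ε * r ^ 2 ≤ ε * (L + 1) ^ 2 := by gcongr
    linarith
  have hw2 : Real.exp (-2) ≤ gaussWeight ε p * gaussWeight ε q := by
    have e : Real.exp (-2) = Real.exp (-1) * Real.exp (-1) := by
      rw [← Real.exp_add]
      norm_num
    rw [e]
    exact mul_le_mul (hw p (by linarith) (by linarith)) (hw q (by linarith) (by linarith))
      (Real.exp_pos _).le (gaussWeight_pos _ _).le
  rw [integral_sineDensity_mul]
  simp only
  have hp0 : 0 < p := by linarith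
  have hpq2 : p ^ 2 ≤ p * q := by nlinarith
  calc (2 * Real.pi)⁻¹ ^ 2 * Real.exp (-2) * (Real.exp (-(9 * κ)) / 4) * p ^ 2
      = (2 * Real.pi)⁻¹ ^ 2 * Real.exp (-2) * (p ^ 2 * (Real.exp (-(9 * κ)) / 4)) := by ring
    _ ≤ _ := by
      have h1 := gaussWeight_pos ε p
      have h2 := gaussWeight_pos ε q
      have h3 : 0 ≤ p * q := (sq_nonneg p).trans hpq2
      gcongr

/-- The second moments of the approximations grow at least logarithmically if `α ≤ 3 / 2`. -/
theorem log_le_integral_realApprox_sq (hY : IsStableMotion α κ Y P) (hκ : 0 < κ)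
    (hα₁ : 1 ≤ α) (hα₂ : α ≤ 3 / 2) {ε L : ℝ} (hε : 0 < ε) (hεL : ε * (L + 1) ^ 2 ≤ 2)
    (hL : 8 + 4 / κ ≤ L) :
    (2 * Real.pi)⁻¹ ^ 2 * Real.exp (-2) * (Real.exp (-(9 * κ)) / 4) / 64 *
      Real.log (L / (8 + 4 / κ)) ≤ ∫ ω, realApprox Y ε ω ^ 2 ∂P := by
  set R := 8 + 4 / κ with hR
  set C := (2 * Real.pi)⁻¹ ^ 2 * Real.exp (-2) * (Real.exp (-(9 * κ)) / 4) with hC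
  have hC0 : 0 < C := by positivity
  have hR8 : 8 ≤ R := by
    have : 0 < 4 / κ := by positivity
    linarith
  have hnn : 0 ≤ ∫ ω, realApprox Y ε ω ^ 2 ∂P := integral_nonneg fun ω => sq_nonneg _
  refine (ENNReal.ofReal_le_ofReal_iff hnn).1 ?_
  rw [hY.ofReal_integral_realApprox_sq hκ.le (by linarith) hε]
  have hinv : C / 64 * Real.log (L / R) = ∫ p in Set.Icc R L, C / 64 * p⁻¹ := by
    rw [integral_Icc_eq_integral_Ioc, ← intervalIntegral.integral_of_le hL,
      intervalIntegral.integral_const_mul, integral_inv_of_pos (by linarith) (by linarith)]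
  rw [hinv, ofReal_integral_eq_lintegral_ofReal]
  rotate_left
  · refine ContinuousOn.integrableOn_compact isCompact_Icc (ContinuousOn.mul continuousOn_const ?_)
    exact continuousOn_inv₀.mono fun x hx => (show (0 : ℝ) < x by linarith [hx.1]).ne'
  · refine (ae_restrict_iff' measurableSet_Icc).2 (Eventually.of_forall fun p hp => ?_)
    have : 0 < p := by linarith [hp.1]
    simp only [Pi.zero_apply]
    positivity
  refine le_trans ?_ (setLIntegral_le_lintegral (Set.Icc R L) _)
  refine setLIntegral_mono' measurableSet_Icc fun p hp => ?_
  have hp8 : 8 ≤ p := hR8.trans hp.1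
  have hp0 : 0 < p := by linarith
  have hδ0 : 0 < p ^ (-α) := by positivity
  have hδ : p ^ (-α) ≤ 1 / 8 := by
    calc p ^ (-α) ≤ p ^ (-1 : ℝ) :=
          Real.rpow_le_rpow_of_exponent_le (by linarith) (by linarith)
      _ = p⁻¹ := Real.rpow_neg_one p
      _ ≤ 1 / 8 := by
        rw [one_div]
        exact inv_anti₀ (by norm_num) hp8
  have hvol : ∀ u v : ℝ, volume (Set.Icc u (u + p ^ (-α)) ×ˢ Set.Icc (v - p ^ (-α)) v) =
      ENNReal.ofReal (p ^ (-α)) * ENNReal.ofReal (p ^ (-α)) := by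
    intro u v
    rw [Measure.volume_eq_prod, Measure.prod_prod, Real.volume_Icc, Real.volume_Icc,
      add_sub_cancel_left, sub_sub_cancel]
  -- For `(c, b)` in this box, `c - b` lies in `[1 / 4, 1 / 2]`, and since `p ^ (-α) ≤ 1 / 8` the
  -- enlarged interval `[a, d]` stays inside `[1 / 8, 7 / 8]`.
  have hbox : volume (Set.Icc (5 / 8 : ℝ) (3 / 4) ×ˢ Set.Icc (1 / 4 : ℝ) (3 / 8)) =
      ENNReal.ofReal (1 / 64) := by
    rw [Measure.volume_eq_prod, Measure.prod_prod, Real.volume_Icc, Real.volume_Icc,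
      ← ENNReal.ofReal_mul (by norm_num)]
    norm_num
  calc ENNReal.ofReal (C / 64 * p⁻¹)
      ≤ ENNReal.ofReal (C * p ^ 2 * (p ^ (-α) * p ^ (-α)) * (1 / 64)) := by
        refine ENNReal.ofReal_le_ofReal ?_
        -- The place where `α ≤ 3 / 2` enters: `2 - 2 * α ≥ -1`.
        have e : p⁻¹ ≤ p ^ 2 * (p ^ (-α) * p ^ (-α)) := by
          rw [← Real.rpow_two, ← Real.rpow_add hp0, ← Real.rpow_add hp0, ← Real.rpow_neg_one]
          exact Real.rpow_le_rpow_of_exponent_le (by linarith) (by linarith)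
        calc C / 64 * p⁻¹ ≤ C / 64 * (p ^ 2 * (p ^ (-α) * p ^ (-α))) := by gcongr
          _ = _ := by ring
    _ = ∫⁻ z in Set.Icc (5 / 8 : ℝ) (3 / 4) ×ˢ Set.Icc (1 / 4 : ℝ) (3 / 8),
          ∫⁻ q in Set.Icc p (p + 1),
          ∫⁻ z' in Set.Icc z.1 (z.1 + p ^ (-α)) ×ˢ Set.Icc (z.2 - p ^ (-α)) z.2,
            ENNReal.ofReal (C * p ^ 2) := by
        simp only [setLIntegral_const, hvol, Real.volume_Icc, hbox, add_sub_cancel_left,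
          ENNReal.ofReal_one, mul_one]
        rw [← ENNReal.ofReal_mul hδ0.le, ← ENNReal.ofReal_mul (by positivity),
          ← ENNReal.ofReal_mul (by positivity)]
    _ ≤ ∫⁻ z in Set.Icc (5 / 8 : ℝ) (3 / 4) ×ˢ Set.Icc (1 / 4 : ℝ) (3 / 8),
          ∫⁻ q, ∫⁻ z' in timeTriangle 0 1,
        ENNReal.ofReal (∫ ω, sineDensity Y ε (p, z) ω * sineDensity Y ε (q, z') ω ∂P) := by
        refine setLIntegral_mono' (measurableSet_Icc.prod measurableSet_Icc) fun z hz => ?_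
        obtain ⟨⟨hc1, hc2⟩, hb1, hb2⟩ := hz
        refine le_trans ?_ (setLIntegral_le_lintegral (Set.Icc p (p + 1)) _)
        refine setLIntegral_mono' measurableSet_Icc fun q hq => ?_
        refine le_trans ?_ (lintegral_mono_set
          (s := Set.Icc z.1 (z.1 + p ^ (-α)) ×ˢ Set.Icc (z.2 - p ^ (-α)) z.2) ?_)
        · refine setLIntegral_mono' (measurableSet_Icc.prod measurableSet_Icc) fun z' hz' => ?_
          obtain ⟨⟨hd1, hd2⟩, ha1, ha2⟩ := hz'
          exact hY.le_ofReal_integral_sineDensity_mul hκ hα₁ (by linarith) hε.le hεL hp.2 hp.1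
            hq.1 hq.2 (by linarith) ha2 hd1 (by linarith) (by linarith) (by linarith)
            (by linarith)
        · rintro z' ⟨⟨hd1, hd2⟩, ha1, ha2⟩
          exact ⟨by linarith, by linarith, by linarith⟩
    _ ≤ _ := by
        refine lintegral_mono_set ?_
        rintro z ⟨⟨hc1, hc2⟩, hb1, hb2⟩
        exact ⟨by linarith, by linarith, by linarith⟩

/-- If `α ≤ 3 / 2`, the approximations are unbounded in `L²`, so that there is no derivative of
self-intersection local time. -/
theorem not_isDSLT (hY : IsStableMotion α κ Y P) (hκ : 0 < κ) (hα₁ : 1 ≤ α) (hα₂ : α ≤ 3 / 2)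
    {X : ℝ≥0 → Ω → ℝ} (hXY : ∀ᵐ ω ∂P, ∀ t : ℝ, X t.toNNReal ω = Y t ω) (θ : Ω → ℝ) :
    ¬ IsDSLT X P θ := by
  intro hθ
  have hlim := hθ.tendsto 2 two_pos
  have hev : ∀ᶠ ε : ℝ in 𝓝[>] 0, eLpNorm (fun ω => realApprox Y ε ω - θ ω) 2 P < 1 ∧ 0 < ε := by
    filter_upwards [hlim.eventually (gt_mem_nhds one_pos), self_mem_nhdsWithin] with ε h1 h2
    refine ⟨?_, h2⟩
    rw [← hY.eLpNorm_dsltApprox_sub hXY h2]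
    exact h1
  obtain ⟨δ, hδ1, hδ⟩ := hev.exists
  obtain ⟨B, hB⟩ := exists_abs_realApprox_le Y hδ
  set C := (2 * Real.pi)⁻¹ ^ 2 * Real.exp (-2) * (Real.exp (-(9 * κ)) / 4) / 64 with hC
  have hC0 : 0 < C := by positivity
  set R := 8 + 4 / κ with hR
  have hR0 : 0 < R := by positivity
  -- From `x ^ 2 ≤ 2 * (x - y) ^ 2 + 2 * y ^ 2`, where `y` is the fixed bounded approximation at `δ`
  -- and the `L²` distance between the two is at most `2`.
  set M : ℝ := 8 + 2 * B ^ 2 with hM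
  have hM0 : 0 < M := by positivity
  -- With this cutoff the logarithmic lower bound is exactly `M + 1`.
  set L := R * Real.exp ((M + 1) / C) with hL
  have hRL : R ≤ L := le_mul_of_one_le_right hR0.le (Real.one_le_exp (by positivity))
  have hsmall : ∀ᶠ ε : ℝ in 𝓝[>] 0, ε * (L + 1) ^ 2 ≤ 2 := by
    have h1 : Tendsto (fun ε : ℝ => ε * (L + 1) ^ 2) (𝓝[>] 0) (𝓝 (0 * (L + 1) ^ 2)) :=
      (tendsto_id.mul_const _).mono_left nhdsWithin_le_nhds
    rw [zero_mul] at h1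
    filter_upwards [h1.eventually (gt_mem_nhds two_pos)] with ε h using h.le
  obtain ⟨ε, ⟨hε1, hε⟩, hεL⟩ := (hev.and hsmall).exists
  have hlow := hY.log_le_integral_realApprox_sq hκ hα₁ hα₂ hε hεL hRL
  rw [← hC, ← hR, hL, mul_div_cancel_left₀ _ hR0.ne', Real.log_exp,
    mul_div_cancel₀ _ hC0.ne'] at hlow
  have hθm := hθ.aemeasurable.aestronglyMeasurable
  have hεm := (hY.measurable_realApprox hε).aestronglyMeasurable (μ := P)
  have hδm := (hY.measurable_realApprox hδ).aestronglyMeasurable (μ := P)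
  have hdiff : eLpNorm (fun ω => realApprox Y ε ω - realApprox Y δ ω) 2 P ≤ 2 := by
    have e : (fun ω => realApprox Y ε ω - realApprox Y δ ω) =
        (fun ω => realApprox Y ε ω - θ ω) - fun ω => realApprox Y δ ω - θ ω := by
      funext ω
      simp
    rw [e]
    refine (eLpNorm_sub_le (hεm.sub hθm) (hδm.sub hθm) one_le_two).trans ?_
    exact (add_le_add hε1.le hδ1.le).trans_eq one_add_one_eq_two
  have hsq : ∫ ω, (realApprox Y ε ω - realApprox Y δ ω) ^ 2 ∂P ≤ 4 := by
    have hmem : MemLp (fun ω => realApprox Y ε ω - realApprox Y δ ω) 2 P :=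
      ⟨hεm.sub hδm, hdiff.trans_lt ENNReal.ofNat_lt_top⟩
    rw [hmem.eLpNorm_eq_integral_rpow_norm two_ne_zero ENNReal.ofNat_ne_top,
      ENNReal.ofReal_le_ofNat] at hdiff
    simp only [ENNReal.toReal_ofNat, Real.rpow_two, Real.norm_eq_abs, sq_abs] at hdiff
    rwa [Real.rpow_inv_le_iff_of_pos (integral_nonneg fun ω => sq_nonneg _) zero_le_two two_pos,
      show (2 : ℝ) ^ (2 : ℝ) = 4 by norm_num] at hdiff
  obtain ⟨B', hB'⟩ := exists_abs_realApprox_le Y hε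
  have hup : ∫ ω, realApprox Y ε ω ^ 2 ∂P ≤ M := by
    have hint : Integrable (fun ω => (realApprox Y ε ω - realApprox Y δ ω) ^ 2) P := by
      refine (integrable_const ((B' + B) ^ 2)).mono' ((hεm.sub hδm).pow 2)
        (Eventually.of_forall fun ω => ?_)
      rw [Real.norm_eq_abs, abs_pow]
      gcongr
      exact (abs_sub _ _).trans (add_le_add (hB' ω) (hB ω))
    calc ∫ ω, realApprox Y ε ω ^ 2 ∂P
        ≤ ∫ ω, 2 * (realApprox Y ε ω - realApprox Y δ ω) ^ 2 + 2 * B ^ 2 ∂P := by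
          refine integral_mono_of_nonneg (Eventually.of_forall fun ω => sq_nonneg _)
            ((hint.const_mul 2).add (integrable_const _)) (Eventually.of_forall fun ω => ?_)
          have h1 : realApprox Y δ ω ^ 2 ≤ B ^ 2 :=
            sq_le_sq' (abs_le.1 (hB ω)).1 (abs_le.1 (hB ω)).2
          simp only
          nlinarith [sq_nonneg (realApprox Y ε ω - 2 * realApprox Y δ ω)]
      _ = 2 * ∫ ω, (realApprox Y ε ω - realApprox Y δ ω) ^ 2 ∂P + 2 * B ^ 2 := by
          rw [integral_add (hint.const_mul 2) (integrable_const _), integral_const_mul]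
          simp
      _ ≤ M := by linarith
  linarith

end IsStableMotion

theorem theorem3p1 {Ω : Type*} [MeasurableSpace Ω] (P : Measure Ω) [IsProbabilityMeasure P]
    (α : ℝ) (hα₁ : 4 / 3 < α) (hα₂ : α ≤ 2)
    (X : ℝ≥0 → Ω → ℝ) (hX : IsSymmetricStableProcess α X P) :
    (3 / 2 < α → ∃ θ : Ω → ℝ, IsDSLT X P θ) ∧
    ∀ θ : Ω → ℝ, IsDSLT X P θ →
      ∀ γ : ℝ, 0 ≤ γ → γ < 2 * α / (6 + α) →
        ∃ M : ℝ, 0 < M ∧ Integrable (fun ω => Real.exp (M * |θ ω| ^ γ)) P := by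
  obtain ⟨κ, Y, hκ, hY, hXY⟩ := hX.exists_isStableMotion (by linarith)
  refine ⟨fun hα => hY.exists_isDSLT hκ hα hα₂ hXY, fun θ hθ γ hγ0 hγ => ?_⟩
  rcases lt_or_ge (3 / 2) α with hα | hα
  · refine hY.exists_integrable_exp hκ hα hXY hθ hγ0 (hγ.le.trans ?_)
    rw [div_le_iff₀ (by linarith)]
    linarith
  · exact absurd hθ (hY.not_isDSLT hκ (by linarith) hα hXY θ)
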